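/- **Parameters.** Let $N,M\ge 0$ be integers with $(N,M)\neq(0,0)$, $n=N+M$, let $\lambda$ be a partition of $k\ge 0$, and let $u_1,\dots,u_n\in\mathbb C$. Let $q,t\in\mathbb C\setminus\{0\}$ be multiplicatively independent, i.e. $q^at^b=1$ with $a,b\in\mathbb Z$ only for $a=b=0$. Put $q_1=q$, $q_2=q^{-1}t$, $q_3=t^{-1}$; fix fourth roots $q^{1/4},t^{1/4}$ and use $q_1^{1/4}=q^{1/4}$, $q_2^{1/4}=q^{-1/4}t^{1/4}$, $q_3^{1/4}=t^{-1/4}$ for all fractional powers. Let $\vec c=(c_1,\dots,c_n)=(3^N1^M)$, $q_{\vec c}=\prod_l q_{c_l}$ and $\kappa_r=\prod_{i=1}^3(q_i^r-1)$. **Currents.** Let $\mathcal F$ be the Fock space with vacuum $|0\rangle$ of the commuting Heisenberg algebras generated by $a^{(l)}_{\pm r}$ ($1\le l\le n$, $r\ge1$) with $[a^{(l)}_r,a^{(l)}_{-s}]=\delta_{r,s}\frac{r}{\kappa_r}(q_{c_l}^{r/2}-q_{c_l}^{-r/2})$. With $C=q_{\vec c}^{1/2}$ and $C_l=q_{c_l}^{1/2}$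 put $$\tilde b_r=C^{-r}\sum_l\tfrac{\kappa_r}{r}q_{c_l}^{r/4}(C_1\cdots C_{l-1})^{r}a^{(l)}_r,\qquad \tilde b_{-r}=\sum_l\tfrac{\kappa_r}{r}q_{c_l}^{-r/4}(C_{l+1}\cdots C_n)^{-r}a^{(l)}_{-r},$$ $$\alpha(z)=\exp\Big(-\sum_{r\ge1}\tfrac{\tilde b_{-r}z^r}{C^r-C^{-r}}\Big),\qquad \beta(z)=\exp\Big(\sum_{r\ge1}\tfrac{\tilde b_rz^{-r}}{C^r-C^{-r}}\Big),$$ $$\varphi_l(z)=\exp\Big(-\sum_{r\ge1}\tfrac{\kappa_r}{r}q_{c_l}^{-r/4}a^{(l)}_{-r}z^r\Big),\qquad \eta_l(z)=\exp\Big(\sum_{r\ge1}\tfrac{\kappa_r}{r}\tfrac{q_{c_l}^{-r/4}}{q_{c_l}^{r/2}-q_{c_l}^{-r/2}}a^{(l)}_{-r}z^r\Big)\exp\Big(-\sum_{r\ge1}\tfrac{\kappa_r}{r}\tfrac{q_{c_l}^{r/4}}{q_{c_l}^{r}-1}a^{(l)}_{r}z^{-r}\Big),$$ $$\widetilde\Lambda_j(z)=u_j\,\alpha(z)\Big(\prod_{l<j}\varphi_l(C_1\cdots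 C_l\,z)\Big)\eta_j(C_1\cdots C_{j-1}z)\,\beta(z).$$ The current $\widetilde T_1(z)$ is defined by the Miura transformation: with $D_z$ the scaling operator $q_3^{D_z}g(z)=g(q_3z)$, $-\widetilde T_1(z)$ is the coefficient of $q_3^{-D_z}$ in the normally ordered product $:\widetilde R_1(z)\cdots\widetilde R_n(z):$ of $$\widetilde R_i(z)=\sum_{m\ge0}(-1)^mq_3^{m^2/2}q_{c_i}^{-m/2}\prod_{\ell=0}^{m-1}\frac{1-q_3^{\ell-m+1}q_{c_i}}{1-q_3^{\ell+1}}\,:\widetilde\Lambda_i(z)\widetilde\Lambda_i(q_3^{-1}z)\cdots\widetilde\Lambda_i(q_3^{-(m-1)}z):\,q_3^{-mD_z}.$$ Let $$f^{\vec c}_{11}(x)=\exp\Big(\sum_{r\ge1}\frac{x^r}{r}\,\frac{(q_{\vec c}^{r/2}q_3^{-r/2}-q_{\vec c}^{-r/2}q_3^{r/2})(q_1^{r/2}-q_1^{-r/2})(q_2^{r/2}-q_2^{-r/2})}{q_{\vec c}^{r/2}-q_{\vec c}^{-r/2}}\Big)\in\mathbb C[[x]].$$ **Diagrams.** Number the boxes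 of $\lambda$ by $1,\dots,k$ row by row, from left to right, and let box $a$ lie in row $\mathrm{row}(a)$ and column $\mathrm{col}(a)$, both counted from $0$. A filling $(i_1,\dots,i_k)\in\{1,\dots,n\}^k$ belongs to $\mathrm{RSSYBT}(N,M;\lambda)$ (reverse semistandard Young bitableaux of type $(N,M)$ and shape $\lambda$) if its entries weakly decrease along rows and down columns, its super numbers (entries $>N$) strictly decrease along each row, and its ordinary numbers (entries $\le N$) strictly decrease down each column. Put $$\mathcal N_\lambda(z)=\prod_{\mathrm{row}(i)<\mathrm{row}(j)}\Delta\big(q_3^{-1/2}z_j/z_i\big)^{-1},\qquad \Delta(z)=\frac{(1-q_1q_3^{1/2}z)(1-q_1^{-1}q_3^{-1/2}z)}{(1-q_3^{1/2}z)(1-q_3^{-1/2}z)},\qquad y_j=\frac{q_{c_j}^{1/2}-q_{c_j}^{-1/2}}{q_3^{1/2}-q_3^{-1/2}},$$ $$\mathcal D^{(i,j)}(x)=\begin{cases}\dfrac{(1-q_1^{-1}x)(1-q_2^{-1}x)}{(1-q_3x)(1-x)}& i<j\\[2mm] \dfrac{(1-q_1^{-1}x)(1-q_1x)}{(1-q_3^{-1}x)(1-q_3x)}&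 i=j>N\\[2mm] 1& i=j\le N\\[1mm] \dfrac{(1-q_1x)(1-q_2x)}{(1-q_3^{-1}x)(1-x)}& i>j.\end{cases}$$ For $g\in\mathbb C(z_1,\dots,z_k)$ write $\operatorname{Lim}_\lambda g$ for the limit as $\xi\to t^{-1}$ of the specialisation of $g$ at $z_a=q^{\mathrm{col}(a)}\xi^{\mathrm{row}(a)}y$ ($1\le a\le k$, $y\ne0$); "$\operatorname{Lim}_\lambda g$ exists" means that for each $y\neq 0$ the specialisation is defined for all $\xi\neq t^{-1}$ near $t^{-1}$ and that the limit exists and does not depend on $y$. **Claim.** The formal series $\mathcal N_\lambda(z)\prod_{1\le i<j\le k}f^{\vec c}_{11}(z_j/z_i)\,\langle0|\widetilde T_1(z_1)\cdots\widetilde T_1(z_k)|0\rangle$ is the expansion in the region $|z_1|\gg\cdots\gg|z_k|$ of a rational function of $z_1,\dots,z_k$, and all limits below exist, with $$\operatorname{Lim}_\lambda\Big[\mathcal N_\lambda(z)\prod_{i<j}f^{\vec c}_{11}\Big(\frac{z_j}{z_i}\Big)\langle0|\widetilde T_1(z_1)\cdots\widetilde T_1(z_k)|0\rangle\Big]=\sum_{(i_1,\dots,i_k)\in\mathrm{RSSYBT}(N,M;\lambda)}\operatorname{Lim}_\lambda\Big[\prod_{a=1}^k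 y_{i_a}u_{i_a}\;\mathcal N_\lambda(z)\prod_{1\le a<b\le k}\mathcal D^{(i_a,i_b)}\Big(\frac{z_b}{z_a}\Big)\Big].$$ Moreover, for every filling $(i_1,\dots,i_k)\in\{1,\dots,n\}^k$ that is not in $\mathrm{RSSYBT}(N,M;\lambda)$, the limit $\operatorname{Lim}_\lambda$ of the same bracket exists and equals $0$. -/

import Mathlib

open Filter Topology

noncomputable section

namespace QuantumCorner

/-! ### Parameters

The three parameters `q₁, q₂, q₃` are indexed by `0, 1, 2 : Fin 3`. A fixed choice of fourth roots
`ρ i = q_{i+1}^{1/4}` is carried along, and every fractional power is a power of it. -/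

/-- `q_i`. -/
def qPar (ρ : Fin 3 → ℂ) (i : Fin 3) : ℂ := ρ i ^ 4

/-- `q_i^{1/2}`. -/
def qHalf (ρ : Fin 3 → ℂ) (i : Fin 3) : ℂ := ρ i ^ 2

/-- `κ_r = (q₁^r - 1)(q₂^r - 1)(q₃^r - 1)`. -/
def kappa (ρ : Fin 3 → ℂ) (r : ℕ) : ℂ := ∏ i, (qPar ρ i ^ r - 1)

/-- The fourth roots for `q₁ = q`, `q₂ = q⁻¹ t`, `q₃ = t⁻¹`, from `q^{1/4}` and `t^{1/4}`. -/
def specRoots (qr tr : ℂ) : Fin 3 → ℂ := ![qr, qr⁻¹ * tr, tr⁻¹]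

/-! ### Formal exponentials -/

/-- `exp f = ∑_j f^j / j!` for a power series `f` with zero constant term, whose coefficients lie in
a possibly noncommutative algebra (the powers `f^j` with `j > m` do not contribute in degree `m`). -/
def expSeries {A : Type*} [Ring A] [Algebra ℂ A] (f : PowerSeries A) : PowerSeries A :=
  PowerSeries.mk fun m =>
    ∑ j ∈ Finset.range (m + 1), ((j.factorial : ℂ)⁻¹) • PowerSeries.coeff m (f ^ j)

/-! ### The Fock space and the Heisenberg operators -/

/-- The tensor product `ℋ^{(c₁)} ⊗ ⋯ ⊗ ℋ^{(c_n)}`. The monomial `∏ X (l, r_i)` is the basis vector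
obtained from the vacuum `1` by the operators `a_{-r_i}` of the `l`-th tensor factors. -/
abbrev Fock (n : ℕ) : Type := MvPolynomial (Fin n × ℕ+) ℂ

/-- `⟨0| v`: the coefficient of the vacuum in `v`. -/
def vacuumCoeff {n : ℕ} (v : Fock n) : ℂ := MvPolynomial.constantCoeff v

/-- `a_{-r}` (`r ≥ 1`) on the `l`-th tensor factor. -/
def aNeg {n : ℕ} (l : Fin n) (r : ℕ) : Module.End ℂ (Fock n) :=
  if h : 0 < r then LinearMap.mulLeft ℂ (MvPolynomial.X (l, (⟨r, h⟩ : ℕ+))) else 0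

/-- `a_r` (`r ≥ 1`) on the `l`-th tensor factor, which carries the Fock space of colour `c l`. It
kills the vacuum and satisfies `[a_r, a_{-r}] = (r / κ_r) (q^{r/2} - q^{-r/2})` with `q = q_{c l}`. -/
def aPos {n : ℕ} (ρ : Fin 3 → ℂ) (c : Fin n → Fin 3) (l : Fin n) (r : ℕ) :
    Module.End ℂ (Fock n) :=
  if h : 0 < r then
    ((r : ℂ) / kappa ρ r * (qHalf ρ (c l) ^ r - (qHalf ρ (c l))⁻¹ ^ r)) •
      (MvPolynomial.pderiv (R := ℂ) (l, (⟨r, h⟩ : ℕ+))).toLinearMap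
  else 0

section Vertex

variable {n : ℕ} (ρ : Fin 3 → ℂ) (c : Fin n → Fin 3)

/-- `∏_{m < l} q_{c_m}^{1/2}`, the value of `C` on the tensor factors before the `l`-th one. -/
def cBefore (l : Fin n) : ℂ := ∏ m ∈ Finset.univ.filter (· < l), qHalf ρ (c m)

/-- `∏_{m > l} q_{c_m}^{1/2}`, the value of `C` on the tensor factors after the `l`-th one. -/
def cAfter (l : Fin n) : ℂ := ∏ m ∈ Finset.univ.filter (l < ·), qHalf ρ (c m)

/-- The value `q_c^{1/2} = ∏_l q_{c_l}^{1/2}` of the central element `C` on the whole space. -/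
def cAll : ℂ := ∏ l, qHalf ρ (c l)

/-- The coefficient of `z^{-r}` in `log K⁺(z)`. On one factor, `K⁺(z)` is
`exp (∑ (κ_r / r) q^{r/4} a_r z^{-r})`; by `Δ K⁺(z) = K⁺(z) ⊗ K⁺(C₁⁻¹ z)` the current
`K⁺((C₁ ⋯ C_{l-1})⁻¹ z)` acts on the `l`-th factor of the tensor product. -/
def logKPlus (r : ℕ) : Module.End ℂ (Fock n) :=
  ∑ l, (kappa ρ r / r * ρ (c l) ^ r * cBefore ρ c l ^ r) • aPos ρ c l r

/-- The coefficient of `z^r` in `log K⁻(z)`. On one factor, `K⁻(z)` is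
`exp (- ∑ (κ_r / r) q^{-r/4} a_{-r} z^r)`; by `Δ K⁻(z) = K⁻(C₂⁻¹ z) ⊗ K⁻(z)` the current
`K⁻((C_{l+1} ⋯ C_n)⁻¹ z)` acts on the `l`-th factor of the tensor product. -/
def logKMinus (r : ℕ) : Module.End ℂ (Fock n) :=
  ∑ l, (-(kappa ρ r / r) * (ρ (c l))⁻¹ ^ r * (cAfter ρ c l)⁻¹ ^ r) • aNeg l r

/-- `b̃_r` (`r ≥ 1`), from `K⁺(z) = exp (∑ b̃_r C^r z^{-r})`. -/
def bPos (r : ℕ) : Module.End ℂ (Fock n) := (cAll ρ c)⁻¹ ^ r • logKPlus ρ c r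

/-- `b̃_{-r}` (`r ≥ 1`), from `K⁻(z) = exp (- ∑ b̃_{-r} z^r)`. -/
def bNeg (r : ℕ) : Module.End ℂ (Fock n) := -logKMinus ρ c r

/-! In the following operators `x` is a scalar and the series is the one in the argument `x z`;
the variable of the power series is `z` for the creation parts, `z⁻¹` for the annihilation parts. -/

/-- `α(x z)`, in the variable `z`. -/
def alphaOp (x : ℂ) : PowerSeries (Module.End ℂ (Fock n)) :=
  expSeries (PowerSeries.mk fun r =>
    (-(1 / (cAll ρ c ^ r - (cAll ρ c)⁻¹ ^ r)) * x ^ r) • bNeg ρ c r)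

/-- `β(x z)`, in the variable `z⁻¹`. -/
def betaOp (x : ℂ) : PowerSeries (Module.End ℂ (Fock n)) :=
  expSeries (PowerSeries.mk fun r =>
    (1 / (cAll ρ c ^ r - (cAll ρ c)⁻¹ ^ r) * x⁻¹ ^ r) • bPos ρ c r)

/-- `φ^{(c_l)}(x z)` on the `l`-th factor, in the variable `z`. -/
def phiOp (l : Fin n) (x : ℂ) : PowerSeries (Module.End ℂ (Fock n)) :=
  expSeries (PowerSeries.mk fun r =>
    (-(kappa ρ r / r) * (ρ (c l))⁻¹ ^ r * x ^ r) • aNeg l r)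

/-- The first exponential of `η^{(c_l)}(x z)` on the `l`-th factor, in the variable `z`. -/
def etaCre (l : Fin n) (x : ℂ) : PowerSeries (Module.End ℂ (Fock n)) :=
  expSeries (PowerSeries.mk fun r =>
    (kappa ρ r / r * ((ρ (c l))⁻¹ ^ r / (qHalf ρ (c l) ^ r - (qHalf ρ (c l))⁻¹ ^ r)) * x ^ r) •
      aNeg l r)

/-- The second exponential of `η^{(c_l)}(x z)` on the `l`-th factor, in the variable `z⁻¹`. -/
def etaAnn (l : Fin n) (x : ℂ) : PowerSeries (Module.End ℂ (Fock n)) :=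
  expSeries (PowerSeries.mk fun r =>
    (-(kappa ρ r / r) * (ρ (c l) ^ r / (qPar ρ (c l) ^ r - 1)) * x⁻¹ ^ r) • aPos ρ c l r)

/-- The factors in `z` of
`Λ̃_j(x z) = u_j α(x z) (φ ⊗ ⋯ ⊗ φ ⊗ η ⊗ 1 ⊗ ⋯ ⊗ 1) β(x z)`, with `η` in the `j`-th place; the
`l`-th `φ` has the argument `q_{c_1}^{1/2} ⋯ q_{c_l}^{1/2} x z`, and `η` has the argument
`q_{c_1}^{1/2} ⋯ q_{c_{j-1}}^{1/2} x z`. -/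
def lambdaCre (j : Fin n) (x : ℂ) : PowerSeries (Module.End ℂ (Fock n)) :=
  alphaOp ρ c x *
    (((List.finRange n).filter (· < j)).map
      fun l => phiOp ρ c l (cBefore ρ c l * qHalf ρ (c l) * x)).prod *
    etaCre ρ c j (cBefore ρ c j * x)

/-- The factors in `z⁻¹` of `Λ̃_j(x z)`. -/
def lambdaAnn (j : Fin n) (x : ℂ) : PowerSeries (Module.End ℂ (Fock n)) :=
  etaAnn ρ c j (cBefore ρ c j * x) * betaOp ρ c x

end Vertex

/-- The coefficient of `z^{-m}` in `A(z) B(z⁻¹)`, applied to the vector `v`. Only finitely many terms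
are nonzero for the series `B` of annihilation operators used here. -/
def mode {n : ℕ} (A B : PowerSeries (Module.End ℂ (Fock n))) (m : ℤ) (v : Fock n) : Fock n :=
  ∑ᶠ (p : ℕ × ℕ) (_ : (p.2 : ℤ) - (p.1 : ℤ) = m),
    (PowerSeries.coeff p.1 A) ((PowerSeries.coeff p.2 B) v)

/-- The coefficient of `z^{-m}` in the normally ordered product
`:Λ̃_{j_1}(x_1 z) Λ̃_{j_2}(x_2 z) ⋯:` for a list of pairs `(j_a, x_a)`, applied to `v`. -/
def normOrdMode {n : ℕ} (ρ : Fin 3 → ℂ) (c : Fin n → Fin 3) (u : Fin n → ℂ)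
    (w : List (Fin n × ℂ)) (m : ℤ) (v : Fock n) : Fock n :=
  (w.map fun p => u p.1).prod •
    mode (w.map fun p => lambdaCre ρ c p.1 p.2).prod (w.map fun p => lambdaAnn ρ c p.1 p.2).prod m v

/-- The scalar coefficient of the order `k` term of the Miura factor `R̃^{(c)}(z)`. -/
def miuraCoeff (ρ : Fin 3 → ℂ) (i : Fin 3) (k : ℕ) : ℂ :=
  (-1) ^ k * qHalf ρ 2 ^ (k ^ 2) * (qHalf ρ i)⁻¹ ^ k *
    ∏ l ∈ Finset.range k,
      (1 - qPar ρ 2 ^ ((l : ℤ) - (k : ℤ) + 1) * qPar ρ i) / (1 - qPar ρ 2 ^ (l + 1))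

/-- The word `Λ̃_i(q₃^{-(k_1 + ⋯ + k_{i-1})} z) Λ̃_i(q₃^{-(k_1 + ⋯ + k_{i-1}) - 1} z) ⋯`
(`k_i` letters for each `i`, from left to right) coming from the order `k_i` terms of the Miura
factors, after all shift operators `q₃^{-k_i D_z}` have been moved to the right. -/
def miuraWord {n : ℕ} (ρ : Fin 3 → ℂ) (k : Fin n → ℕ) : List (Fin n × ℂ) :=
  (List.finRange n).flatMap fun i =>
    (List.range (k i)).map fun j =>
      (i, (qPar ρ 2)⁻¹ ^ ((∑ l ∈ Finset.univ.filter (· < i), k l) + j))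

/-- The coefficient of `z^{-m}` in the current `T̃_d(z)`, applied to `v`; here `(-1)^d T̃_d(z)` is the
coefficient of `q₃^{-d D_z}` in `:R̃_1(z) ⋯ R̃_n(z):`. -/
def currentMode {n : ℕ} (ρ : Fin 3 → ℂ) (c : Fin n → Fin 3) (u : Fin n → ℂ) (d : ℕ) (m : ℤ)
    (v : Fock n) : Fock n :=
  (-1 : ℂ) ^ d • ∑ k ∈ Finset.piAntidiag (Finset.univ : Finset (Fin n)) d,
    (∏ i, miuraCoeff ρ (c i) (k i)) • normOrdMode ρ c u (miuraWord ρ k) m v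

/-- The coefficient of `z_1^{-m_1} ⋯ z_k^{-m_k}` in `⟨0| T̃_1(z_1) ⋯ T̃_1(z_k) |0⟩`. -/
def correlatorCoeff {n k : ℕ} (ρ : Fin 3 → ℂ) (c : Fin n → Fin 3) (u : Fin n → ℂ)
    (m : Fin k → ℤ) : ℂ :=
  vacuumCoeff ((List.finRange k).foldr (fun a v => currentMode ρ c u 1 (m a) v) 1)

/-- The structure function `f^c_{r,m}` as a formal power series (symmetric in `r` and `m`). -/
def structF {n : ℕ} (ρ : Fin 3 → ℂ) (c : Fin n → Fin 3) (r m : ℕ) : PowerSeries ℂ :=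
  expSeries (PowerSeries.mk fun k =>
    1 / (k : ℂ) *
      (qHalf ρ 2 ^ (min r m * k) - (qHalf ρ 2)⁻¹ ^ (min r m * k)) *
      (cAll ρ c ^ k * (qHalf ρ 2)⁻¹ ^ (max r m * k) -
        (cAll ρ c)⁻¹ ^ k * qHalf ρ 2 ^ (max r m * k)) *
      ((qHalf ρ 0 ^ k - (qHalf ρ 0)⁻¹ ^ k) * (qHalf ρ 1 ^ k - (qHalf ρ 1)⁻¹ ^ k) /
        ((cAll ρ c ^ k - (cAll ρ c)⁻¹ ^ k) * (qHalf ρ 2 ^ k - (qHalf ρ 2)⁻¹ ^ k))))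

/-- The colours `(3^N 1^M)`. -/
def colours (N M : ℕ) : Fin (N + M) → Fin 3 := fun j => if (j : ℕ) < N then 2 else 0

/-! ### Formal series and rational functions in `z_1, …, z_k` -/

/-- Formal series in `z_1, …, z_k` expanded in the region `|z_1| ≫ |z_2| ≫ ⋯ ≫ |z_k|`. The
coefficient at `γ` belongs to the monomial `z_1^{-γ_1} ⋯ z_k^{-γ_k}`, so that `z_j / z_i` has positive
order for `i < j`. -/
abbrev Formal (k : ℕ) : Type := HahnSeries (Lex (Fin k → ℤ)) ℂ

/-- The field `ℂ(z_1, …, z_k)`. -/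
abbrev RatFun (k : ℕ) : Type := FractionRing (MvPolynomial (Fin k) ℂ)

/-- The monomial `z_i` as a formal series. -/
def formalVar {k : ℕ} (i : Fin k) : Formal k := HahnSeries.single (toLex (-Pi.single i 1)) 1

/-- A polynomial as a formal series. -/
def expandPoly (k : ℕ) : MvPolynomial (Fin k) ℂ →ₐ[ℂ] Formal k := MvPolynomial.aeval formalVar

theorem formalVar_pow {k : ℕ} (i : Fin k) (e : ℕ) :
    (formalVar i) ^ e = HahnSeries.single (toLex (-Pi.single i (e : ℤ))) (1 : ℂ) := by
  rw [formalVar, HahnSeries.single_pow, one_pow]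
  have h : e • toLex (-Pi.single i (1 : ℤ) : Fin k → ℤ) = toLex (-Pi.single i (e : ℤ)) := by
    change toLex (e • (-Pi.single i (1 : ℤ) : Fin k → ℤ)) = _
    congr 1
    funext j
    by_cases h : j = i
    · subst h; simp
    · simp [h]
  rw [h]

theorem expandPoly_monomial {k : ℕ} (e : Fin k →₀ ℕ) (a : ℂ) :
    expandPoly k (MvPolynomial.monomial e a) =
      HahnSeries.single (toLex fun i => -(e i : ℤ)) a := by
  have key : ∀ s : Finset (Fin k), ∏ i ∈ s, (formalVar i : Formal k) ^ e i =
      HahnSeries.single (toLex (-∑ i ∈ s, Pi.single i (e i : ℤ))) (1 : ℂ) := by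
    intro s
    induction s using Finset.induction_on with
    | empty => simp
    | insert i s hi ih =>
      rw [Finset.prod_insert hi, ih, formalVar_pow, HahnSeries.single_mul_single,
        Finset.sum_insert hi, neg_add, toLex_add, one_mul]
  rw [expandPoly, MvPolynomial.aeval_monomial, Finsupp.prod_fintype _ _ (by simp), key,
    HahnSeries.algebraMap_apply, HahnSeries.C_apply]
  simp only [Algebra.algebraMap_self, RingHom.id_apply, HahnSeries.single_mul_single, zero_add,
    mul_one]
  have h : (-∑ i, Pi.single i (e i : ℤ) : Fin k → ℤ) = fun i => -(e i : ℤ) := by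
    funext j
    simp [Finset.sum_apply, Finset.sum_pi_single]
  rw [h]

theorem expandPoly_coeff {k : ℕ} (p : MvPolynomial (Fin k) ℂ) (e : Fin k →₀ ℕ) :
    (expandPoly k p).coeff (toLex fun i => -(e i : ℤ)) = p.coeff e := by
  classical
  induction p using MvPolynomial.induction_on' with
  | monomial d a =>
    rw [expandPoly_monomial, HahnSeries.coeff_single, MvPolynomial.coeff_monomial]
    by_cases h : d = e
    · subst h; simp
    · rw [if_neg h, if_neg]
      intro h'
      apply h
      ext i
      have := congrFun (toLex.injective h') i
      simp at this
      exact this.symm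
  | add p q hp hq => rw [map_add, HahnSeries.coeff_add, hp, hq, MvPolynomial.coeff_add]

theorem expandPoly_injective (k : ℕ) :
    Function.Injective (expandPoly k : MvPolynomial (Fin k) ℂ →+* Formal k) := by
  intro p q h
  ext e
  rw [← expandPoly_coeff, ← expandPoly_coeff]
  exact congrArg (fun f : Formal k => f.coeff (toLex fun i => -(e i : ℤ))) h

/-- The expansion of a rational function in the region `|z_1| ≫ ⋯ ≫ |z_k|`. -/
def expand (k : ℕ) : RatFun k →+* Formal k := IsFractionRing.lift (expandPoly_injective k)

/-- `F (z_j / z_i)` for a power series `F` in one variable and `i < j`. -/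
def ratioSeries {k : ℕ} (F : PowerSeries ℂ) (i j : Fin k) : Formal k :=
  PowerSeries.heval (HahnSeries.single (toLex (Pi.single i 1 - Pi.single j 1)) (1 : ℂ)) F

/-- The ratio `z_j / z_i` as a rational function. -/
def ratio {k : ℕ} (i j : Fin k) : RatFun k :=
  algebraMap (MvPolynomial (Fin k) ℂ) (RatFun k) (MvPolynomial.X j) /
    algebraMap (MvPolynomial (Fin k) ℂ) (RatFun k) (MvPolynomial.X i)

/-- A constant as a rational function. -/
def const {k : ℕ} (a : ℂ) : RatFun k :=
  algebraMap (MvPolynomial (Fin k) ℂ) (RatFun k) (MvPolynomial.C a)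

/-! ### Young diagrams and bitableaux -/

/-- The row and the column (both counted from `0`) of the box number `a` (counted from `0`), when the
boxes of a diagram with the given row lengths are numbered row by row from left to right. -/
def boxPos : List ℕ → ℕ → ℕ × ℕ
  | [], a => (0, a)
  | r :: rs, a => if a < r then (0, a) else ((boxPos rs (a - r)).1 + 1, (boxPos rs (a - r)).2)

/-- The row of the box number `a` of the diagram of a partition. -/
def boxRow {k : ℕ} (lam : Nat.Partition k) (a : Fin k) : ℕ :=
  (boxPos (lam.parts.sort (· ≥ ·)) a).1

/-- The column of the box number `a` of the diagram of a partition. -/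
def boxCol {k : ℕ} (lam : Nat.Partition k) (a : Fin k) : ℕ :=
  (boxPos (lam.parts.sort (· ≥ ·)) a).2

/-- The filling `i` of the boxes of `lam` is a reverse semistandard Young bitableau of type `(N, M)`.
The entries are shifted by one: those below `N` are the ordinary numbers, the others are the super
numbers. -/
def IsRSSYBT (N M : ℕ) {k : ℕ} (lam : Nat.Partition k) (i : Fin k → Fin (N + M)) : Prop :=
  (∀ a b, boxRow lam a = boxRow lam b → boxCol lam a < boxCol lam b → i b ≤ i a) ∧
  (∀ a b, boxCol lam a = boxCol lam b → boxRow lam a < boxRow lam b → i b ≤ i a) ∧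
  (∀ a b, boxRow lam a = boxRow lam b → boxCol lam a < boxCol lam b →
    N ≤ (i a : ℕ) → N ≤ (i b : ℕ) → i b < i a) ∧
  (∀ a b, boxCol lam a = boxCol lam b → boxRow lam a < boxRow lam b →
    (i a : ℕ) < N → (i b : ℕ) < N → i b < i a)

instance (N M : ℕ) {k : ℕ} (lam : Nat.Partition k) : DecidablePred (IsRSSYBT N M lam) :=
  fun _ => inferInstanceAs (Decidable (_ ∧ _))

/-- The set of reverse semistandard Young bitableaux of type `(N, M)` and shape `lam`. -/
def RSSYBT (N M : ℕ) {k : ℕ} (lam : Nat.Partition k) : Finset (Fin k → Fin (N + M)) :=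
  Finset.univ.filter (IsRSSYBT N M lam)

/-! ### The two sides -/

/-- `Δ(z) = (1 - q₁ q₃^{1/2} z)(1 - q₁⁻¹ q₃^{-1/2} z) / ((1 - q₃^{1/2} z)(1 - q₃^{-1/2} z))`. -/
def deltaFun {k : ℕ} (ρ : Fin 3 → ℂ) (z : RatFun k) : RatFun k :=
  (1 - const (qPar ρ 0 * qHalf ρ 2) * z) * (1 - const ((qPar ρ 0)⁻¹ * (qHalf ρ 2)⁻¹) * z) /
    ((1 - const (qHalf ρ 2) * z) * (1 - const (qHalf ρ 2)⁻¹ * z))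

/-- The normalisation `𝒩_λ(z_1, …, z_k)`, the product of `Δ(q₃^{-1/2} z_j / z_i)⁻¹` over the pairs of indices `(i, j)` such that the
row of box `i` is strictly above the row of box `j`. -/
def normFactor {k : ℕ} (ρ : Fin 3 → ℂ) (lam : Nat.Partition k) : RatFun k :=
  ∏ p ∈ Finset.univ.filter (fun p : Fin k × Fin k => boxRow lam p.1 < boxRow lam p.2),
    (deltaFun ρ (const (qHalf ρ 2)⁻¹ * ratio p.1 p.2))⁻¹

/-- `𝒟^{(i,j)}(x)`. -/
def dFactor {k : ℕ} (ρ : Fin 3 → ℂ) (N M : ℕ) (i j : Fin (N + M)) (x : RatFun k) : RatFun k :=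
  if i < j then
    (1 - const (qPar ρ 0)⁻¹ * x) * (1 - const (qPar ρ 1)⁻¹ * x) /
      ((1 - const (qPar ρ 2) * x) * (1 - x))
  else if j < i then
    (1 - const (qPar ρ 0) * x) * (1 - const (qPar ρ 1) * x) /
      ((1 - const (qPar ρ 2)⁻¹ * x) * (1 - x))
  else if N ≤ (i : ℕ) then
    (1 - const (qPar ρ 0)⁻¹ * x) * (1 - const (qPar ρ 0) * x) /
      ((1 - const (qPar ρ 2)⁻¹ * x) * (1 - const (qPar ρ 2) * x))
  else 1

/-- `y_j = (q_{c_j}^{1/2} - q_{c_j}^{-1/2}) / (q₃^{1/2} - q₃^{-1/2})`. -/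
def yCoeff {n : ℕ} (ρ : Fin 3 → ℂ) (c : Fin n → Fin 3) (j : Fin n) : ℂ :=
  (qHalf ρ (c j) - (qHalf ρ (c j))⁻¹) / (qHalf ρ 2 - (qHalf ρ 2)⁻¹)

/-- The term
`y_{i_1} ⋯ y_{i_k} u_{i_1} ⋯ u_{i_k} 𝒩_λ(z) ∏_{a < b} 𝒟^{(i_a, i_b)}(z_b / z_a)` of a filling `i`. -/
def fillingTerm {k : ℕ} (ρ : Fin 3 → ℂ) (N M : ℕ) (u : Fin (N + M) → ℂ) (lam : Nat.Partition k)
    (i : Fin k → Fin (N + M)) : RatFun k :=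
  const ((∏ a, yCoeff ρ (colours N M) (i a)) * ∏ a, u (i a)) * normFactor ρ lam *
    ∏ p ∈ Finset.univ.filter (fun p : Fin k × Fin k => p.1 < p.2),
      dFactor ρ N M (i p.1) (i p.2) (ratio p.1 p.2)

/-- The rational function `f` is regular at the point `p` and takes the value `w` there. -/
def HasValueAt {k : ℕ} (f : RatFun k) (p : Fin k → ℂ) (w : ℂ) : Prop :=
  ∃ P Q : MvPolynomial (Fin k) ℂ, MvPolynomial.eval p Q ≠ 0 ∧
    f = algebraMap _ (RatFun k) P / algebraMap _ (RatFun k) Q ∧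
    w = MvPolynomial.eval p P / MvPolynomial.eval p Q

/-- The point `z_a = q^{col a} ξ^{row a} y`. -/
def dualPoint {k : ℕ} (lam : Nat.Partition k) (q ξ y : ℂ) : Fin k → ℂ :=
  fun a => q ^ boxCol lam a * ξ ^ boxRow lam a * y

/-- The specialisation of `f` to the points `z_a = q^{col a} ξ^{row a} y` is defined near `ξ = t⁻¹`
(except possibly at `ξ = t⁻¹`) and tends to `L` as `ξ → t⁻¹`, for every nonzero `y`. -/
def HasSpecLimit {k : ℕ} (lam : Nat.Partition k) (q t : ℂ) (f : RatFun k) (L : ℂ) : Prop :=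
  ∀ y : ℂ, y ≠ 0 → ∃ g : ℂ → ℂ,
    (∀ᶠ ξ in 𝓝[≠] t⁻¹, HasValueAt f (dualPoint lam q ξ y) (g ξ)) ∧
    Tendsto g (𝓝[≠] t⁻¹) (𝓝 L)

end QuantumCorner

end

open Filter Topology

noncomputable section

namespace QuantumCorner

/-! ### Formal exponentials -/

section ExpSeries

variable {A : Type*} [Ring A]

/-! The proof has an algebraic and a combinatorial half, which meet in the sum of `fillingTerm` over
all fillings, bitableaux or not.

Algebra. The order-one part of the Miura product is `T̃_1 = ∑ y_j Λ̃_j` (`currentMode_one`), so the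
correlator is a sum over fillings of vacuum expectation values of vertex operators. Wick's theorem
(`coeff_contractionProd_mul_evalHom`) turns each of these into a product, over pairs `a < b`, of
scalar series in `z_b / z_a`. The logarithm of such a contraction is found by telescoping over the
tensor factors (`sum_contraction_aux`): one part involves `C` but not the pair of indices, the other
only the order of `i` and `j` and, if they agree, the colour of `i`. The structure function removes
exactly the dependence on `C`, and what is left is the logarithm of a quotient of linear factors,
namely `dFactor` (`structF_mul_contraction`, `expand_dFactor`). So the normalised correlator is the
expansion of a rational function, the sum of all filling terms.

Combinatorics. At the specialised points a linear factor in `z_b / z_a` becomes `1 - c q^d ξ^s`, and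
since `q` and `t` are multiplicatively independent it can vanish at `ξ = t⁻¹` only for neighbouring
boxes. Horizontal neighbours that break the row condition produce a factor that is zero for every
`ξ` (`specZero_dFactor`), so the whole term is zero. Otherwise the normalisation contributes a
simple zero for each pair of vertical neighbours and a simple pole for each pair of diagonal
neighbours; `dFactor` cancels the zero when the entries satisfy the column condition, and the pole
when they strictly decrease (`specOrder_of_row_lt`). The order of the term is therefore the number
of bad vertical pairs minus the number of bad diagonal pairs. A bad diagonal pair forces bad
vertical pairs on both of its sides, which makes this difference positive as soon as a bad vertical
pair exists (`card_badDiagonal_lt`); then the limit is zero. Without bad vertical pairs there are no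
bad diagonal ones either: the filling is a bitableau and the limit is finite. -/

theorem coeff_pow_eq_zero_of_lt {f : PowerSeries A} (hf : PowerSeries.coeff 0 f = 0) {m j : ℕ}
    (h : m < j) : PowerSeries.coeff m (f ^ j) = 0 := by
  induction j generalizing m with
  | zero => omega
  | succ j ih =>
    rw [pow_succ, PowerSeries.coeff_mul]
    refine Finset.sum_eq_zero fun p hp => ?_
    rw [Finset.HasAntidiagonal.mem_antidiagonal] at hp
    by_cases h1 : p.1 < j
    · rw [ih h1, zero_mul]
    · have : p.2 = 0 := by omega
      rw [this, hf, mul_zero]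

theorem coeff_pow_mul_pow_eq_zero {f g : PowerSeries A} (hf : PowerSeries.coeff 0 f = 0)
    (hg : PowerSeries.coeff 0 g = 0) {m i j : ℕ} (h : m < i + j) :
    PowerSeries.coeff m (f ^ i * g ^ j) = 0 := by
  rw [PowerSeries.coeff_mul]
  refine Finset.sum_eq_zero fun p hp => ?_
  rw [Finset.HasAntidiagonal.mem_antidiagonal] at hp
  by_cases h1 : p.1 < i
  · rw [coeff_pow_eq_zero_of_lt hf h1, zero_mul]
  · rw [coeff_pow_eq_zero_of_lt hg (by omega : p.2 < j), mul_zero]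

theorem commute_of_coeff {f g : PowerSeries A}
    (h : ∀ m n, Commute (PowerSeries.coeff m f) (PowerSeries.coeff n g)) : Commute f g := by
  refine PowerSeries.ext fun m => ?_
  rw [PowerSeries.coeff_mul, PowerSeries.coeff_mul, ← Finset.Nat.sum_antidiagonal_swap]
  exact Finset.sum_congr rfl fun p _ => h _ _

variable [Algebra ℂ A]

theorem coeff_expSeries (f : PowerSeries A) (m : ℕ) :
    PowerSeries.coeff m (expSeries f) =
      ∑ j ∈ Finset.range (m + 1), ((j.factorial : ℂ)⁻¹) • PowerSeries.coeff m (f ^ j) := by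
  rw [expSeries, PowerSeries.coeff_mk]

/-- Lets several exponentials be truncated at a common order, so that their sums can be rearranged.
-/
theorem coeff_expSeries_of_le {f : PowerSeries A} (hf : PowerSeries.coeff 0 f = 0) {m K : ℕ}
    (h : m + 1 ≤ K) : PowerSeries.coeff m (expSeries f) =
      ∑ j ∈ Finset.range K, ((j.factorial : ℂ)⁻¹) • PowerSeries.coeff m (f ^ j) := by
  rw [coeff_expSeries]
  refine Finset.sum_subset (fun x hx => ?_) fun x _ hx => ?_
  · rw [Finset.mem_range] at *; omega
  · rw [coeff_pow_eq_zero_of_lt hf (by simpa using hx), smul_zero]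

theorem expSeries_zero : expSeries (0 : PowerSeries A) = 1 := by
  refine PowerSeries.ext fun m => ?_
  rw [coeff_expSeries, Finset.sum_eq_single 0]
  · simp
  · intro j _ hj; simp [zero_pow hj]
  · simp

theorem coeff_zero_expSeries (f : PowerSeries A) : PowerSeries.coeff 0 (expSeries f) = 1 := by
  simp [coeff_expSeries]

/-- The product of two exponentials, both truncated at the same order. -/
theorem coeff_expSeries_mul {f g : PowerSeries A} (hf : PowerSeries.coeff 0 f = 0)
    (hg : PowerSeries.coeff 0 g = 0) (m : ℕ) :
    PowerSeries.coeff m (expSeries f * expSeries g) =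
      ∑ i ∈ Finset.range (m + 1), ∑ j ∈ Finset.range (m + 1),
        ((i.factorial : ℂ)⁻¹ * (j.factorial : ℂ)⁻¹) • PowerSeries.coeff m (f ^ i * g ^ j) := by
  rw [PowerSeries.coeff_mul]
  have : ∀ p ∈ Finset.HasAntidiagonal.antidiagonal m,
      PowerSeries.coeff p.1 (expSeries f) * PowerSeries.coeff p.2 (expSeries g) =
      ∑ i ∈ Finset.range (m + 1), ∑ j ∈ Finset.range (m + 1),
        ((i.factorial : ℂ)⁻¹ * (j.factorial : ℂ)⁻¹) •
          (PowerSeries.coeff p.1 (f ^ i) * PowerSeries.coeff p.2 (g ^ j)) := by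
    intro p hp
    rw [Finset.HasAntidiagonal.mem_antidiagonal] at hp
    rw [coeff_expSeries_of_le hf (by omega : p.1 + 1 ≤ m + 1),
      coeff_expSeries_of_le hg (by omega : p.2 + 1 ≤ m + 1), Finset.sum_mul_sum]
    refine Finset.sum_congr rfl fun i _ => Finset.sum_congr rfl fun j _ => ?_
    rw [smul_mul_smul_comm]
  rw [Finset.sum_congr rfl this, Finset.sum_comm]
  refine Finset.sum_congr rfl fun i _ => ?_
  rw [Finset.sum_comm]
  refine Finset.sum_congr rfl fun j _ => ?_
  rw [PowerSeries.coeff_mul, Finset.smul_sum]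

theorem expSeries_add {f g : PowerSeries A} (hf : PowerSeries.coeff 0 f = 0)
    (hg : PowerSeries.coeff 0 g = 0) (h : Commute f g) :
    expSeries (f + g) = expSeries f * expSeries g := by
  refine PowerSeries.ext fun m => ?_
  rw [coeff_expSeries_mul hf hg, coeff_expSeries]
  have e1 : ∀ n ∈ Finset.range (m + 1),
      ((n.factorial : ℂ)⁻¹) • PowerSeries.coeff m ((f + g) ^ n) =
      ∑ p ∈ Finset.HasAntidiagonal.antidiagonal n, ((p.1.factorial : ℂ)⁻¹ * (p.2.factorial : ℂ)⁻¹) •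
        PowerSeries.coeff m (f ^ p.1 * g ^ p.2) := by
    intro n _
    rw [h.add_pow', map_sum, Finset.smul_sum]
    refine Finset.sum_congr rfl fun p hp => ?_
    rw [Finset.HasAntidiagonal.mem_antidiagonal] at hp
    subst hp
    rw [map_nsmul, ← Nat.cast_smul_eq_nsmul ℂ, smul_smul]
    congr 1
    have := Nat.add_choose_mul_factorial_mul_factorial p.1 p.2
    rw [Nat.choose_symm_add.symm] at this
    have h' : ((p.1 + p.2).choose p.1 : ℂ) * p.1.factorial * p.2.factorial =
      (p.1 + p.2).factorial := by exact_mod_cast this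
    have h0 : ∀ n : ℕ, ((n.factorial : ℕ) : ℂ) ≠ 0 := fun n => by
      exact_mod_cast n.factorial_ne_zero
    rw [← h']
    have hc : ((p.1 + p.2).choose p.1 : ℂ) ≠ 0 := by
      exact_mod_cast (Nat.choose_pos (Nat.le_add_right _ _)).ne'
    field_simp [h0 p.1, h0 p.2]
  rw [Finset.sum_congr rfl e1, Finset.sum_sigma', ← Finset.sum_product']
  -- The square of pairs on the right exceeds the triangle on the left by pairs with `p.1 + p.2 >
  -- m`; these vanish because `f ^ p.1 * g ^ p.2` starts in degree `p.1 + p.2`.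
  refine Finset.sum_bij_ne_zero (fun x _ _ => x.2) ?_ ?_ ?_ ?_
  · rintro ⟨n, p⟩ hx _
    simp only [Finset.mem_sigma, Finset.mem_range, Finset.HasAntidiagonal.mem_antidiagonal] at hx
    simp only [Finset.mem_product, Finset.mem_range]
    omega
  · rintro ⟨n, p⟩ hx _ ⟨n', p'⟩ hx' _ e
    simp only [Finset.mem_sigma, Finset.mem_range, Finset.HasAntidiagonal.mem_antidiagonal] at hx hx' e
    subst e
    obtain ⟨_, rfl⟩ := hx
    obtain ⟨_, rfl⟩ := hx'
    rfl
  · rintro p hp hne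
    refine ⟨⟨p.1 + p.2, p⟩, ?_, hne, rfl⟩
    simp only [Finset.mem_sigma, Finset.mem_range, Finset.HasAntidiagonal.mem_antidiagonal, and_true]
    by_contra hlt
    exact hne (by rw [coeff_pow_mul_pow_eq_zero hf hg (by omega), smul_zero])
  · intros; rfl

theorem map_expSeries {B : Type*} [Ring B] [Algebra ℂ B] (φ : A →ₐ[ℂ] B) (f : PowerSeries A) :
    PowerSeries.map (φ : A →+* B) (expSeries f) = expSeries (PowerSeries.map (φ : A →+* B) f) := by
  refine PowerSeries.ext fun m => ?_
  rw [PowerSeries.coeff_map, coeff_expSeries, coeff_expSeries, map_sum]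
  refine Finset.sum_congr rfl fun j _ => ?_
  rw [← map_pow, PowerSeries.coeff_map]
  exact map_smul φ _ _

/-- If `[D, x] = c` commutes with `D`, then `exp(D) x = (x + c) exp(D)`. -/
theorem expSeries_mul_eq_add_mul {D x c : PowerSeries A} (hD : PowerSeries.coeff 0 D = 0)
    (hx : D * x = x * D + c) (hc : Commute D c) :
    expSeries D * x = (x + c) * expSeries D := by
  have hpow : ∀ n : ℕ, D ^ (n + 1) * x = x * D ^ (n + 1) + ((n + 1 : ℕ) : ℂ) • (c * D ^ n) := by
    intro n
    induction n with
    | zero => simp [hx]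
    | succ n ih =>
      rw [pow_succ' D (n + 1), mul_assoc, ih, mul_add, ← mul_assoc D x, hx, mul_smul_comm,
        ← mul_assoc D c, hc.eq, add_mul, mul_assoc, mul_assoc, ← pow_succ' D n, add_assoc]
      congr 1
      push_cast
      module
  have expand_left : ∀ (m : ℕ) (y : PowerSeries A), PowerSeries.coeff m (expSeries D * y) =
      ∑ j ∈ Finset.range (m + 2), ((j.factorial : ℂ)⁻¹) • PowerSeries.coeff m (D ^ j * y) := by
    intro m y
    simp_rw [PowerSeries.coeff_mul, Finset.smul_sum]
    rw [Finset.sum_comm]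
    refine Finset.sum_congr rfl fun p hp => ?_
    rw [Finset.HasAntidiagonal.mem_antidiagonal] at hp
    rw [coeff_expSeries_of_le hD (by omega : p.1 + 1 ≤ m + 2), Finset.sum_mul]
    simp_rw [smul_mul_assoc]
  have expand_right : ∀ (m : ℕ) (y : PowerSeries A) (K : ℕ), m + 1 ≤ K →
      PowerSeries.coeff m (y * expSeries D) =
      ∑ j ∈ Finset.range K, ((j.factorial : ℂ)⁻¹) • PowerSeries.coeff m (y * D ^ j) := by
    intro m y K hK
    simp_rw [PowerSeries.coeff_mul, Finset.smul_sum]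
    rw [Finset.sum_comm]
    refine Finset.sum_congr rfl fun p hp => ?_
    rw [Finset.HasAntidiagonal.mem_antidiagonal] at hp
    rw [coeff_expSeries_of_le hD (by omega : p.2 + 1 ≤ K), Finset.mul_sum]
    simp_rw [mul_smul_comm]
  refine PowerSeries.ext fun m => ?_
  -- The cut-off for `c` is one lower: the power `D ^ (j + 1)` on the left produces `c * D ^ j`.
  rw [expand_left, add_mul, map_add, expand_right m x (m + 2) (by omega),
    expand_right m c (m + 1) (by omega), Finset.sum_range_succ', Finset.sum_range_succ' _ (m + 1)]
  have : ∀ j : ℕ, (((j + 1).factorial : ℂ)⁻¹) • PowerSeries.coeff m (D ^ (j + 1) * x) =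
      (((j + 1).factorial : ℂ)⁻¹) • PowerSeries.coeff m (x * D ^ (j + 1)) +
        ((j.factorial : ℂ)⁻¹) • PowerSeries.coeff m (c * D ^ j) := by
    intro j
    have hs : PowerSeries.coeff m (((j + 1 : ℕ) : ℂ) • (c * D ^ j)) =
        ((j + 1 : ℕ) : ℂ) • PowerSeries.coeff m (c * D ^ j) := rfl
    rw [hpow, map_add, smul_add, hs, smul_smul]
    congr 2
    rw [Nat.factorial_succ]
    push_cast
    have : (j : ℂ) + 1 ≠ 0 := by exact_mod_cast j.succ_ne_zero
    field_simp
  rw [Finset.sum_congr rfl fun j _ => this j, Finset.sum_add_distrib]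
  simp only [pow_zero, one_mul, mul_one]
  abel

end ExpSeries

section ExpSeriesComm

variable {A : Type*} [CommRing A] [Algebra ℂ A]

theorem expSeries_sum {ι : Type*} (s : Finset ι) (f : ι → PowerSeries A)
    (hf : ∀ i ∈ s, PowerSeries.coeff 0 (f i) = 0) :
    expSeries (∑ i ∈ s, f i) = ∏ i ∈ s, expSeries (f i) := by
  classical
  induction s using Finset.induction_on with
  | empty => simp [expSeries_zero]
  | insert i s hi ih =>
    rw [Finset.sum_insert hi, Finset.prod_insert hi, expSeries_add (hf i (by simp)) _ (Commute.all _ _),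
      ih fun j hj => hf j (by simp [hj])]
    rw [map_sum]
    exact Finset.sum_eq_zero fun j hj => hf j (by simp [hj])

theorem rescale_expSeries (a : A) (f : PowerSeries A) :
    PowerSeries.rescale a (expSeries f) = expSeries (PowerSeries.rescale a f) := by
  refine PowerSeries.ext fun m => ?_
  rw [PowerSeries.coeff_rescale, coeff_expSeries, coeff_expSeries, Finset.mul_sum]
  refine Finset.sum_congr rfl fun j _ => ?_
  rw [← map_pow, PowerSeries.coeff_rescale, mul_smul_comm]

theorem derivative_expSeries {f : PowerSeries A} (hf : PowerSeries.coeff 0 f = 0) :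
    PowerSeries.derivative A (expSeries f) = PowerSeries.derivative A f * expSeries f := by
  refine PowerSeries.ext fun m => ?_
  rw [PowerSeries.coeff_derivative, coeff_expSeries_of_le hf (le_refl (m + 1 + 1)), Finset.sum_mul,
    PowerSeries.coeff_mul]
  have e1 : ∀ p ∈ Finset.HasAntidiagonal.antidiagonal m,
      PowerSeries.coeff p.1 (PowerSeries.derivative A f) * PowerSeries.coeff p.2 (expSeries f) =
      ∑ j ∈ Finset.range (m + 1), ((j.factorial : ℂ)⁻¹) •
        (PowerSeries.coeff p.1 (PowerSeries.derivative A f) * PowerSeries.coeff p.2 (f ^ j)) := by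
    intro p hp
    rw [Finset.HasAntidiagonal.mem_antidiagonal] at hp
    rw [coeff_expSeries_of_le hf (by omega : p.2 + 1 ≤ m + 1), Finset.mul_sum]
    simp_rw [mul_smul_comm]
  rw [Finset.sum_congr rfl e1, Finset.sum_comm, Finset.sum_range_succ']
  have e0 : PowerSeries.coeff (m + 1) (f ^ 0) = 0 := by simp [PowerSeries.coeff_one]
  rw [e0, smul_zero, zero_mul, add_zero]
  refine Finset.sum_congr rfl fun j _ => ?_
  rw [← Finset.smul_sum, ← PowerSeries.coeff_mul, smul_mul_assoc]
  have e2 : PowerSeries.coeff (m + 1) (f ^ (j + 1)) * ((m : A) + 1) =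
      PowerSeries.coeff m (PowerSeries.derivative A (f ^ (j + 1))) := by
    rw [PowerSeries.coeff_derivative]
  have e3 : PowerSeries.coeff m (PowerSeries.derivative A (f ^ (j + 1))) =
      ((j + 1 : ℕ) : ℂ) • PowerSeries.coeff m (PowerSeries.derivative A f * f ^ j) := by
    rw [Derivation.leibniz_pow, Nat.add_sub_cancel, map_nsmul, ← Nat.cast_smul_eq_nsmul ℂ,
      smul_eq_mul, mul_comm (f ^ j)]
  rw [e2, e3, smul_smul]
  congr 1
  rw [Nat.factorial_succ]
  push_cast
  have : (j : ℂ) + 1 ≠ 0 := by exact_mod_cast j.succ_ne_zero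
  field_simp

end ExpSeriesComm

/-- A power series with constant coefficient `1` is `exp f` if its logarithmic derivative is the
derivative of `f`. -/
theorem eq_expSeries_of_derivative {f g : PowerSeries ℂ} (hf : PowerSeries.coeff 0 f = 0)
    (hg : PowerSeries.coeff 0 g = 1)
    (h : PowerSeries.derivative ℂ g = PowerSeries.derivative ℂ f * g) : g = expSeries f := by
  have hneg : PowerSeries.coeff 0 (-f) = 0 := by rw [map_neg, hf, neg_zero]
  have hinv : expSeries (-f) * expSeries f = 1 := by
    rw [← expSeries_add hneg hf (Commute.all _ _), neg_add_cancel, expSeries_zero]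
  -- The product has derivative zero and constant term `1`.
  have key : g * expSeries (-f) = 1 := by
    refine PowerSeries.derivative.ext (R := ℂ) ?_ ?_
    · rw [Derivation.leibniz, derivative_expSeries hneg, h, map_neg, smul_eq_mul, smul_eq_mul]
      simp only [Derivation.map_one_eq_zero]
      ring
    · rw [← PowerSeries.coeff_zero_eq_constantCoeff_apply, PowerSeries.coeff_mul]
      simp [hg, coeff_zero_expSeries, ← PowerSeries.coeff_zero_eq_constantCoeff_apply]
  calc g = g * (expSeries (-f) * expSeries f) := by rw [hinv, mul_one]
    _ = expSeries f := by rw [← mul_assoc, key, one_mul]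

/-- `exp (- ∑ a^r x^r / r) = 1 - a x`. -/
theorem expSeries_neg_log (a : ℂ) :
    expSeries (PowerSeries.mk fun r => -(1 / (r : ℂ) * a ^ r)) =
      1 - PowerSeries.C a * PowerSeries.X := by
  symm
  -- The exponent has no constant term because `1 / 0 = 0`.
  refine eq_expSeries_of_derivative (by simp) (by simp) ?_
  refine PowerSeries.ext fun m => ?_
  rw [mul_sub, mul_one, map_sub (PowerSeries.coeff m), ← mul_assoc, mul_comm _ (PowerSeries.C a),
    mul_assoc, PowerSeries.coeff_C_mul]
  have hd : ∀ m : ℕ, PowerSeries.coeff m (PowerSeries.derivative ℂ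
      (PowerSeries.mk fun r => -(1 / (r : ℂ) * a ^ r))) = -a ^ (m + 1) := by
    intro m
    rw [PowerSeries.coeff_derivative, PowerSeries.coeff_mk]
    have : (m : ℂ) + 1 ≠ 0 := by exact_mod_cast m.succ_ne_zero
    push_cast
    field_simp
  rw [hd]
  cases m with
  | zero =>
    simp
  | succ m =>
    rw [PowerSeries.coeff_succ_mul_X, hd, PowerSeries.coeff_derivative, map_sub,
      PowerSeries.coeff_C_mul, PowerSeries.coeff_X]
    simp [PowerSeries.coeff_one]
    ring

/-! ### Boxes of a diagram -/

/-- Numbers beyond the last box continue along one extra row, so no bound on `a` and `b` is needed.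
-/
theorem boxPos_lex (L : List ℕ) {a b : ℕ} (h : a < b) :
    (boxPos L a).1 < (boxPos L b).1 ∨
      (boxPos L a).1 = (boxPos L b).1 ∧ (boxPos L a).2 < (boxPos L b).2 := by
  induction L generalizing a b with
  | nil => exact Or.inr ⟨rfl, h⟩
  | cons r rs ih =>
    by_cases hb : b < r
    · simpa only [boxPos, hb, h.trans hb, if_true, true_and, lt_irrefl, false_or] using h
    · by_cases ha : a < r
      · simp only [boxPos, hb, ha, if_true, if_false]
        exact Or.inl (Nat.succ_pos _)
      · simp only [boxPos, hb, ha, if_false]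
        have := ih (a := a - r) (b := b - r) (by omega)
        omega

theorem boxPos_lt {L : List ℕ} {a : ℕ} (h : a < L.sum) :
    ∃ h : (boxPos L a).1 < L.length, (boxPos L a).2 < L[(boxPos L a).1] := by
  induction L generalizing a with
  | nil => simp at h
  | cons r rs ih =>
    by_cases ha : a < r
    · simp [boxPos, ha]
    · rw [List.sum_cons] at h
      obtain ⟨h1, h2⟩ := ih (a := a - r) (by omega)
      simpa [boxPos, ha, h1] using h2

theorem exists_boxPos {L : List ℕ} {i j : ℕ} (hi : i < L.length) (hj : j < L[i]) :
    ∃ a < L.sum, boxPos L a = (i, j) := by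
  induction L generalizing i with
  | nil => simp at hi
  | cons r rs ih =>
    cases i with
    | zero =>
      simp only [List.getElem_cons_zero] at hj
      exact ⟨j, by rw [List.sum_cons]; omega, by simp [boxPos, hj]⟩
    | succ i =>
      simp only [List.getElem_cons_succ] at hj
      obtain ⟨a, ha, e⟩ := ih (by simpa using hi) hj
      refine ⟨r + a, by rw [List.sum_cons]; omega, ?_⟩
      simp [boxPos, e]

section Partition

variable {k : ℕ} (lam : Nat.Partition k)

theorem sum_sort_parts : (lam.parts.sort (· ≥ ·)).sum = k := by
  rw [← Multiset.sum_coe, Multiset.sort_eq, lam.parts_sum]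

theorem box_lex {a b : Fin k} (h : a < b) : boxRow lam a < boxRow lam b ∨
    boxRow lam a = boxRow lam b ∧ boxCol lam a < boxCol lam b :=
  boxPos_lex _ h

theorem box_lt_iff {a b : Fin k} : a < b ↔ boxRow lam a < boxRow lam b ∨
    boxRow lam a = boxRow lam b ∧ boxCol lam a < boxCol lam b := by
  refine ⟨box_lex lam, fun h => ?_⟩
  by_contra hle
  rcases (not_lt.mp hle).eq_or_lt with rfl | hlt
  · omega
  · have := box_lex lam hlt
    omega

theorem box_injective {a b : Fin k} (hr : boxRow lam a = boxRow lam b)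
    (hc : boxCol lam a = boxCol lam b) : a = b := by
  rcases lt_trichotomy a b with h | h | h
  · have := box_lex lam h; omega
  · exact h
  · have := box_lex lam h; omega

/-- A diagram contains, with each box, the boxes weakly above and to the left of it. -/
theorem exists_box {b : Fin k} {i j : ℕ} (hi : i ≤ boxRow lam b) (hj : j ≤ boxCol lam b) :
    ∃ a, boxRow lam a = i ∧ boxCol lam a = j := by
  obtain ⟨h1, h2⟩ := boxPos_lt (L := lam.parts.sort (· ≥ ·)) (a := b)
    (by rw [sum_sort_parts]; exact b.2)
  have hi' : i < (lam.parts.sort (· ≥ ·)).length := lt_of_le_of_lt hi h1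
  have hle : (lam.parts.sort (· ≥ ·))[boxRow lam b] ≤ (lam.parts.sort (· ≥ ·))[i] := by
    have hs : (lam.parts.sort (· ≥ ·)).Pairwise (· ≥ ·) := Multiset.pairwise_sort _ _
    rcases hi.eq_or_lt with rfl | hlt
    · exact le_rfl
    · exact List.pairwise_iff_getElem.mp hs _ _ hi' h1 hlt
  obtain ⟨a, ha, e⟩ := exists_boxPos hi' (lt_of_le_of_lt hj (lt_of_lt_of_le h2 hle))
  rw [sum_sort_parts] at ha
  exact ⟨⟨a, ha⟩, congrArg Prod.fst e, congrArg Prod.snd e⟩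

variable (N M : ℕ)

/-- The condition on horizontal neighbours with entries `x`, `y` in a reverse semistandard Young
bitableau. -/
def RowRel {m : ℕ} (N : ℕ) (x y : Fin m) : Prop := y < x ∨ y = x ∧ (x : ℕ) < N

/-- The condition on vertical neighbours with entries `x`, `y` in a reverse semistandard Young
bitableau. -/
def ColRel {m : ℕ} (N : ℕ) (x y : Fin m) : Prop := y < x ∨ y = x ∧ N ≤ (x : ℕ)

variable {N M lam}

/-- `RowRel` is transitive, and every box between `a` and `b` belongs to the diagram, so the
condition propagates from neighbours. The vertical version is the same. -/
theorem rowRel_of_adjacent {i : Fin k → Fin (N + M)}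
    (h : ∀ a b, boxRow lam a = boxRow lam b → boxCol lam b = boxCol lam a + 1 →
      RowRel N (i a) (i b)) (d : ℕ) {a b : Fin k} (hr : boxRow lam a = boxRow lam b)
    (hc : boxCol lam b = boxCol lam a + d + 1) : RowRel N (i a) (i b) := by
  induction d generalizing b with
  | zero => exact h a b hr hc
  | succ d ih =>
    obtain ⟨x, hxr, hxc⟩ := exists_box lam (b := b) (i := boxRow lam b) (j := boxCol lam a + d + 1)
      le_rfl (by omega)
    have h1 := ih (b := x) (by omega) hxc
    have h2 := h x b hxr (by omega)
    unfold RowRel at *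
    omega

theorem colRel_of_adjacent {i : Fin k → Fin (N + M)}
    (h : ∀ a b, boxCol lam a = boxCol lam b → boxRow lam b = boxRow lam a + 1 →
      ColRel N (i a) (i b)) (d : ℕ) {a b : Fin k} (hc : boxCol lam a = boxCol lam b)
    (hr : boxRow lam b = boxRow lam a + d + 1) : ColRel N (i a) (i b) := by
  induction d generalizing b with
  | zero => exact h a b hc hr
  | succ d ih =>
    obtain ⟨x, hxr, hxc⟩ := exists_box lam (b := b) (i := boxRow lam a + d + 1) (j := boxCol lam b)
      (by omega) le_rfl
    have h1 := ih (b := x) (by omega) hxr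
    have h2 := h x b hxc (by omega)
    unfold ColRel at *
    omega

/-- A filling is a reverse semistandard Young bitableau if neighbouring entries are in order. -/
theorem isRSSYBT_of_adjacent {i : Fin k → Fin (N + M)}
    (hrow : ∀ a b, boxRow lam a = boxRow lam b → boxCol lam b = boxCol lam a + 1 →
      RowRel N (i a) (i b))
    (hcol : ∀ a b, boxCol lam a = boxCol lam b → boxRow lam b = boxRow lam a + 1 →
      ColRel N (i a) (i b)) : IsRSSYBT N M lam i := by
  have R : ∀ a b, boxRow lam a = boxRow lam b → boxCol lam a < boxCol lam b →
      RowRel N (i a) (i b) := fun a b hr hc =>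
    rowRel_of_adjacent hrow (boxCol lam b - boxCol lam a - 1) hr (by omega)
  have S : ∀ a b, boxCol lam a = boxCol lam b → boxRow lam a < boxRow lam b →
      ColRel N (i a) (i b) := fun a b hc hr =>
    colRel_of_adjacent hcol (boxRow lam b - boxRow lam a - 1) hc (by omega)
  unfold RowRel at R
  unfold ColRel at S
  refine ⟨fun a b h1 h2 => ?_, fun a b h1 h2 => ?_, fun a b h1 h2 h3 h4 => ?_,
    fun a b h1 h2 h3 h4 => ?_⟩
  · have := R a b h1 h2; omega
  · have := S a b h1 h2; omega
  · have := R a b h1 h2; omega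
  · have := S a b h1 h2; omega

/-- The pairs of vertical neighbours whose entries are out of order. -/
def badVertical (lam : Nat.Partition k) (i : Fin k → Fin (N + M)) : Finset (Fin k × Fin k) := by
  classical
  exact Finset.univ.filter fun p => boxCol lam p.1 = boxCol lam p.2 ∧
    boxRow lam p.2 = boxRow lam p.1 + 1 ∧ ¬ ColRel N (i p.1) (i p.2)

/-- The pairs of diagonal neighbours with weakly increasing entries. -/
def badDiagonal (lam : Nat.Partition k) (i : Fin k → Fin (N + M)) : Finset (Fin k × Fin k) :=
  Finset.univ.filter fun p => boxCol lam p.2 = boxCol lam p.1 + 1 ∧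
    boxRow lam p.2 = boxRow lam p.1 + 1 ∧ i p.1 ≤ i p.2

theorem mem_badVertical {i : Fin k → Fin (N + M)} {p : Fin k × Fin k} :
    p ∈ badVertical lam i ↔ boxCol lam p.1 = boxCol lam p.2 ∧
      boxRow lam p.2 = boxRow lam p.1 + 1 ∧ ¬ ColRel N (i p.1) (i p.2) := by
  simp [badVertical]

theorem mem_badDiagonal {i : Fin k → Fin (N + M)} {p : Fin k × Fin k} :
    p ∈ badDiagonal lam i ↔ boxCol lam p.2 = boxCol lam p.1 + 1 ∧
      boxRow lam p.2 = boxRow lam p.1 + 1 ∧ i p.1 ≤ i p.2 := by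
  simp [badDiagonal]

variable {i : Fin k → Fin (N + M)}

/-- Above the lower box of a bad diagonal pair there is a bad vertical pair. -/
theorem exists_badVertical_above
    (hrow : ∀ a b, boxRow lam a = boxRow lam b → boxCol lam b = boxCol lam a + 1 →
      RowRel N (i a) (i b))
    {p : Fin k × Fin k} (hp : p ∈ badDiagonal lam i) :
    ∃ x, boxRow lam x = boxRow lam p.1 ∧ boxCol lam x = boxCol lam p.1 + 1 ∧
      (x, p.2) ∈ badVertical lam i := by
  rw [mem_badDiagonal] at hp
  obtain ⟨x, hxr, hxc⟩ := exists_box lam (b := p.2) (i := boxRow lam p.1) (j := boxCol lam p.2)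
    (by omega) le_rfl
  refine ⟨x, hxr, by omega, mem_badVertical.mpr ⟨hxc, by simp only; omega, ?_⟩⟩
  -- The row gives `i x ≤ i p.1 ≤ i p.2`. The column condition could then hold only with equality
  -- throughout and a super entry, but equality in the row needs an ordinary entry.
  have h1 := hrow p.1 x hxr.symm (by omega)
  have h2 := hp.2.2
  unfold ColRel RowRel at *
  simp only
  omega

/-- Below the upper box of a bad diagonal pair there is a bad vertical pair. -/
theorem exists_badVertical_below
    (hrow : ∀ a b, boxRow lam a = boxRow lam b → boxCol lam b = boxCol lam a + 1 →
      RowRel N (i a) (i b))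
    {p : Fin k × Fin k} (hp : p ∈ badDiagonal lam i) :
    ∃ x, x < p.2 ∧ (p.1, x) ∈ badVertical lam i := by
  rw [mem_badDiagonal] at hp
  obtain ⟨x, hxr, hxc⟩ := exists_box lam (b := p.2) (i := boxRow lam p.2) (j := boxCol lam p.1)
    le_rfl (by omega)
  refine ⟨x, (box_lt_iff lam).mpr (by omega), mem_badVertical.mpr ⟨hxc.symm, by simp only; omega, ?_⟩⟩
  have h1 := hrow x p.2 hxr (by omega)
  have h2 := hp.2.2
  unfold ColRel RowRel at *
  simp only
  omega

/-- Sending a bad diagonal pair to the bad vertical pair with the same lower box is injective. It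
misses the bad vertical pair whose lower box comes first in the numbering: a bad diagonal pair
ending in that box would yield a bad vertical pair ending one box further left. -/
theorem card_badDiagonal_lt
    (hrow : ∀ a b, boxRow lam a = boxRow lam b → boxCol lam b = boxCol lam a + 1 →
      RowRel N (i a) (i b))
    (hne : (badVertical lam i).Nonempty) :
    (badDiagonal lam i).card < (badVertical lam i).card := by
  classical
  have : Nonempty (Fin k) := ⟨hne.choose.1⟩
  choose! f hfr hfc hf using fun p hp => exists_badVertical_above hrow (p := p) hp
  obtain ⟨v, hv, hmin⟩ := (badVertical lam i).exists_min_image Prod.snd hne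
  have hmaps : ∀ p ∈ badDiagonal lam i, (f p, p.2) ∈ (badVertical lam i).erase v := by
    intro p hp
    refine Finset.mem_erase.mpr ⟨?_, hf p hp⟩
    rintro rfl
    obtain ⟨x, hx, hx'⟩ := exists_badVertical_below hrow hp
    exact absurd (hmin _ hx') (not_le.mpr hx)
  refine lt_of_le_of_lt (Finset.card_le_card_of_injOn _ hmaps ?_) (Finset.card_erase_lt_of_mem hv)
  intro p hp p' hp' e
  simp only [Prod.mk.injEq] at e
  have h1 := hfr p hp
  have h2 := hfr p' hp'
  have h3 := hfc p hp
  have h4 := hfc p' hp'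
  rw [e.1] at h1 h3
  exact Prod.ext (box_injective lam (by omega) (by omega)) e.2

theorem badDiagonal_eq_empty
    (hrow : ∀ a b, boxRow lam a = boxRow lam b → boxCol lam b = boxCol lam a + 1 →
      RowRel N (i a) (i b))
    (h : badVertical lam i = ∅) : badDiagonal lam i = ∅ := by
  rw [Finset.eq_empty_iff_forall_notMem]
  intro p hp
  obtain ⟨x, -, -, hx⟩ := exists_badVertical_above hrow hp
  simp [h] at hx

end Partition

/-! ### Values of rational functions -/

section Values

variable {k : ℕ}

theorem const_mul_const (a b : ℂ) : (const a : RatFun k) * const b = const (a * b) := by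
  simp [const]

theorem const_one : (const 1 : RatFun k) = 1 := by simp [const]

theorem hasValueAt_const (a : ℂ) (p : Fin k → ℂ) : HasValueAt (const a) p a :=
  ⟨MvPolynomial.C a, 1, by simp, by simp [const], by simp⟩

theorem algebraMap_ne_zero_of_eval {p : Fin k → ℂ} {Q : MvPolynomial (Fin k) ℂ}
    (h : MvPolynomial.eval p Q ≠ 0) : algebraMap (MvPolynomial (Fin k) ℂ) (RatFun k) Q ≠ 0 := by
  intro h0
  rw [FaithfulSMul.algebraMap_eq_zero_iff] at h0
  exact h (by rw [h0, map_zero])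

theorem HasValueAt.mul {f g : RatFun k} {p : Fin k → ℂ} {v w : ℂ} (hf : HasValueAt f p v)
    (hg : HasValueAt g p w) : HasValueAt (f * g) p (v * w) := by
  obtain ⟨P, Q, hQ, rfl, rfl⟩ := hf
  obtain ⟨P', Q', hQ', rfl, rfl⟩ := hg
  refine ⟨P * P', Q * Q', ?_, ?_, ?_⟩
  · rw [map_mul]; exact mul_ne_zero hQ hQ'
  · rw [map_mul, map_mul, div_mul_div_comm]
  · rw [map_mul, map_mul, div_mul_div_comm]

theorem HasValueAt.add {f g : RatFun k} {p : Fin k → ℂ} {v w : ℂ} (hf : HasValueAt f p v)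
    (hg : HasValueAt g p w) : HasValueAt (f + g) p (v + w) := by
  obtain ⟨P, Q, hQ, rfl, rfl⟩ := hf
  obtain ⟨P', Q', hQ', rfl, rfl⟩ := hg
  refine ⟨P * Q' + Q * P', Q * Q', ?_, ?_, ?_⟩
  · rw [map_mul]; exact mul_ne_zero hQ hQ'
  · rw [map_mul, map_add, map_mul, map_mul,
      div_add_div _ _ (algebraMap_ne_zero_of_eval hQ) (algebraMap_ne_zero_of_eval hQ')]
  · rw [map_mul, map_add, map_mul, map_mul, div_add_div _ _ hQ hQ']

theorem HasValueAt.inv {f : RatFun k} {p : Fin k → ℂ} {v : ℂ} (hf : HasValueAt f p v)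
    (hv : v ≠ 0) : HasValueAt f⁻¹ p v⁻¹ := by
  obtain ⟨P, Q, hQ, rfl, rfl⟩ := hf
  exact ⟨Q, P, fun h => hv (by rw [h, zero_div]), by rw [inv_div], by rw [inv_div]⟩

theorem hasValueAt_ratio {p : Fin k → ℂ} {a : Fin k} (b : Fin k) (h : p a ≠ 0) :
    HasValueAt (ratio a b) p (p b / p a) :=
  ⟨MvPolynomial.X b, MvPolynomial.X a, by simpa using h, rfl, by simp⟩

theorem hasValueAt_sum {ι : Type*} (s : Finset ι) {f : ι → RatFun k} {p : Fin k → ℂ}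
    {v : ι → ℂ} (h : ∀ i ∈ s, HasValueAt (f i) p (v i)) :
    HasValueAt (∑ i ∈ s, f i) p (∑ i ∈ s, v i) := by
  classical
  induction s using Finset.induction_on with
  | empty => simpa [const] using hasValueAt_const (0 : ℂ) p
  | insert i s hi ih =>
    rw [Finset.sum_insert hi, Finset.sum_insert hi]
    exact (h i (by simp)).add (ih fun j hj => h j (by simp [hj]))

/-- The linear factor `1 - c x`. -/
def linFactor (c : ℂ) (x : RatFun k) : RatFun k := 1 - const c * x

theorem hasValueAt_linFactor (c : ℂ) {p : Fin k → ℂ} {a : Fin k} (b : Fin k) (h : p a ≠ 0) :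
    HasValueAt (linFactor c (ratio a b)) p (1 - c * (p b / p a)) := by
  have h1 := ((hasValueAt_const 1 p).add
    ((hasValueAt_const (-c) p).mul (hasValueAt_ratio b h)))
  have e : linFactor c (ratio a b) = const 1 + const (-c) * ratio a b := by
    simp [linFactor, const]; ring
  rw [e, show 1 - c * (p b / p a) = 1 + -c * (p b / p a) by ring]
  exact h1

end Values

/-! ### Orders and limits of specialisations -/

section Orders

variable {k : ℕ} (lam : Nat.Partition k) (q t : ℂ)

/-- The specialisation of `f` at the points `z_a = q^{col a} ξ^{row a} y` is defined near
`ξ = t⁻¹` except possibly at `ξ = t⁻¹`. -/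
def SpecDefined (f : RatFun k) : Prop :=
  ∀ y : ℂ, y ≠ 0 → ∃ g : ℂ → ℂ, ∀ᶠ ξ in 𝓝[≠] t⁻¹, HasValueAt f (dualPoint lam q ξ y) (g ξ)

/-- The specialisation of `f` vanishes identically near `ξ = t⁻¹`. -/
def SpecZero (f : RatFun k) : Prop :=
  ∀ y : ℂ, y ≠ 0 → ∀ᶠ ξ in 𝓝[≠] t⁻¹, HasValueAt f (dualPoint lam q ξ y) 0

/-- The specialisation of `f` has a zero of order `e` at `ξ = t⁻¹`. -/
def SpecOrder (f : RatFun k) (e : ℤ) : Prop :=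
  ∃ L : ℂ, L ≠ 0 ∧ ∀ y : ℂ, y ≠ 0 → ∃ r : ℂ → ℂ,
    (∀ᶠ ξ in 𝓝[≠] t⁻¹, HasValueAt f (dualPoint lam q ξ y) ((1 - t * ξ) ^ e * r ξ)) ∧
    Tendsto r (𝓝[≠] t⁻¹) (𝓝 L)

variable {lam q t}

/-- The second factor only has to be defined for `ξ ≠ t⁻¹`; a pole at `t⁻¹` does no harm. -/
theorem SpecZero.mul {f g : RatFun k} (hf : SpecZero lam q t f) (hg : SpecDefined lam q t g) :
    SpecZero lam q t (f * g) := by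
  intro y hy
  obtain ⟨v, hv⟩ := hg y hy
  filter_upwards [hf y hy, hv] with ξ h1 h2
  simpa using h1.mul h2

theorem SpecZero.hasSpecLimit {f : RatFun k} (hf : SpecZero lam q t f) :
    HasSpecLimit lam q t f 0 :=
  fun y hy => ⟨fun _ => 0, hf y hy, tendsto_const_nhds⟩

theorem SpecDefined.mul {f g : RatFun k} (hf : SpecDefined lam q t f)
    (hg : SpecDefined lam q t g) : SpecDefined lam q t (f * g) := by
  intro y hy
  obtain ⟨v, hv⟩ := hf y hy
  obtain ⟨w, hw⟩ := hg y hy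
  exact ⟨fun ξ => v ξ * w ξ, by filter_upwards [hv, hw] with ξ h1 h2 using h1.mul h2⟩

theorem specDefined_const (a : ℂ) : SpecDefined lam q t (const a) :=
  fun _ _ => ⟨fun _ => a, Eventually.of_forall fun _ => hasValueAt_const a _⟩

theorem specDefined_prod {ι : Type*} (s : Finset ι) {f : ι → RatFun k}
    (h : ∀ i ∈ s, SpecDefined lam q t (f i)) : SpecDefined lam q t (∏ i ∈ s, f i) := by
  classical
  induction s using Finset.induction_on with
  | empty => simpa [const] using specDefined_const (lam := lam) (q := q) (t := t) 1
  | insert i s hi ih =>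
    rw [Finset.prod_insert hi]
    exact (h i (by simp)).mul (ih fun j hj => h j (by simp [hj]))

theorem SpecOrder.specDefined {f : RatFun k} {e : ℤ} (hf : SpecOrder lam q t f e) :
    SpecDefined lam q t f := by
  obtain ⟨L, -, h⟩ := hf
  intro y hy
  obtain ⟨r, hr, -⟩ := h y hy
  exact ⟨_, hr⟩

theorem eventually_one_sub_ne_zero : ∀ᶠ ξ in 𝓝[≠] t⁻¹, 1 - t * ξ ≠ 0 := by
  filter_upwards [self_mem_nhdsWithin] with ξ hξ h
  apply hξ
  exact eq_inv_of_mul_eq_one_right (sub_eq_zero.mp h).symm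

theorem SpecOrder.mul {f g : RatFun k} {d e : ℤ} (hf : SpecOrder lam q t f d)
    (hg : SpecOrder lam q t g e) : SpecOrder lam q t (f * g) (d + e) := by
  obtain ⟨L, hL, h⟩ := hf
  obtain ⟨L', hL', h'⟩ := hg
  refine ⟨L * L', mul_ne_zero hL hL', fun y hy => ?_⟩
  obtain ⟨r, hr, hrL⟩ := h y hy
  obtain ⟨r', hr', hrL'⟩ := h' y hy
  refine ⟨fun ξ => r ξ * r' ξ, ?_, hrL.mul hrL'⟩
  filter_upwards [hr, hr', eventually_one_sub_ne_zero] with ξ h1 h2 h3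
  rw [zpow_add₀ h3, mul_mul_mul_comm]
  exact h1.mul h2

theorem SpecOrder.inv {f : RatFun k} {e : ℤ} (hf : SpecOrder lam q t f e) :
    SpecOrder lam q t f⁻¹ (-e) := by
  obtain ⟨L, hL, h⟩ := hf
  refine ⟨L⁻¹, inv_ne_zero hL, fun y hy => ?_⟩
  obtain ⟨r, hr, hrL⟩ := h y hy
  refine ⟨fun ξ => (r ξ)⁻¹, ?_, hrL.inv₀ hL⟩
  filter_upwards [hr, hrL.eventually_ne hL, eventually_one_sub_ne_zero] with ξ h1 h2 h3
  rw [zpow_neg, ← mul_inv]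
  exact h1.inv (mul_ne_zero (zpow_ne_zero _ h3) h2)

theorem SpecOrder.div {f g : RatFun k} {d e : ℤ} (hf : SpecOrder lam q t f d)
    (hg : SpecOrder lam q t g e) : SpecOrder lam q t (f / g) (d - e) := by
  rw [div_eq_mul_inv, sub_eq_add_neg]
  exact hf.mul hg.inv

theorem specOrder_one : SpecOrder lam q t 1 0 := by
  refine ⟨1, one_ne_zero, fun y _ => ⟨fun _ => 1, Eventually.of_forall fun ξ => ?_,
    tendsto_const_nhds⟩⟩
  simpa [const_one] using hasValueAt_const (1 : ℂ) (dualPoint lam q ξ y)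

theorem specOrder_prod {ι : Type*} (s : Finset ι) {f : ι → RatFun k} {e : ι → ℤ}
    (h : ∀ i ∈ s, SpecOrder lam q t (f i) (e i)) :
    SpecOrder lam q t (∏ i ∈ s, f i) (∑ i ∈ s, e i) := by
  classical
  induction s using Finset.induction_on with
  | empty => simpa using specOrder_one
  | insert i s hi ih =>
    rw [Finset.prod_insert hi, Finset.sum_insert hi]
    exact (h i (by simp)).mul (ih fun j hj => h j (by simp [hj]))

theorem SpecOrder.exists_hasSpecLimit {f : RatFun k} (a : ℂ) (hf : SpecOrder lam q t f 0) :
    ∃ L, HasSpecLimit lam q t (const a * f) L := by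
  obtain ⟨L, -, h⟩ := hf
  refine ⟨a * L, fun y hy => ?_⟩
  obtain ⟨r, hr, hrL⟩ := h y hy
  refine ⟨fun ξ => a * r ξ, ?_, hrL.const_mul a⟩
  filter_upwards [hr] with ξ h1
  simpa using (hasValueAt_const a _).mul h1

theorem SpecOrder.hasSpecLimit_zero (ht : t ≠ 0) {f : RatFun k} (a : ℂ) {e : ℤ} (he : 0 < e)
    (hf : SpecOrder lam q t f e) : HasSpecLimit lam q t (const a * f) 0 := by
  obtain ⟨L, -, h⟩ := hf
  intro y hy
  obtain ⟨r, hr, hrL⟩ := h y hy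
  refine ⟨fun ξ => a * ((1 - t * ξ) ^ e * r ξ), ?_, ?_⟩
  · filter_upwards [hr] with ξ h1 using (hasValueAt_const a _).mul h1
  · lift e to ℕ using he.le
    have h1 : Tendsto (fun ξ : ℂ => (1 - t * ξ) ^ e) (𝓝[≠] t⁻¹) (𝓝 ((1 - t * t⁻¹) ^ e)) :=
      (Continuous.tendsto (by fun_prop) _).mono_left nhdsWithin_le_nhds
    rw [mul_inv_cancel₀ ht, sub_self, zero_pow (by omega)] at h1
    have h2 := (h1.mul hrL).const_mul a
    simp only [zero_mul, mul_zero] at h2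
    simpa only [zpow_natCast] using h2

theorem dualPoint_ne_zero (hq : q ≠ 0) {ξ y : ℂ} (hξ : ξ ≠ 0) (hy : y ≠ 0) (a : Fin k) :
    dualPoint lam q ξ y a ≠ 0 :=
  mul_ne_zero (mul_ne_zero (pow_ne_zero _ hq) (pow_ne_zero _ hξ)) hy

theorem eventually_ne_zero (ht : t ≠ 0) : ∀ᶠ ξ in 𝓝[≠] t⁻¹, ξ ≠ 0 :=
  (continuous_id.tendsto (t⁻¹)).mono_left nhdsWithin_le_nhds |>.eventually_ne (inv_ne_zero ht)

/-- Since `y` drops out of all ratios, orders and limits do not depend on it. -/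
theorem dualPoint_div (hq : q ≠ 0) {ξ y : ℂ} (hξ : ξ ≠ 0) (hy : y ≠ 0) {a b : Fin k} {d : ℤ}
    {s : ℕ} (hd : (boxCol lam b : ℤ) = boxCol lam a + d) (hs : boxRow lam b = boxRow lam a + s) :
    dualPoint lam q ξ y b / dualPoint lam q ξ y a = q ^ d * ξ ^ s := by
  rw [div_eq_iff (dualPoint_ne_zero hq hξ hy a), dualPoint, dualPoint, ← zpow_natCast q,
    ← zpow_natCast q, hd, zpow_add₀ hq, hs, pow_add]
  ring

theorem specDefined_linFactor (hq : q ≠ 0) (ht : t ≠ 0) (c : ℂ) (a b : Fin k) :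
    SpecDefined lam q t (linFactor c (ratio a b)) := fun y hy => ⟨_, by
  filter_upwards [eventually_ne_zero ht] with ξ hξ using
    hasValueAt_linFactor c b (dualPoint_ne_zero hq hξ hy a)⟩

/-- Horizontal neighbours have ratio `q` whatever `ξ` is, so the factor vanishes identically and not
just at `ξ = t⁻¹`. -/
theorem specZero_linFactor (hq : q ≠ 0) (ht : t ≠ 0) {a b : Fin k}
    (hd : boxCol lam b = boxCol lam a + 1) (hs : boxRow lam b = boxRow lam a) :
    SpecZero lam q t (linFactor q⁻¹ (ratio a b)) := by
  intro y hy
  filter_upwards [eventually_ne_zero ht] with ξ hξ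
  have h := hasValueAt_linFactor q⁻¹ b (dualPoint_ne_zero (lam := lam) hq hξ hy a)
  rw [dualPoint_div hq hξ hy (d := 1) (s := 0) (by omega) (by omega)] at h
  simpa [hq] using h

/-- A linear factor that does not vanish at `ξ = t⁻¹`. -/
theorem specOrder_linFactor_zero (hq : q ≠ 0) (ht : t ≠ 0)
    (hgen : ∀ a b : ℤ, q ^ a * t ^ b = 1 → a = 0 ∧ b = 0) {c : ℂ} {m n d : ℤ}
    (hc : c = q ^ m * t ^ n) {s : ℕ} {a b : Fin k} (hd : (boxCol lam b : ℤ) = boxCol lam a + d)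
    (hs : boxRow lam b = boxRow lam a + s) (hne : m + d ≠ 0 ∨ n ≠ s) :
    SpecOrder lam q t (linFactor c (ratio a b)) 0 := by
  refine ⟨1 - c * (q ^ d * t⁻¹ ^ s), ?_, fun y hy => ⟨fun ξ => 1 - c * (q ^ d * ξ ^ s), ?_, ?_⟩⟩
  · intro h
    -- A zero at `ξ = t⁻¹` is a multiplicative relation between `q` and `t`, which must be trivial.
    have h1 : q ^ (m + d) * t ^ (n - s) = 1 := by
      rw [zpow_add₀ hq, zpow_sub₀ ht, zpow_natCast, div_eq_mul_inv, ← inv_pow]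
      rw [hc] at h
      linear_combination -h
    have := hgen _ _ h1
    omega
  · filter_upwards [eventually_ne_zero ht] with ξ hξ
    rw [zpow_zero, one_mul, ← dualPoint_div hq hξ hy hd hs]
    exact hasValueAt_linFactor c b (dualPoint_ne_zero hq hξ hy a)
  · exact (Continuous.tendsto (by fun_prop) _).mono_left nhdsWithin_le_nhds

/-- A linear factor that vanishes at `ξ = t⁻¹`. -/
theorem specOrder_linFactor_one (hq : q ≠ 0) (ht : t ≠ 0) {c : ℂ} {d : ℤ}
    (hc : c * q ^ d = t) {a b : Fin k} (hd : (boxCol lam b : ℤ) = boxCol lam a + d)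
    (hs : boxRow lam b = boxRow lam a + 1) :
    SpecOrder lam q t (linFactor c (ratio a b)) 1 := by
  -- The factor is exactly `1 - t * ξ`, so the cofactor is the constant `1`.
  refine ⟨1, one_ne_zero, fun y hy => ⟨fun ξ => 1, ?_, tendsto_const_nhds⟩⟩
  filter_upwards [eventually_ne_zero ht] with ξ hξ
  have h := hasValueAt_linFactor c b (dualPoint_ne_zero (lam := lam) hq hξ hy a)
  rw [dualPoint_div hq hξ hy hd hs, ← mul_assoc, hc, pow_one] at h
  simpa using h

theorem hasSpecLimit_sum {ι : Type*} (s : Finset ι) {f : ι → RatFun k} {L : ι → ℂ}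
    (h : ∀ i ∈ s, HasSpecLimit lam q t (f i) (L i)) :
    HasSpecLimit lam q t (∑ i ∈ s, f i) (∑ i ∈ s, L i) := by
  intro y hy
  choose! g hg hgL using fun i hi => h i hi y hy
  refine ⟨fun ξ => ∑ i ∈ s, g i ξ, ?_, tendsto_finsetSum s hgL⟩
  filter_upwards [(Filter.eventually_all_finset s).mpr hg] with ξ hξ
  exact hasValueAt_sum s hξ

end Orders

/-! ### The limits of the terms of the fillings -/

theorem qPar_specRoots_zero (qr tr : ℂ) : qPar (specRoots qr tr) 0 = qr ^ 4 := rfl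

theorem qPar_specRoots_one (qr tr : ℂ) :
    qPar (specRoots qr tr) 1 = (qr ^ 4)⁻¹ * tr ^ 4 := by
  simp [qPar, specRoots, mul_pow]

theorem qPar_specRoots_two (qr tr : ℂ) : qPar (specRoots qr tr) 2 = (tr ^ 4)⁻¹ := by
  simp [qPar, specRoots]

theorem qHalf_specRoots_two_sq (qr tr : ℂ) : qHalf (specRoots qr tr) 2 ^ 2 = (tr ^ 4)⁻¹ := by
  simp [qHalf, specRoots]
  ring

section FillingLimits

variable {k : ℕ} {lam : Nat.Partition k} {N M : ℕ} {qr tr q t : ℂ}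

/-- The shift by `q₃^{-1/2}` removes all half-integral powers. The result is the same function as
`dFactor` for `j < i`, which is why strictly decreasing entries cancel the normalisation. -/
theorem deltaFun_eq (hq : q = qr ^ 4) (ht : t = tr ^ 4) (ht0 : t ≠ 0) (x : RatFun k) :
    deltaFun (specRoots qr tr) (const (qHalf (specRoots qr tr) 2)⁻¹ * x) =
      linFactor q x * linFactor (q⁻¹ * t) x / (linFactor 1 x * linFactor t x) := by
  have h2 : qHalf (specRoots qr tr) 2 ^ 2 = t⁻¹ := by rw [qHalf_specRoots_two_sq, ht]
  have h0 : qHalf (specRoots qr tr) 2 ≠ 0 := by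
    intro h
    rw [h] at h2
    exact inv_ne_zero ht0 (by simpa using h2.symm)
  have h3 : (qHalf (specRoots qr tr) 2)⁻¹ * (qHalf (specRoots qr tr) 2)⁻¹ = t := by
    rw [← mul_inv, ← pow_two, h2, inv_inv]
  rw [deltaFun, qPar_specRoots_zero, ← hq]
  simp only [linFactor, ← mul_assoc, const_mul_const]
  rw [mul_assoc q, mul_inv_cancel₀ h0, mul_assoc q⁻¹, h3, mul_one]

theorem dFactor_eq (hq : q = qr ^ 4) (ht : t = tr ^ 4) (i j : Fin (N + M)) (x : RatFun k) :
    dFactor (specRoots qr tr) N M i j x =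
      if i < j then linFactor q⁻¹ x * linFactor (q * t⁻¹) x / (linFactor t⁻¹ x * linFactor 1 x)
      else if j < i then linFactor q x * linFactor (q⁻¹ * t) x / (linFactor t x * linFactor 1 x)
      else if N ≤ (i : ℕ) then
        linFactor q⁻¹ x * linFactor q x / (linFactor t x * linFactor t⁻¹ x)
      else 1 := by
  simp only [dFactor, linFactor, qPar_specRoots_zero, qPar_specRoots_one, qPar_specRoots_two,
    ← hq, ← ht, const_one, one_mul, mul_inv, inv_inv]

/-- The order contributed by a pair of boxes in different rows. -/
theorem specOrder_of_row_lt (hq : q = qr ^ 4) (ht : t = tr ^ 4) (hq0 : q ≠ 0) (ht0 : t ≠ 0)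
    (hgen : ∀ a b : ℤ, q ^ a * t ^ b = 1 → a = 0 ∧ b = 0) (i : Fin k → Fin (N + M))
    {p : Fin k × Fin k} (hp : boxRow lam p.1 < boxRow lam p.2) :
    SpecOrder lam q t ((deltaFun (specRoots qr tr)
        (const (qHalf (specRoots qr tr) 2)⁻¹ * ratio p.1 p.2))⁻¹ *
      dFactor (specRoots qr tr) N M (i p.1) (i p.2) (ratio p.1 p.2))
      ((if p ∈ badVertical lam i then 1 else 0) - (if p ∈ badDiagonal lam i then 1 else 0)) := by
  obtain ⟨s, hs⟩ := Nat.exists_eq_add_of_lt hp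
  rw [add_assoc] at hs
  obtain ⟨d, hd⟩ : ∃ d : ℤ, (boxCol lam p.2 : ℤ) = boxCol lam p.1 + d :=
    ⟨boxCol lam p.2 - boxCol lam p.1, by ring⟩
  have lin : ∀ {c : ℂ} (m n : ℤ), c = q ^ m * t ^ n → (m + d ≠ 0 ∨ n ≠ (s + 1 : ℕ)) →
      SpecOrder lam q t (linFactor c (ratio p.1 p.2)) 0 := fun m n hc hne =>
    specOrder_linFactor_zero hq0 ht0 hgen hc hd hs hne
  have f1 := lin (c := 1) 0 0 (by simp) (by omega)
  have f2 := lin (c := q) 1 0 (by simp) (by omega)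
  have f3 := lin (c := q⁻¹) (-1) 0 (by simp) (by omega)
  have f4 := lin (c := t⁻¹) 0 (-1) (by simp) (by omega)
  have f5 := lin (c := q * t⁻¹) 1 (-1) (by simp) (by omega)
  -- The row difference is `s + 1`, so `s = 0` means adjacent rows. Only `1 - t x` (vertical
  -- neighbours) and `1 - q⁻¹ t x` (diagonal neighbours) can vanish at `ξ = t⁻¹`; the first stands
  -- in the numerator of the inverse of `deltaFun`, the second in its denominator.
  have f6 : SpecOrder lam q t (linFactor t (ratio p.1 p.2)) (if d = 0 ∧ s = 0 then 1 else 0) := by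
    split_ifs with h
    · exact specOrder_linFactor_one hq0 ht0 (by rw [h.1, zpow_zero, mul_one]) hd (by omega)
    · exact lin 0 1 (by simp) (by omega)
  have f7 : SpecOrder lam q t (linFactor (q⁻¹ * t) (ratio p.1 p.2))
      (if d = 1 ∧ s = 0 then 1 else 0) := by
    split_ifs with h
    · refine specOrder_linFactor_one hq0 ht0 ?_ hd (by omega)
      rw [h.1, zpow_one, mul_assoc, mul_comm t, inv_mul_cancel_left₀ hq0]
    · exact lin (-1) 1 (by simp) (by omega)
  have hv : p ∈ badVertical lam i ↔ (d = 0 ∧ s = 0) ∧ ¬ ColRel N (i p.1) (i p.2) := by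
    rw [mem_badVertical, ← and_assoc]
    refine and_congr_left fun _ => ?_
    omega
  have hdg : p ∈ badDiagonal lam i ↔ (d = 1 ∧ s = 0) ∧ i p.1 ≤ i p.2 := by
    rw [mem_badDiagonal, ← and_assoc]
    refine and_congr_left fun _ => ?_
    omega
  rw [deltaFun_eq hq ht ht0, inv_div, dFactor_eq hq ht]
  have hN := (f1.mul f6).div (f2.mul f7)
  simp only [hv, hdg, ColRel]
  -- For increasing entries `dFactor` affects neither the zero nor the pole. For equal super entries
  -- it cancels the vertical zero but keeps the diagonal pole, for equal ordinary entries it is `1`,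
  -- and for decreasing entries it cancels both.
  rcases lt_trichotomy (i p.1) (i p.2) with h | h | h
  · rw [if_pos h]
    convert hN.mul ((f3.mul f5).div (f4.mul f1)) using 1
    simp [h.not_gt, h.ne', h.le]
  · rw [if_neg h.not_lt, if_neg h.not_gt]
    by_cases hs : N ≤ (i p.1 : ℕ)
    · rw [if_pos hs]
      convert hN.mul ((f3.mul f2).div (f6.mul f4)) using 1
      simp [h.symm, hs]
      ring
    · rw [if_neg hs]
      convert hN.mul specOrder_one using 1
      simp [h.not_gt, hs, h.le]
  · rw [if_neg h.not_gt, if_pos h]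
    convert hN.mul ((f2.mul f7).div (f6.mul f1)) using 1
    simp [h, h.not_ge]

/-- The order contributed by a pair of boxes in the same row. -/
theorem specOrder_of_row_eq (hq : q = qr ^ 4) (ht : t = tr ^ 4) (hq0 : q ≠ 0) (ht0 : t ≠ 0)
    (hgen : ∀ a b : ℤ, q ^ a * t ^ b = 1 → a = 0 ∧ b = 0) {i : Fin k → Fin (N + M)}
    {a b : Fin k} (hr : boxRow lam a = boxRow lam b) (hc : boxCol lam a < boxCol lam b)
    (hrel : RowRel N (i a) (i b)) :
    SpecOrder lam q t (dFactor (specRoots qr tr) N M (i a) (i b) (ratio a b)) 0 := by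
  obtain ⟨d, hd⟩ := Nat.exists_eq_add_of_lt hc
  have hd' : (boxCol lam b : ℤ) = boxCol lam a + (d + 1 : ℕ) := by omega
  have lin : ∀ {c : ℂ} (m n : ℤ), c = q ^ m * t ^ n → (m + (d + 1 : ℕ) ≠ 0 ∨ n ≠ (0 : ℕ)) →
      SpecOrder lam q t (linFactor c (ratio a b)) 0 := fun m n hc hne =>
    specOrder_linFactor_zero hq0 ht0 hgen hc hd' (s := 0) (by omega) hne
  have f1 := lin (c := 1) 0 0 (by simp) (by omega)
  have f2 := lin (c := q) 1 0 (by simp) (by omega)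
  have f6 := lin (c := t) 0 1 (by simp) (by omega)
  have f7 := lin (c := q⁻¹ * t) (-1) 1 (by simp) (by omega)
  rw [dFactor_eq hq ht]
  rcases hrel with h | ⟨h, h'⟩
  · rw [if_neg h.not_gt, if_pos h]
    simpa using (f2.mul f7).div (f6.mul f1)
  · rw [if_neg h.not_gt, if_neg h.not_lt, if_neg (by omega)]
    exact specOrder_one

/-- Along a row the ratio is a positive power of `q`, while the denominators only involve the
constants `1`, `t`, `t⁻¹`. They cannot vanish, even if the entries are out of order. -/
theorem specDefined_dFactor (hq : q = qr ^ 4) (ht : t = tr ^ 4) (hq0 : q ≠ 0) (ht0 : t ≠ 0)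
    (hgen : ∀ a b : ℤ, q ^ a * t ^ b = 1 → a = 0 ∧ b = 0) (i j : Fin (N + M))
    {a b : Fin k} (hr : boxRow lam a = boxRow lam b) (hc : boxCol lam a < boxCol lam b) :
    SpecDefined lam q t (dFactor (specRoots qr tr) N M i j (ratio a b)) := by
  obtain ⟨d, hd⟩ := Nat.exists_eq_add_of_lt hc
  have hd' : (boxCol lam b : ℤ) = boxCol lam a + (d + 1 : ℕ) := by omega
  have lin : ∀ {c : ℂ} (m n : ℤ), c = q ^ m * t ^ n → (m + (d + 1 : ℕ) ≠ 0 ∨ n ≠ (0 : ℕ)) →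
      SpecOrder lam q t (linFactor c (ratio a b)) 0 := fun m n hc hne =>
    specOrder_linFactor_zero hq0 ht0 hgen hc hd' (s := 0) (by omega) hne
  have f1 := lin (c := 1) 0 0 (by simp) (by omega)
  have f4 := lin (c := t⁻¹) 0 (-1) (by simp) (by omega)
  have f6 := lin (c := t) 0 1 (by simp) (by omega)
  have l := fun c => specDefined_linFactor (lam := lam) (t := t) hq0 ht0 c a b
  rw [dFactor_eq hq ht]
  split_ifs
  · exact ((l _).mul (l _)).mul (f4.mul f1).inv.specDefined
  · exact ((l _).mul (l _)).mul (f6.mul f1).inv.specDefined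
  · exact ((l _).mul (l _)).mul (f6.mul f4).inv.specDefined
  · exact specOrder_one.specDefined

/-- A pair of horizontal neighbours whose entries are out of order. -/
theorem specZero_dFactor (hq : q = qr ^ 4) (ht : t = tr ^ 4) (hq0 : q ≠ 0) (ht0 : t ≠ 0)
    (hgen : ∀ a b : ℤ, q ^ a * t ^ b = 1 → a = 0 ∧ b = 0) {i j : Fin (N + M)}
    {a b : Fin k} (hr : boxRow lam a = boxRow lam b) (hc : boxCol lam b = boxCol lam a + 1)
    (hrel : ¬ RowRel N i j) :
    SpecZero lam q t (dFactor (specRoots qr tr) N M i j (ratio a b)) := by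
  have hd' : (boxCol lam b : ℤ) = boxCol lam a + 1 := by omega
  have lin : ∀ {c : ℂ} (m n : ℤ), c = q ^ m * t ^ n → (m + 1 ≠ 0 ∨ n ≠ (0 : ℕ)) →
      SpecOrder lam q t (linFactor c (ratio a b)) 0 := fun m n hc hne =>
    specOrder_linFactor_zero hq0 ht0 hgen hc hd' (s := 0) (by omega) hne
  have f1 := lin (c := 1) 0 0 (by simp) (by omega)
  have f4 := lin (c := t⁻¹) 0 (-1) (by simp) (by omega)
  have f6 := lin (c := t) 0 1 (by simp) (by omega)
  have l := fun c => specDefined_linFactor (lam := lam) (t := t) hq0 ht0 c a b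
  have z := specZero_linFactor (lam := lam) (t := t) hq0 ht0 hc hr.symm
  rw [dFactor_eq hq ht]
  unfold RowRel at hrel
  -- The factor `1 - q⁻¹ x` is present for `i < j` and for equal super entries, which are exactly
  -- the cases where `RowRel` fails.
  split_ifs with h1 h2 h3
  · exact (z.mul (l _)).mul (f4.mul f1).inv.specDefined
  · omega
  · exact (z.mul (l _)).mul (f6.mul f4).inv.specDefined
  · omega

/-- The term of a filling as a product over the pairs of boxes. -/
theorem fillingTerm_eq (ρ : Fin 3 → ℂ) (u : Fin (N + M) → ℂ) (i : Fin k → Fin (N + M)) :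
    fillingTerm ρ N M u lam i =
      const ((∏ a, yCoeff ρ (colours N M) (i a)) * ∏ a, u (i a)) *
        ∏ p ∈ Finset.univ.filter (fun p : Fin k × Fin k => p.1 < p.2),
          (if boxRow lam p.1 < boxRow lam p.2 then
            (deltaFun ρ (const (qHalf ρ 2)⁻¹ * ratio p.1 p.2))⁻¹ else 1) *
          dFactor ρ N M (i p.1) (i p.2) (ratio p.1 p.2) := by
  rw [fillingTerm, normFactor, Finset.prod_mul_distrib, mul_assoc]
  congr 2
  rw [← Finset.prod_filter, Finset.filter_filter]
  refine Finset.prod_congr (Finset.filter_congr fun p _ => ?_) fun _ _ => rfl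
  exact ⟨fun h => ⟨(box_lt_iff lam).mpr (Or.inl h), h⟩, And.right⟩

theorem sum_bad_indicator (i : Fin k → Fin (N + M)) :
    ∑ p ∈ Finset.univ.filter (fun p : Fin k × Fin k => p.1 < p.2),
      (((if p ∈ badVertical lam i then 1 else 0) : ℤ) - (if p ∈ badDiagonal lam i then 1 else 0)) =
      (badVertical lam i).card - (badDiagonal lam i).card := by
  rw [Finset.sum_sub_distrib, Finset.sum_boole, Finset.sum_boole]
  congr 3
  · ext p
    simp only [Finset.mem_filter, Finset.mem_univ, true_and, and_iff_right_iff_imp]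
    intro h
    rw [mem_badVertical] at h
    exact (box_lt_iff lam).mpr (by omega)
  · ext p
    simp only [Finset.mem_filter, Finset.mem_univ, true_and, and_iff_right_iff_imp]
    intro h
    rw [mem_badDiagonal] at h
    exact (box_lt_iff lam).mpr (by omega)

/-- Three cases: a bad horizontal pair makes the term identically zero; otherwise a bad vertical
pair makes its order positive; if there is neither, the order is zero and the filling is a
bitableau. -/
theorem exists_hasSpecLimit_fillingTerm (hq : q = qr ^ 4) (ht : t = tr ^ 4) (hq0 : q ≠ 0)
    (ht0 : t ≠ 0) (hgen : ∀ a b : ℤ, q ^ a * t ^ b = 1 → a = 0 ∧ b = 0)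
    (u : Fin (N + M) → ℂ) (i : Fin k → Fin (N + M)) :
    ∃ L, HasSpecLimit lam q t (fillingTerm (specRoots qr tr) N M u lam i) L ∧
      (i ∉ RSSYBT N M lam → L = 0) := by
  rw [fillingTerm_eq]
  by_cases hrow : ∀ a b, boxRow lam a = boxRow lam b → boxCol lam b = boxCol lam a + 1 →
      RowRel N (i a) (i b)
  · have hord := specOrder_prod (lam := lam) (q := q) (t := t)
      (Finset.univ.filter (fun p : Fin k × Fin k => p.1 < p.2))
      (f := fun p => (if boxRow lam p.1 < boxRow lam p.2 then
            (deltaFun (specRoots qr tr)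
              (const (qHalf (specRoots qr tr) 2)⁻¹ * ratio p.1 p.2))⁻¹ else 1) *
          dFactor (specRoots qr tr) N M (i p.1) (i p.2) (ratio p.1 p.2))
      (e := fun p => ((if p ∈ badVertical lam i then 1 else 0) -
        (if p ∈ badDiagonal lam i then 1 else 0))) (fun p hp => by
        simp only [Finset.mem_filter, Finset.mem_univ, true_and] at hp
        by_cases hr : boxRow lam p.1 < boxRow lam p.2
        · simp only [hr, if_true]
          exact specOrder_of_row_lt hq ht hq0 ht0 hgen i hr
        · have hlex := box_lex lam hp
          have hr' : boxRow lam p.1 = boxRow lam p.2 := by omega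
          have hc : boxCol lam p.1 < boxCol lam p.2 := by omega
          simp only [hr, if_false, one_mul]
          rw [if_neg (by rw [mem_badVertical]; omega), if_neg (by rw [mem_badDiagonal]; omega)]
          exact specOrder_of_row_eq hq ht hq0 ht0 hgen hr' hc
            (rowRel_of_adjacent hrow (boxCol lam p.2 - boxCol lam p.1 - 1) hr' (by omega)))
    rw [sum_bad_indicator] at hord
    rcases (badVertical lam i).eq_empty_or_nonempty with hV | hV
    · rw [badDiagonal_eq_empty hrow hV, hV] at hord
      obtain ⟨L, hL⟩ := SpecOrder.exists_hasSpecLimit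
        ((∏ a, yCoeff (specRoots qr tr) (colours N M) (i a)) * ∏ a, u (i a)) hord
      refine ⟨L, hL, fun hi => absurd ?_ hi⟩
      rw [RSSYBT, Finset.mem_filter]
      refine ⟨Finset.mem_univ _, isRSSYBT_of_adjacent hrow fun a b hc hr => ?_⟩
      by_contra hrel
      have : (a, b) ∈ badVertical lam i := mem_badVertical.mpr ⟨hc, hr, hrel⟩
      simp [hV] at this
    · have := card_badDiagonal_lt hrow hV
      exact ⟨0, hord.hasSpecLimit_zero ht0 _ (by omega), fun _ => rfl⟩
  · push Not at hrow
    obtain ⟨a, b, hr, hc, hrel⟩ := hrow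
    refine ⟨0, SpecZero.hasSpecLimit ?_, fun _ => rfl⟩
    have hab : (a, b) ∈ Finset.univ.filter (fun p : Fin k × Fin k => p.1 < p.2) := by
      simp only [Finset.mem_filter, Finset.mem_univ, true_and]
      exact (box_lt_iff lam).mpr (by omega)
    -- The vanishing factor is split off; the remaining product may have a pole at `ξ = t⁻¹` and
    -- only has to be defined nearby.
    rw [← Finset.mul_prod_erase _ _ hab, ← mul_assoc, mul_comm]
    simp only [hr, lt_irrefl, if_false, one_mul]
    rw [mul_comm (const _), ← mul_assoc, mul_comm _ (dFactor _ _ _ _ _ _), mul_assoc]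
    refine (specZero_dFactor hq ht hq0 ht0 hgen hr hc hrel).mul
      ((specDefined_prod _ fun p hp => ?_).mul (specDefined_const _))
    simp only [Finset.mem_erase, Finset.mem_filter, Finset.mem_univ, true_and] at hp
    by_cases hr : boxRow lam p.1 < boxRow lam p.2
    · simp only [hr, if_true]
      exact (specOrder_of_row_lt hq ht hq0 ht0 hgen i hr).specDefined
    · have hlex := box_lex lam hp.2
      simp only [hr, if_false, one_mul]
      exact specDefined_dFactor hq ht hq0 ht0 hgen _ _ (by omega) (by omega)

end FillingLimits

/-! ### Extraction of coefficients from formal series -/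

section Extraction

variable {k : ℕ}

/-- All exponents of the formal series `x` have the property `P`. -/
def SuppOn (P : (Fin k → ℤ) → Prop) (x : Formal k) : Prop :=
  ∀ γ, x.coeff γ ≠ 0 → P (ofLex γ)

theorem SuppOn.mono {P Q : (Fin k → ℤ) → Prop} {x : Formal k} (h : SuppOn P x)
    (hPQ : ∀ γ, P γ → Q γ) : SuppOn Q x := fun γ hγ => hPQ _ (h γ hγ)

theorem suppOn_zero (P : (Fin k → ℤ) → Prop) : SuppOn P 0 := fun _ h => absurd rfl h

theorem SuppOn.add {P : (Fin k → ℤ) → Prop} {x y : Formal k} (hx : SuppOn P x)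
    (hy : SuppOn P y) : SuppOn P (x + y) := by
  intro γ h
  by_cases h1 : x.coeff γ = 0
  · refine hy γ fun h2 => h ?_
    rw [HahnSeries.coeff_add, h1, h2, add_zero]
  · exact hx γ h1

theorem suppOn_sum {ι : Type*} {P : (Fin k → ℤ) → Prop} (s : Finset ι) {x : ι → Formal k}
    (hx : ∀ i ∈ s, SuppOn P (x i)) : SuppOn P (∑ i ∈ s, x i) := by
  classical
  induction s using Finset.induction_on with
  | empty => exact suppOn_zero P
  | insert i s hi ih =>
    rw [Finset.sum_insert hi]
    exact (hx i (by simp)).add (ih fun j hj => hx j (by simp [hj]))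

theorem SuppOn.mul {P Q R : (Fin k → ℤ) → Prop} {x y : Formal k} (hx : SuppOn P x)
    (hy : SuppOn Q y) (h : ∀ γ δ, P γ → Q δ → R (γ + δ)) : SuppOn R (x * y) := by
  intro γ hγ
  obtain ⟨a, ha, b, hb, rfl⟩ := Set.mem_add.mp (HahnSeries.support_mul_subset hγ)
  exact h _ _ (hx a ha) (hy b hb)

theorem suppOn_single {P : (Fin k → ℤ) → Prop} {γ : Fin k → ℤ} (h : P γ) (a : ℂ) :
    SuppOn P (HahnSeries.single (toLex γ) a) := by
  intro δ hδ
  rw [HahnSeries.coeff_single] at hδ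
  split_ifs at hδ with e
  · rw [e]; exact h
  · exact absurd rfl hδ

/-- The monomial `z_b⁻¹` as a formal series. -/
def formalInv (b : Fin k) : Formal k := HahnSeries.single (toLex (Pi.single b 1)) 1

theorem formalInv_pow (b : Fin k) (s : ℕ) :
    formalInv b ^ s = HahnSeries.single (toLex (Pi.single b (s : ℤ))) (1 : ℂ) := by
  induction s with
  | zero => simp
  | succ s ih =>
    rw [pow_succ, ih, formalInv, HahnSeries.single_mul_single, one_mul, ← toLex_add,
      ← Pi.single_add]
    push_cast
    rfl

theorem coeff_mul_formalInv_pow (x : Formal k) (c : Fin k) (p : ℕ) (m : Fin k → ℤ) :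
    (x * formalInv c ^ p).coeff (toLex m) = x.coeff (toLex (m - Pi.single c (p : ℤ))) := by
  have := HahnSeries.coeff_mul_single_add (r := (1 : ℂ)) (x := x)
    (a := toLex (m - Pi.single c (p : ℤ))) (b := toLex (Pi.single c (p : ℤ)))
  rw [← toLex_add, sub_add_cancel, mul_one] at this
  rw [formalInv_pow, this]

/-- The formal series `g` is the value at `z_c` of the power series `f`, whose coefficients do not
involve `z_c`. -/
def IsValueAtVar (c : Fin k) (f : PowerSeries (Formal k)) (g : Formal k) : Prop :=
  (∀ s, SuppOn (fun γ => γ c = 0) (PowerSeries.coeff s f)) ∧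
    ∀ n : ℕ, SuppOn (fun γ => γ c ≤ -n)
      (g - ∑ s ∈ Finset.range n, PowerSeries.coeff s f * formalVar c ^ s)

theorem suppOn_formalVar_pow (c : Fin k) (s : ℕ) :
    SuppOn (fun γ => γ c = -s) (formalVar c ^ s) := by
  rw [formalVar_pow]
  exact suppOn_single (by simp) 1

theorem IsValueAtVar.coeff {c : Fin k} {f : PowerSeries (Formal k)} {g : Formal k}
    (h : IsValueAtVar c f g) (m : Fin k → ℤ) :
    g.coeff (toLex m) = if m c ≤ 0 then
      (PowerSeries.coeff (-(m c)).toNat f).coeff (toLex (m - Pi.single c (m c))) else 0 := by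
  split_ifs with hm
  -- The coefficient at `m` belongs to `z_c ^ (-(m c))`. Cutting after the power `n` leaves a
  -- remainder that only contains higher powers of `z_c`, and the lower powers do not contribute.
  · set n := (-(m c)).toNat with hn
    have h1 : (g - ∑ s ∈ Finset.range (n + 1), PowerSeries.coeff s f * formalVar c ^ s).coeff
        (toLex m) = 0 := by
      by_contra hne
      have := h.2 (n + 1) _ hne
      simp only [ofLex_toLex] at this
      omega
    have h2 : ∀ s ∈ Finset.range n,
        (PowerSeries.coeff s f * formalVar c ^ s).coeff (toLex m) = 0 := by
      intro s hs
      by_contra hne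
      have := ((h.1 s).mul (suppOn_formalVar_pow c s) (R := fun γ => γ c = -s)
        (by intro γ δ h1 h2; rw [Pi.add_apply, h1, h2, zero_add])) _ hne
      simp only [ofLex_toLex] at this
      rw [Finset.mem_range] at hs
      omega
    rw [HahnSeries.coeff_sub, Finset.sum_range_succ, HahnSeries.coeff_add, HahnSeries.coeff_sum,
      Finset.sum_eq_zero h2, zero_add, sub_eq_zero] at h1
    rw [h1, formalVar_pow]
    have e : toLex m = toLex (m - Pi.single c (m c)) + toLex (-Pi.single c (n : ℤ)) := by
      rw [← toLex_add, show (n : ℤ) = -(m c) by omega, Pi.single_neg, neg_neg, sub_add_cancel]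
    rw [e, HahnSeries.coeff_mul_single_add, mul_one]
  · by_contra hne
    have := h.2 0 (toLex m) (by simpa using hne)
    simp only [ofLex_toLex] at this
    omega

theorem isValueAtVar_C {c : Fin k} {x : Formal k} (hx : SuppOn (fun γ => γ c = 0) x) :
    IsValueAtVar c (PowerSeries.C x) x := by
  refine ⟨fun s => ?_, fun n => ?_⟩
  · rw [PowerSeries.coeff_C]
    split_ifs
    · exact hx
    · exact suppOn_zero _
  · cases n with
    | zero => exact (by simpa using hx.mono fun γ h => by simp [h])
    | succ n =>
      rw [Finset.sum_range_succ', Finset.sum_eq_zero]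
      · simpa using suppOn_zero _
      · intro s _
        simp

theorem IsValueAtVar.mul {c : Fin k} {f f' : PowerSeries (Formal k)} {g g' : Formal k}
    (h : IsValueAtVar c f g) (h' : IsValueAtVar c f' g') : IsValueAtVar c (f * f') (g * g') := by
  refine ⟨fun s => ?_, fun n => ?_⟩
  · rw [PowerSeries.coeff_mul]
    exact suppOn_sum _ fun p _ => (h.1 _).mul (h'.1 _) fun γ δ h1 h2 => by simp [h1, h2]
  · set T := ∑ s ∈ Finset.range n, PowerSeries.coeff s f * formalVar c ^ s with hT
    set T' := ∑ s ∈ Finset.range n, PowerSeries.coeff s f' * formalVar c ^ s with hT'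
    -- The product of the two truncations differs from the truncated product only by terms of total
    -- degree at least `n` in `z_c`.
    have hTT : SuppOn (fun γ => γ c ≤ -n)
        (T * T' - ∑ s ∈ Finset.range n, PowerSeries.coeff s (f * f') * formalVar c ^ s) := by
      have e1 : ∑ s ∈ Finset.range n, PowerSeries.coeff s (f * f') * formalVar c ^ s =
          ∑ p ∈ (Finset.range n ×ˢ Finset.range n).filter (fun p => p.1 + p.2 < n),
            PowerSeries.coeff p.1 f * PowerSeries.coeff p.2 f' * formalVar c ^ (p.1 + p.2) := by
        simp_rw [PowerSeries.coeff_mul, Finset.sum_mul]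
        rw [Finset.sum_sigma']
        refine Finset.sum_bij' (fun x _ => x.2) (fun p _ => ⟨p.1 + p.2, p⟩) ?_ ?_ ?_ ?_ ?_
        · rintro ⟨s, p⟩ hx
          simp only [Finset.mem_sigma, Finset.mem_range, Finset.HasAntidiagonal.mem_antidiagonal,
            Finset.mem_filter, Finset.mem_product] at hx ⊢
          omega
        · rintro p hx
          simp only [Finset.mem_sigma, Finset.mem_range, Finset.HasAntidiagonal.mem_antidiagonal,
            Finset.mem_filter, Finset.mem_product] at hx ⊢
          exact ⟨hx.2, trivial⟩
        · rintro ⟨s, p⟩ hx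
          simp only [Finset.mem_sigma, Finset.mem_range, Finset.HasAntidiagonal.mem_antidiagonal] at hx
          obtain ⟨_, rfl⟩ := hx
          rfl
        · intros; rfl
        · rintro ⟨s, p⟩ hx
          simp only [Finset.mem_sigma, Finset.mem_range, Finset.HasAntidiagonal.mem_antidiagonal] at hx
          rw [hx.2]
      rw [hT, hT', Finset.sum_mul_sum, ← Finset.sum_product',
        ← Finset.sum_filter_add_sum_filter_not _ (fun p : ℕ × ℕ => p.1 + p.2 < n), e1]
      have e2 : ∀ p : ℕ × ℕ, PowerSeries.coeff p.1 f * formalVar c ^ p.1 *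
          (PowerSeries.coeff p.2 f' * formalVar c ^ p.2) =
          PowerSeries.coeff p.1 f * PowerSeries.coeff p.2 f' * formalVar c ^ (p.1 + p.2) := by
        intro p; ring
      simp_rw [e2]
      rw [add_sub_cancel_left]
      refine suppOn_sum _ fun p hp => ?_
      simp only [Finset.mem_filter] at hp
      refine ((h.1 p.1).mul (h'.1 p.2) (R := fun γ => γ c = 0) fun γ δ h1 h2 => ?_).mul
        (suppOn_formalVar_pow c (p.1 + p.2)) fun γ δ h1 h2 => ?_
      · simp [h1, h2]
      · rw [Pi.add_apply, h1, h2]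
        omega
    have hg' : SuppOn (fun γ => γ c ≤ 0) g' := by simpa using h'.2 0
    have hTs : SuppOn (fun γ => γ c ≤ 0) T := by
      refine suppOn_sum _ fun s _ => (h.1 s).mul (suppOn_formalVar_pow c s) fun γ δ h1 h2 => ?_
      rw [Pi.add_apply, h1, h2]
      omega
    have e : g * g' - ∑ s ∈ Finset.range n, PowerSeries.coeff s (f * f') * formalVar c ^ s =
        (g - T) * g' + T * (g' - T') +
          (T * T' - ∑ s ∈ Finset.range n, PowerSeries.coeff s (f * f') * formalVar c ^ s) := by
      ring
    rw [e]
    refine (((h.2 n).mul hg' fun γ δ h1 h2 => ?_).add (hTs.mul (h'.2 n) fun γ δ h1 h2 => ?_)).add hTT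
    · rw [Pi.add_apply]; omega
    · rw [Pi.add_apply]; omega

theorem isValueAtVar_prod {ι : Type*} {c : Fin k} (S : Finset ι) {f : ι → PowerSeries (Formal k)}
    {g : ι → Formal k} (h : ∀ b ∈ S, IsValueAtVar c (f b) (g b)) :
    IsValueAtVar c (∏ b ∈ S, f b) (∏ b ∈ S, g b) := by
  classical
  induction S using Finset.induction_on with
  | empty =>
    simpa using isValueAtVar_C (c := c) (x := 1)
      (suppOn_single (P := fun γ => γ c = 0) (γ := 0) rfl 1)
  | insert b S hb ih =>
    rw [Finset.prod_insert hb, Finset.prod_insert hb]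
    exact (h b (by simp)).mul (ih fun j hj => h j (by simp [hj]))

/-- Positive order is what makes `heval` a genuine substitution. It holds because the first nonzero
exponent in the lexicographic order is the one at `b`. -/
theorem orderTop_ratio_pos {b c : Fin k} (h : b < c) :
    0 < (HahnSeries.single (toLex (Pi.single b 1 - Pi.single c 1 : Fin k → ℤ)) (1 : ℂ)).orderTop := by
  rw [HahnSeries.orderTop_single one_ne_zero, ← WithTop.coe_zero, WithTop.coe_lt_coe]
  refine ⟨b, fun j hj => ?_, ?_⟩
  · have h1 : j ≠ b := hj.ne
    have h2 : j ≠ c := (hj.trans h).ne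
    change (0 : ℤ) = (Pi.single b 1 - Pi.single c 1 : Fin k → ℤ) j
    simp [h1, h2]
  · change (0 : ℤ) < (Pi.single b 1 - Pi.single c 1 : Fin k → ℤ) b
    simp [h.ne]

theorem ratioSeries_X {b c : Fin k} (h : b < c) :
    ratioSeries PowerSeries.X b c = formalInv b * formalVar c := by
  rw [ratioSeries, PowerSeries.heval_X _ (orderTop_ratio_pos h), formalInv, formalVar,
    HahnSeries.single_mul_single, ← toLex_add, one_mul, sub_eq_add_neg]

theorem ratioSeries_mul (F F' : PowerSeries ℂ) (b c : Fin k) :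
    ratioSeries (F * F') b c = ratioSeries F b c * ratioSeries F' b c := map_mul _ _ _

theorem ratioSeries_C (a : ℂ) (b c : Fin k) :
    ratioSeries (PowerSeries.C a) b c = HahnSeries.C a := by
  rw [ratioSeries, PowerSeries.heval_C]
  ext γ
  simp [HahnSeries.C_apply, HahnSeries.coeff_single, HahnSeries.coeff_one]

theorem suppOn_ratioSeries (F : PowerSeries ℂ) {b c : Fin k} (h : b < c) :
    SuppOn (fun γ => γ c ≤ 0) (ratioSeries F b c) := by
  intro γ hγ
  rw [ratioSeries, PowerSeries.coeff_heval] at hγ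
  obtain ⟨n, hn⟩ : ∃ n, (PowerSeries.coeff n F) • ((HahnSeries.single
      (toLex (Pi.single b 1 - Pi.single c 1 : Fin k → ℤ)) (1 : ℂ)) ^ n).coeff γ ≠ 0 := by
    by_contra! hall
    refine hγ (finsum_eq_zero_of_forall_eq_zero fun n => ?_)
    rw [HahnSeries.SummableFamily.coeff_apply,
      HahnSeries.SummableFamily.powerSeriesFamily_of_orderTop_pos (orderTop_ratio_pos h),
      HahnSeries.coeff_smul, hall]
  have h1 := right_ne_zero_of_smul hn
  rw [HahnSeries.single_pow, one_pow, HahnSeries.coeff_single] at h1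
  have h2 : γ = n • toLex (Pi.single b 1 - Pi.single c 1 : Fin k → ℤ) := by
    by_contra h3
    rw [if_neg h3] at h1
    exact h1 rfl
  rw [h2]
  change (n • (Pi.single b 1 - Pi.single c 1 : Fin k → ℤ)) c ≤ 0
  simp [h.ne']

/-- As a series in `z_c` the coefficients are those of `F` times powers of `z_b⁻¹`; the remainder
after `n` terms is `(z_c / z_b) ^ n` times another series in the same ratio. -/
theorem isValueAtVar_ratioSeries (F : PowerSeries ℂ) {b c : Fin k} (h : b < c) :
    IsValueAtVar c
      (PowerSeries.rescale (formalInv b) (PowerSeries.map (HahnSeries.C : ℂ →+* Formal k) F))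
      (ratioSeries F b c) := by
  have hcoeff : ∀ s, PowerSeries.coeff s (PowerSeries.rescale (formalInv b)
      (PowerSeries.map (HahnSeries.C : ℂ →+* Formal k) F)) =
      formalInv b ^ s * HahnSeries.C (PowerSeries.coeff s F) := fun s => by
    rw [PowerSeries.coeff_rescale, PowerSeries.coeff_map]
  refine ⟨fun s => ?_, fun n => ?_⟩
  · rw [hcoeff, formalInv_pow]
    refine (suppOn_single (P := fun γ => γ c = 0) (by simp [h.ne']) 1).mul
      (suppOn_single (P := fun γ => γ c = 0) (γ := 0) rfl _) fun γ δ h1 h2 => ?_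
    simp [h1, h2]
  · have e : ratioSeries F b c - ∑ s ∈ Finset.range n, PowerSeries.coeff s
        (PowerSeries.rescale (formalInv b)
          (PowerSeries.map (HahnSeries.C : ℂ →+* Formal k) F)) * formalVar c ^ s =
        formalInv b ^ n * formalVar c ^ n *
          ratioSeries (PowerSeries.mk fun i => PowerSeries.coeff (i + n) F) b c := by
      have h1 := PowerSeries.eq_X_pow_mul_shift_add_trunc n F
      have h2 : ratioSeries F b c = ratioSeries (PowerSeries.X ^ n *
          (PowerSeries.mk fun i => PowerSeries.coeff (i + n) F) + (PowerSeries.trunc n F : PowerSeries ℂ)) b c := by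
        rw [← h1]
      have h3 : ratioSeries (PowerSeries.trunc n F : PowerSeries ℂ) b c =
          ∑ s ∈ Finset.range n, PowerSeries.coeff s
            (PowerSeries.rescale (formalInv b)
              (PowerSeries.map (HahnSeries.C : ℂ →+* Formal k) F)) * formalVar c ^ s := by
        have h4 : (PowerSeries.trunc n F : PowerSeries ℂ) =
            ∑ s ∈ Finset.range n, PowerSeries.C (PowerSeries.coeff s F) * PowerSeries.X ^ s := by
          refine PowerSeries.ext fun m => ?_
          simp [PowerSeries.coeff_trunc, PowerSeries.coeff_X_pow]
        rw [h4, ratioSeries, map_sum]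
        refine Finset.sum_congr rfl fun s _ => ?_
        rw [← ratioSeries, ratioSeries_mul, ratioSeries_C, hcoeff]
        have h5 : ratioSeries (PowerSeries.X ^ s) b c = (ratioSeries PowerSeries.X b c) ^ s :=
          map_pow _ _ _
        rw [h5, ratioSeries_X h, mul_pow]
        ring
      rw [h2, ratioSeries, map_add, ← ratioSeries, ← ratioSeries, h3, add_sub_cancel_right,
        ratioSeries_mul]
      have h5 : ratioSeries (PowerSeries.X ^ n) b c = (ratioSeries PowerSeries.X b c) ^ n :=
        map_pow _ _ _
      rw [h5, ratioSeries_X h, mul_pow]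
    rw [e, formalInv_pow]
    refine ((suppOn_single (P := fun γ => γ c = 0) (by simp [h.ne']) 1).mul
      (suppOn_formalVar_pow c n) (R := fun γ => γ c = -n) fun γ δ h1 h2 => ?_).mul
      (suppOn_ratioSeries _ h) fun γ δ h1 h2 => ?_
    · simp [h1, h2]
    · rw [Pi.add_apply, h1]
      omega

end Extraction

/-! ### Modes of vertex operators and their vacuum expectation values -/

section Wick

variable {n k : ℕ}

/-- The vector obtained from the vacuum by `a_{-r}` on the `l`-th factor, and `0` for `r = 0`. -/
def creVar (l : Fin n) (r : ℕ) : Fock n :=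
  if h : 0 < r then MvPolynomial.X (l, (⟨r, h⟩ : ℕ+)) else 0

/-- `exp (∑ B_{l,r} a^{(l)}_{-r} z^r)` applied to the vacuum. -/
def creSeries (B : Fin n → ℕ → ℂ) : PowerSeries (Fock n) :=
  expSeries (PowerSeries.mk fun r => ∑ l, MvPolynomial.C (B l r) * creVar l r)

/-- The action of `exp (∑ A_{l,r} z^{-r} ∂_{l,r})` on the Fock space. -/
def shiftHom (A : Fin n → ℕ → ℂ) : Fock n →ₐ[ℂ] Polynomial (Fock n) :=
  MvPolynomial.aeval fun s => Polynomial.C (MvPolynomial.X s) +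
    Polynomial.C (MvPolynomial.C (A s.1 s.2)) * Polynomial.X ^ (s.2 : ℕ)

/-- The coefficient of `z^{-m}` in `exp (∑ B_{l,r} a^{(l)}_{-r} z^r) exp (∑ A_{l,r} z^{-r} ∂_{l,r})`. -/
def vertexMode (A B : Fin n → ℕ → ℂ) (m : ℤ) : Module.End ℂ (Fock n) :=
  Polynomial.lsum (fun p => if m ≤ (p : ℤ) then
    LinearMap.mulLeft ℂ (PowerSeries.coeff ((p : ℤ) - m).toNat (creSeries B)) else 0) ∘ₗ
      (shiftHom A).toLinearMap

theorem vertexMode_apply (A B : Fin n → ℕ → ℂ) (m : ℤ) (v : Fock n) :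
    vertexMode A B m v = ∑ p ∈ (shiftHom A v).support, if m ≤ (p : ℤ) then
      PowerSeries.coeff ((p : ℤ) - m).toNat (creSeries B) * (shiftHom A v).coeff p else 0 := by
  rw [vertexMode, LinearMap.comp_apply, Polynomial.lsum_apply, Polynomial.sum_def]
  refine Finset.sum_congr rfl fun p _ => ?_
  split_ifs <;> simp

/-- The contraction of the annihilation part `A` with the creation part `B`. -/
def contraction (A B : Fin n → ℕ → ℂ) : PowerSeries ℂ :=
  expSeries (PowerSeries.mk fun r => if r = 0 then 0 else ∑ l, A l r * B l r)

/-- The functional `⟨0| ∏_{b ∈ S} exp (∑ A^{(b)}_{l,r} z_b^{-r} ∂_{l,r})`. -/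
def evalHom (A : Fin k → Fin n → ℕ → ℂ) (S : Finset (Fin k)) : Fock n →ₐ[ℂ] Formal k :=
  MvPolynomial.aeval fun s => ∑ b ∈ S, HahnSeries.C (A b s.1 s.2) * formalInv b ^ (s.2 : ℕ)

theorem algebraMap_formal (a : ℂ) : algebraMap ℂ (Formal k) a = HahnSeries.C a := by
  rw [HahnSeries.algebraMap_apply]
  rfl

theorem evalHom_C (A : Fin k → Fin n → ℕ → ℂ) (S : Finset (Fin k)) (a : ℂ) :
    evalHom A S (MvPolynomial.C a) = HahnSeries.C a := by
  rw [evalHom, MvPolynomial.aeval_C, algebraMap_formal]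

theorem evalHom_creVar (A : Fin k → Fin n → ℕ → ℂ) (S : Finset (Fin k)) (l : Fin n) {r : ℕ}
    (hr : r ≠ 0) :
    evalHom A S (creVar l r) = ∑ b ∈ S, HahnSeries.C (A b l r) * formalInv b ^ r := by
  rw [creVar, dif_pos (Nat.pos_of_ne_zero hr), evalHom, MvPolynomial.aeval_X]
  rfl

/-- An algebra map commutes with exponentials, and it sends each creation operator to a sum over `b
∈ S`, so the exponential splits into a product. This is where the contractions arise. -/
theorem map_evalHom_creSeries (A : Fin k → Fin n → ℕ → ℂ) (S : Finset (Fin k))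
    (B : Fin n → ℕ → ℂ) :
    PowerSeries.map (evalHom A S : Fock n →+* Formal k) (creSeries B) =
      ∏ b ∈ S, PowerSeries.rescale (formalInv b)
        (PowerSeries.map (HahnSeries.C : ℂ →+* Formal k) (contraction (A b) B)) := by
  have hC : (HahnSeries.C : ℂ →+* Formal k) = (Algebra.ofId ℂ (Formal k) : ℂ →+* Formal k) :=
    RingHom.ext fun x => (algebraMap_formal x).symm
  simp_rw [contraction, hC, map_expSeries, rescale_expSeries]
  rw [creSeries, map_expSeries, ← expSeries_sum]
  · congr 1
    refine PowerSeries.ext fun r => ?_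
    rw [map_sum, PowerSeries.coeff_map, PowerSeries.coeff_mk]
    simp_rw [PowerSeries.coeff_rescale, PowerSeries.coeff_map, PowerSeries.coeff_mk]
    by_cases hr : r = 0
    · subst hr
      simp [creVar]
    · simp only [hr, if_false, ← hC, map_sum, map_mul, RingHom.coe_coe, evalHom_C,
        evalHom_creVar A S _ hr, Finset.mul_sum]
      rw [Finset.sum_comm]
      refine Finset.sum_congr rfl fun b _ => Finset.sum_congr rfl fun l _ => ?_
      ring
  · intro b _
    simp

/-- Substitutions by shifts add up: shift by the `c`-th operator first, keeping its variable as a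
polynomial variable, then apply the others and put `z_c⁻¹` for that variable. -/
theorem evalHom_insert (A : Fin k → Fin n → ℕ → ℂ) {S : Finset (Fin k)} {c : Fin k} (hc : c ∉ S)
    (v : Fock n) : evalHom A (insert c S) v =
      ∑ p ∈ (shiftHom (A c) v).support,
        evalHom A S ((shiftHom (A c) v).coeff p) * formalInv c ^ p := by
  have key : evalHom A (insert c S) v =
      Polynomial.eval₂ (evalHom A S : Fock n →+* Formal k) (formalInv c) (shiftHom (A c) v) := by
    induction v using MvPolynomial.induction_on with
    | C a =>
      rw [evalHom_C, shiftHom, MvPolynomial.aeval_C, Polynomial.algebraMap_apply,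
        Polynomial.eval₂_C, MvPolynomial.algebraMap_eq, RingHom.coe_coe, evalHom_C]
    | add p q hp hq => rw [map_add, map_add, Polynomial.eval₂_add, hp, hq]
    | mul_X p s hp =>
      rw [map_mul, map_mul, Polynomial.eval₂_mul, hp]
      congr 1
      rw [shiftHom, MvPolynomial.aeval_X, Polynomial.eval₂_add, Polynomial.eval₂_C,
        Polynomial.eval₂_mul, Polynomial.eval₂_C, Polynomial.eval₂_pow, Polynomial.eval₂_X,
        RingHom.coe_coe, evalHom_C, evalHom, evalHom, MvPolynomial.aeval_X, MvPolynomial.aeval_X,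
        Finset.sum_insert hc, add_comm]
  rw [key, Polynomial.eval₂_eq_sum, Polynomial.sum_def]
  rfl

/-- The product of the contractions of all pairs of operators with positions in `S`. -/
def contractionProd (A B : Fin k → Fin n → ℕ → ℂ) (S : Finset (Fin k)) : Formal k :=
  ∏ c ∈ S, ∏ b ∈ S.filter (· < c), ratioSeries (contraction (A b) (B c)) b c

theorem contractionProd_insert (A B : Fin k → Fin n → ℕ → ℂ) {S : Finset (Fin k)} {c : Fin k}
    (hc : ∀ b ∈ S, b < c) : contractionProd A B (insert c S) =
      contractionProd A B S * ∏ b ∈ S, ratioSeries (contraction (A b) (B c)) b c := by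
  have hcS : c ∉ S := fun h => lt_irrefl _ (hc c h)
  rw [contractionProd, Finset.prod_insert hcS, mul_comm, contractionProd]
  congr 1
  · refine Finset.prod_congr rfl fun d hd => Finset.prod_congr ?_ fun _ _ => rfl
    rw [Finset.filter_insert, if_neg (hc d hd).not_gt]
  · refine Finset.prod_congr ?_ fun _ _ => rfl
    rw [Finset.filter_insert, if_neg (lt_irrefl c), Finset.filter_true_of_mem hc]

/-- Wick's theorem: the matrix elements `⟨0| V_1(z_1) V_2(z_2) ⋯ |v⟩` of vertex operators. -/
theorem coeff_contractionProd_mul_evalHom (A B : Fin k → Fin n → ℕ → ℂ) (L : List (Fin k))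
    (hL : L.Pairwise (· < ·)) (v : Fock n) (m : Fin k → ℤ) :
    (contractionProd A B L.toFinset * evalHom A L.toFinset v).coeff (toLex m) =
      if ∀ b, b ∉ L → m b = 0 then
        vacuumCoeff ((L.map fun a => vertexMode (A a) (B a) (m a)).prod v) else 0 := by
  -- The rightmost operator acts first on `v`, so it is the one to peel off. Its index is the
  -- largest, hence the new contractions contain only nonnegative powers of `z_c`.
  induction L using List.reverseRecOn generalizing v m with
  | nil =>
    have hev : evalHom A ∅ v = HahnSeries.C (vacuumCoeff v) := by
      have : evalHom A (∅ : Finset (Fin k)) = (Algebra.ofId ℂ (Formal k)).comp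
          (MvPolynomial.aeval (0 : Fin n × ℕ+ → ℂ)) := by
        refine MvPolynomial.algHom_ext fun s => ?_
        simp [evalHom]
      rw [this, AlgHom.comp_apply, Algebra.ofId_apply, algebraMap_formal, MvPolynomial.aeval_zero]
      rfl
    simp only [List.toFinset_nil, contractionProd, Finset.prod_empty, one_mul, hev,
      HahnSeries.C_apply, HahnSeries.coeff_single, List.not_mem_nil, not_false_eq_true,
      forall_const, List.map_nil, List.prod_nil, Module.End.one_apply]
    have hiff : toLex m = 0 ↔ ∀ b, m b = 0 :=
      ⟨fun h b => congrFun (toLex.injective h) b, fun h => congrArg toLex (funext h)⟩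
    by_cases h : toLex m = 0
    · rw [if_pos h, if_pos (hiff.mp h)]
    · rw [if_neg h, if_neg fun h' => h (hiff.mpr h')]
  | append_singleton L c ih =>
    rw [List.pairwise_append] at hL
    have hlt : ∀ b ∈ L.toFinset, b < c := fun b hb =>
      hL.2.2 b (List.mem_toFinset.mp hb) c (List.mem_singleton_self c)
    have hcL : c ∉ L := fun h => lt_irrefl c (hlt c (List.mem_toFinset.mpr h))
    have hS : (L ++ [c]).toFinset = insert c L.toFinset := by
      ext; simp
    -- The vanishing clause of the induction hypothesis is used here: the series for `L` does not
    -- involve `z_c`.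
    have hindep : ∀ w, SuppOn (fun γ => γ c = 0)
        (contractionProd A B L.toFinset * evalHom A L.toFinset w) := by
      intro w γ hγ
      have := ih hL.1 w (ofLex γ)
      rw [toLex_ofLex] at this
      rw [this] at hγ
      by_contra hne
      rw [if_neg fun h => hne (h c hcL)] at hγ
      exact hγ rfl
    have hval : ∀ w, IsValueAtVar c
        (PowerSeries.C (contractionProd A B L.toFinset * evalHom A L.toFinset w) *
          PowerSeries.map (evalHom A L.toFinset : Fock n →+* Formal k) (creSeries (B c)))
        (contractionProd A B L.toFinset * evalHom A L.toFinset w *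
          ∏ b ∈ L.toFinset, ratioSeries (contraction (A b) (B c)) b c) := by
      intro w
      refine (isValueAtVar_C (hindep w)).mul ?_
      rw [map_evalHom_creSeries]
      exact isValueAtVar_prod _ fun b hb => isValueAtVar_ratioSeries _ (hlt b hb)
    set m' : Fin k → ℤ := m - Pi.single c (m c) with hm'
    have hm'b : ∀ b, b ≠ c → m' b = m b := fun b hb => by simp [hm', hb]
    have hm'c : m' c = 0 := by simp [hm']
    rw [hS, contractionProd_insert A B hlt, evalHom_insert A (by simpa using hcL), Finset.mul_sum,
      HahnSeries.coeff_sum]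
    -- The annihilation part supplies `z_c ^ (-p)`, so the creation part has to supply `z_c ^ (p - m
    -- c)`, which requires `m c ≤ p`.
    have hterm : ∀ p ∈ (shiftHom (A c) v).support,
        (contractionProd A B L.toFinset *
          (∏ b ∈ L.toFinset, ratioSeries (contraction (A b) (B c)) b c) *
          (evalHom A L.toFinset ((shiftHom (A c) v).coeff p) * formalInv c ^ p)).coeff (toLex m) =
        if m c ≤ (p : ℤ) then (contractionProd A B L.toFinset * evalHom A L.toFinset
          (PowerSeries.coeff ((p : ℤ) - m c).toNat (creSeries (B c)) *
            (shiftHom (A c) v).coeff p)).coeff (toLex m') else 0 := by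
      intro p _
      rw [← mul_assoc, coeff_mul_formalInv_pow, mul_right_comm, (hval _).coeff]
      have e1 : (m - Pi.single c (p : ℤ) : Fin k → ℤ) c = m c - p := by simp
      have e2 : m - Pi.single c (p : ℤ) - Pi.single c (m c - p) = m' := by
        rw [hm', sub_sub, ← Pi.single_add]
        congr 2
        ring
      rw [e1, e2, PowerSeries.coeff_C_mul, PowerSeries.coeff_map, map_mul, RingHom.coe_coe,
        neg_sub, mul_assoc, mul_comm (evalHom A L.toFinset ((shiftHom (A c) v).coeff p))]
      exact if_congr (by omega) rfl rfl
    rw [Finset.sum_congr rfl hterm]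
    have hmap : L.map (fun a => vertexMode (A a) (B a) (m' a)) =
        L.map fun a => vertexMode (A a) (B a) (m a) :=
      List.map_congr_left fun a ha => by rw [hm'b a fun h => hcL (h ▸ ha)]
    have hcond : (∀ b, b ∉ L → m' b = 0) ↔ ∀ b, b ∉ L ++ [c] → m b = 0 := by
      constructor
      · intro h b hb
        simp only [List.mem_append, List.mem_singleton, not_or] at hb
        rw [← hm'b b hb.2]
        exact h b hb.1
      · intro h b hb
        by_cases hbc : b = c
        · rw [hbc, hm'c]
        · rw [hm'b b hbc]
          exact h b (by simp [hb, hbc])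
    simp_rw [ih hL.1, hmap, hcond]
    split_ifs with h
    · rw [List.map_append, List.prod_append, List.map_singleton, List.prod_singleton,
        Module.End.mul_apply, vertexMode_apply, map_sum, vacuumCoeff, map_sum]
      refine Finset.sum_congr rfl fun p _ => ?_
      split_ifs
      · rfl
      · simp
    · simp

theorem contractionProd_univ (A B : Fin k → Fin n → ℕ → ℂ) :
    contractionProd A B Finset.univ =
      ∏ p ∈ Finset.univ.filter (fun p : Fin k × Fin k => p.1 < p.2),
        ratioSeries (contraction (A p.1) (B p.2)) p.1 p.2 := by
  rw [contractionProd, Finset.prod_filter, ← Finset.univ_product_univ, Finset.prod_product_right]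
  refine Finset.prod_congr rfl fun c _ => ?_
  rw [Finset.prod_filter]

/-- The vacuum expectation value of a product of vertex operators. -/
theorem coeff_prod_contraction (A B : Fin k → Fin n → ℕ → ℂ) (m : Fin k → ℤ) :
    (∏ p ∈ Finset.univ.filter (fun p : Fin k × Fin k => p.1 < p.2),
        ratioSeries (contraction (A p.1) (B p.2)) p.1 p.2).coeff (toLex m) =
      vacuumCoeff ((List.ofFn fun a => vertexMode (A a) (B a) (m a)).prod 1) := by
  have h := coeff_contractionProd_mul_evalHom A B (List.finRange k) (List.pairwise_lt_finRange k) 1 m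
  rw [if_pos fun b hb => absurd (List.mem_finRange b) hb, map_one, mul_one,
    List.toFinset_finRange, contractionProd_univ] at h
  rw [h, List.ofFn_eq_map]

end Wick

/-! ### The currents as vertex operators -/

section Operators

variable {n : ℕ}

theorem aNeg_eq (l : Fin n) (r : ℕ) : aNeg l r = Algebra.lmul ℂ (Fock n) (creVar l r) := by
  unfold aNeg creVar
  split_ifs
  · rfl
  · rw [map_zero]

theorem coeff_zero_creSeries_log (B : Fin n → ℕ → ℂ) : PowerSeries.coeff 0
    (PowerSeries.mk fun r => ∑ l, MvPolynomial.C (B l r) * creVar l r) = 0 := by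
  simp [creVar]

theorem creSeries_add (B B' : Fin n → ℕ → ℂ) :
    creSeries (B + B') = creSeries B * creSeries B' := by
  rw [creSeries, creSeries, creSeries, ← expSeries_add (coeff_zero_creSeries_log B)
    (coeff_zero_creSeries_log B') (Commute.all _ _)]
  congr 1
  refine PowerSeries.ext fun r => ?_
  simp [Finset.sum_add_distrib, add_mul]

theorem creSeries_sum {ι : Type*} (s : Finset ι) (B : ι → Fin n → ℕ → ℂ) :
    creSeries (∑ i ∈ s, B i) = ∏ i ∈ s, creSeries (B i) := by
  classical
  induction s using Finset.induction_on with
  | empty =>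
    have : (PowerSeries.mk fun r => ∑ l, MvPolynomial.C ((0 : Fin n → ℕ → ℂ) l r) * creVar l r) =
        0 := PowerSeries.ext fun r => by simp
    rw [Finset.sum_empty, Finset.prod_empty, creSeries, this, expSeries_zero]
  | insert i s hi ih => rw [Finset.sum_insert hi, Finset.prod_insert hi, creSeries_add, ih]

/-- Creation operators are multiplications, so their exponentials can be computed in the commutative
algebra `Fock n` and carried over by `lmul`. -/
theorem expSeries_sum_aNeg (B : Fin n → ℕ → ℂ) :
    expSeries (PowerSeries.mk fun r => ∑ l, B l r • aNeg l r) =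
      PowerSeries.map (Algebra.lmul ℂ (Fock n) : Fock n →+* Module.End ℂ (Fock n))
        (creSeries B) := by
  rw [creSeries, map_expSeries]
  congr 1
  refine PowerSeries.ext fun r => ?_
  rw [PowerSeries.coeff_mk, PowerSeries.coeff_map, PowerSeries.coeff_mk, map_sum]
  refine Finset.sum_congr rfl fun l _ => ?_
  rw [aNeg_eq, ← MvPolynomial.smul_eq_C_mul]
  exact (map_smul _ _ _).symm

theorem expSeries_smul_aNeg (l : Fin n) (s : ℕ → ℂ) :
    expSeries (PowerSeries.mk fun r => s r • aNeg l r) =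
      PowerSeries.map (Algebra.lmul ℂ (Fock n) : Fock n →+* Module.End ℂ (Fock n))
        (creSeries fun l' r => if l' = l then s r else 0) := by
  rw [← expSeries_sum_aNeg]
  congr 1
  refine PowerSeries.ext fun r => ?_
  simp

/-- `∂ / ∂ a_{-r}` on the `l`-th factor, and `0` for `r = 0`. -/
def derOp (l : Fin n) (r : ℕ) : Module.End ℂ (Fock n) :=
  if h : 0 < r then (MvPolynomial.pderiv (R := ℂ) (l, r.toPNat h)).toLinearMap else 0

/-- The series of operators `exp (∑ A_{l,r} z^{-r} ∂_{l,r})`. -/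
def annSeries (A : Fin n → ℕ → ℂ) : PowerSeries (Module.End ℂ (Fock n)) :=
  expSeries (PowerSeries.mk fun r => ∑ l, A l r • derOp l r)

theorem derOp_apply (l : Fin n) {r : ℕ} (h : 0 < r) (v : Fock n) :
    derOp l r v = MvPolynomial.pderiv (l, r.toPNat h) v := by
  rw [derOp, dif_pos h]
  rfl

theorem derOp_zero (l : Fin n) : derOp l 0 = 0 := dif_neg (lt_irrefl 0)

theorem commute_derOp (l l' : Fin n) (r r' : ℕ) : Commute (derOp l r) (derOp l' r') := by
  classical
  rcases r.eq_zero_or_pos with rfl | h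
  · rw [derOp_zero]
    exact Commute.zero_left _
  rcases r'.eq_zero_or_pos with rfl | h'
  · rw [derOp_zero]
    exact Commute.zero_right _
  have hb : ⁅MvPolynomial.pderiv (R := ℂ) (l, r.toPNat h),
      MvPolynomial.pderiv (R := ℂ) (l', r'.toPNat h')⁆ = 0 := by
    refine MvPolynomial.derivation_ext fun s => ?_
    rw [Derivation.commutator_apply, MvPolynomial.pderiv_X, MvPolynomial.pderiv_X]
    simp only [Pi.single_apply, Derivation.coe_zero, Pi.zero_apply]
    split_ifs <;> simp
  refine LinearMap.ext fun v => ?_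
  have := DFunLike.congr_fun hb v
  rw [Derivation.commutator_apply] at this
  rw [Module.End.mul_apply, Module.End.mul_apply, derOp_apply l h, derOp_apply l' h',
    derOp_apply l h, derOp_apply l' h']
  exact sub_eq_zero.mp this

theorem annSeries_add (A A' : Fin n → ℕ → ℂ) :
    annSeries (A + A') = annSeries A * annSeries A' := by
  rw [annSeries, annSeries, annSeries, ← expSeries_add]
  · congr 1
    refine PowerSeries.ext fun r => ?_
    simp [Finset.sum_add_distrib, add_smul]
  · simp [derOp_zero]
  · simp [derOp_zero]
  · refine commute_of_coeff fun r r' => ?_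
    rw [PowerSeries.coeff_mk, PowerSeries.coeff_mk]
    exact Commute.sum_left _ _ _ fun l _ => Commute.sum_right _ _ _ fun l' _ =>
      ((commute_derOp l l' r r').smul_left _).smul_right _

theorem derOp_mul_X (l : Fin n) (r : ℕ) (s : Fin n × ℕ+) (v : Fock n) :
    derOp l r (MvPolynomial.X s * v) =
      MvPolynomial.X s * derOp l r v + if l = s.1 ∧ r = s.2 then v else 0 := by
  rcases r.eq_zero_or_pos with rfl | h
  · have : ¬ (l = s.1 ∧ 0 = (s.2 : ℕ)) := fun h => s.2.ne_zero h.2.symm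
    simp [derOp_zero, this]
  · rw [derOp_apply l h, derOp_apply l h, Derivation.leibniz, smul_eq_mul, smul_eq_mul]
    congr 1
    split_ifs with h2
    · have e : s = (l, r.toPNat h) := Prod.ext h2.1.symm (PNat.eq h2.2.symm)
      rw [e, MvPolynomial.pderiv_X_self, mul_one]
    · have e : s ≠ (l, r.toPNat h) := by
        rintro rfl
        exact h2 ⟨rfl, rfl⟩
      rw [MvPolynomial.pderiv_X_of_ne e, mul_zero]

/-- Taylor's formula: the exponential of a constant-coefficient derivation is a translation of the
variables. The induction on `v` needs only that the derivation kills constants and that its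
commutator with multiplication by a variable is a scalar series (`expSeries_mul_eq_add_mul`). -/
theorem coeff_annSeries_apply (A : Fin n → ℕ → ℂ) (p : ℕ) (v : Fock n) :
    (PowerSeries.coeff p (annSeries A)) v = (shiftHom A v).coeff p := by
  set D : PowerSeries (Module.End ℂ (Fock n)) :=
    PowerSeries.mk fun r => ∑ l, A l r • derOp l r with hD
  have hD0 : PowerSeries.coeff 0 D = 0 := by simp [hD, derOp_zero]
  induction v using MvPolynomial.induction_on generalizing p with
  | C a =>
    have hkill : ∀ r, (PowerSeries.coeff r D) (MvPolynomial.C a) = 0 := by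
      intro r
      rw [hD, PowerSeries.coeff_mk, LinearMap.sum_apply]
      refine Finset.sum_eq_zero fun l _ => ?_
      rw [LinearMap.smul_apply]
      rcases r.eq_zero_or_pos with rfl | h
      · rw [derOp_zero, LinearMap.zero_apply, smul_zero]
      · rw [derOp_apply l h, MvPolynomial.pderiv_C, smul_zero]
    have hpow : ∀ j : ℕ, (PowerSeries.coeff p (D ^ (j + 1))) (MvPolynomial.C a) = 0 := by
      intro j
      rw [pow_succ, PowerSeries.coeff_mul, LinearMap.sum_apply]
      refine Finset.sum_eq_zero fun x _ => ?_
      rw [Module.End.mul_apply, hkill, map_zero]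
    rw [annSeries, coeff_expSeries, LinearMap.sum_apply, Finset.sum_range_succ', shiftHom,
      MvPolynomial.aeval_C, Polynomial.algebraMap_apply, Polynomial.coeff_C,
      Finset.sum_eq_zero fun j _ => by rw [LinearMap.smul_apply, hpow, smul_zero]]
    simp only [Nat.factorial_zero, Nat.cast_one, inv_one, pow_zero, one_smul, zero_add,
      PowerSeries.coeff_one]
    split_ifs <;> simp
  | add v w hv hw => rw [map_add, map_add, Polynomial.coeff_add, hv, hw]
  | mul_X v s hv =>
    set x : Module.End ℂ (Fock n) := Algebra.lmul ℂ (Fock n) (MvPolynomial.X s) with hx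
    have hx' : ∀ w, x w = MvPolynomial.X s * w := fun _ => rfl
    -- This is the commutator of `D` with multiplication by the variable `s`.
    set c : PowerSeries (Module.End ℂ (Fock n)) :=
      PowerSeries.monomial (s.2 : ℕ) (A s.1 s.2 • (1 : Module.End ℂ (Fock n))) with hc
    have hcomm : D * PowerSeries.C x = PowerSeries.C x * D + c := by
      refine PowerSeries.ext fun r => ?_
      rw [PowerSeries.coeff_mul_C, map_add, PowerSeries.coeff_C_mul, hc, PowerSeries.coeff_monomial,
        hD, PowerSeries.coeff_mk]
      refine LinearMap.ext fun w => ?_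
      simp only [Module.End.mul_apply, LinearMap.add_apply, LinearMap.sum_apply,
        LinearMap.smul_apply, hx', derOp_mul_X,
        smul_add, Finset.sum_add_distrib, Finset.mul_sum, mul_smul_comm]
      congr 1
      rw [Finset.sum_eq_single s.1]
      · by_cases hr : r = s.2
        · simp [hr]
        · simp [hr]
      · intro l _ hl
        simp [hl]
      · simp
    have hDc : Commute D c := by
      refine commute_of_coeff fun r r' => ?_
      rw [hc, PowerSeries.coeff_monomial]
      split_ifs
      · exact (Commute.one_right _).smul_right _
      · exact Commute.zero_right _
    have key := congrArg (fun f => (PowerSeries.coeff p f) v)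
      (expSeries_mul_eq_add_mul hD0 hcomm hDc)
    simp only [PowerSeries.coeff_mul_C, add_mul, map_add, PowerSeries.coeff_C_mul,
      Module.End.mul_apply, LinearMap.add_apply] at key
    rw [mul_comm v]
    have hX : shiftHom A (MvPolynomial.X s) = Polynomial.C (MvPolynomial.X s) +
        Polynomial.C (MvPolynomial.C (A s.1 s.2)) * Polynomial.X ^ (s.2 : ℕ) :=
      MvPolynomial.aeval_X _ _
    rw [map_mul (shiftHom A), hX, ← hx', annSeries, key, ← annSeries, hv,
      add_mul, Polynomial.coeff_add, Polynomial.coeff_C_mul]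
    congr 1
    rw [mul_assoc, Polynomial.coeff_C_mul, Polynomial.coeff_X_pow_mul', hc,
      PowerSeries.monomial_eq_C_mul_X_pow, mul_assoc, PowerSeries.coeff_C_mul,
      PowerSeries.coeff_X_pow_mul']
    split_ifs
    · rw [Module.End.mul_apply, LinearMap.smul_apply, Module.End.one_apply, hv,
        MvPolynomial.smul_eq_C_mul]
    · simp

/-- The annihilation part applied to `v` is a polynomial in `z⁻¹`, so the `finsum` has finite
support, and its second index determines the first. -/
theorem mode_eq_vertexMode (A B : Fin n → ℕ → ℂ) (m : ℤ) (v : Fock n) :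
    mode (PowerSeries.map (Algebra.lmul ℂ (Fock n) : Fock n →+* Module.End ℂ (Fock n))
      (creSeries B)) (annSeries A) m v = vertexMode A B m v := by
  classical
  have hterm : ∀ p : ℕ × ℕ, (PowerSeries.coeff p.1 (PowerSeries.map
      (Algebra.lmul ℂ (Fock n) : Fock n →+* Module.End ℂ (Fock n)) (creSeries B)))
        ((PowerSeries.coeff p.2 (annSeries A)) v) =
      PowerSeries.coeff p.1 (creSeries B) * (shiftHom A v).coeff p.2 := fun p => by
    rw [PowerSeries.coeff_map, coeff_annSeries_apply]
    rfl
  rw [mode, vertexMode_apply, ← Finset.sum_filter]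
  simp_rw [hterm, finsum_eq_if]
  rw [finsum_eq_sum_of_support_subset (s := ((shiftHom A v).support.filter
    (fun p : ℕ => m ≤ (p : ℤ))).image fun p : ℕ => (((p : ℤ) - m).toNat, p))]
  · rw [Finset.sum_image (fun p _ p' _ h => (Prod.mk.inj h).2)]
    refine Finset.sum_congr rfl fun p hp => ?_
    rw [Finset.mem_filter] at hp
    rw [if_pos (by simp only; omega)]
  · rintro ⟨a, b⟩ hp
    rw [Function.mem_support] at hp
    simp only at hp
    have h1 : (b : ℤ) - a = m := by
      by_contra h
      rw [if_neg h] at hp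
      exact hp rfl
    rw [if_pos h1] at hp
    simp only [Finset.coe_image, Set.mem_image, Finset.mem_coe, Finset.mem_filter,
      Polynomial.mem_support_iff]
    exact ⟨b, ⟨right_ne_zero_of_mul hp, by omega⟩, by simp only [Prod.mk.injEq, and_true]; omega⟩

end Operators

/-! ### The modes of `Λ̃_j` and `T̃_1`, and the correlator as a sum over fillings -/

section Currents

variable {n : ℕ} (ρ : Fin 3 → ℂ) (c : Fin n → Fin 3)

/-- The coefficients of the creation part of `log Λ̃_j`. -/
def lambdaCreLog (j l : Fin n) (r : ℕ) : ℂ :=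
  1 / (cAll ρ c ^ r - (cAll ρ c)⁻¹ ^ r) *
      (-(kappa ρ r / r) * (ρ (c l))⁻¹ ^ r * (cAfter ρ c l)⁻¹ ^ r) +
    (if l < j then
      -(kappa ρ r / r) * (ρ (c l))⁻¹ ^ r * (cBefore ρ c l * qHalf ρ (c l)) ^ r else 0) +
    if l = j then kappa ρ r / r *
      ((ρ (c j))⁻¹ ^ r / (qHalf ρ (c j) ^ r - (qHalf ρ (c j))⁻¹ ^ r)) * cBefore ρ c j ^ r else 0

/-- The coefficients of the annihilation part of `log Λ̃_j`, in terms of the derivations. -/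
def lambdaAnnLog (j l : Fin n) (r : ℕ) : ℂ :=
  (if l = j then -(kappa ρ r / r) * (ρ (c j) ^ r / (qPar ρ (c j) ^ r - 1)) *
      (cBefore ρ c j)⁻¹ ^ r else 0) *
    ((r : ℂ) / kappa ρ r * (qHalf ρ (c l) ^ r - (qHalf ρ (c l))⁻¹ ^ r)) +
  1 / (cAll ρ c ^ r - (cAll ρ c)⁻¹ ^ r) * (cAll ρ c)⁻¹ ^ r *
    (kappa ρ r / r * ρ (c l) ^ r * cBefore ρ c l ^ r) *
    ((r : ℂ) / kappa ρ r * (qHalf ρ (c l) ^ r - (qHalf ρ (c l))⁻¹ ^ r))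

theorem lambdaCre_eq (j : Fin n) : lambdaCre ρ c j 1 =
    PowerSeries.map (Algebra.lmul ℂ (Fock n) : Fock n →+* Module.End ℂ (Fock n))
      (creSeries (lambdaCreLog ρ c j)) := by
  have hα : alphaOp ρ c 1 =
      PowerSeries.map (Algebra.lmul ℂ (Fock n) : Fock n →+* Module.End ℂ (Fock n))
        (creSeries fun l r => 1 / (cAll ρ c ^ r - (cAll ρ c)⁻¹ ^ r) *
          (-(kappa ρ r / r) * (ρ (c l))⁻¹ ^ r * (cAfter ρ c l)⁻¹ ^ r)) := by
    rw [alphaOp, ← expSeries_sum_aNeg]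
    congr 1
    refine PowerSeries.ext fun r => ?_
    simp only [PowerSeries.coeff_mk, bNeg, logKMinus, one_pow, mul_one, smul_neg,
      Finset.smul_sum, smul_smul]
    rw [← Finset.sum_neg_distrib]
    refine Finset.sum_congr rfl fun l _ => ?_
    rw [← neg_smul]
    congr 1
    ring
  have hφ : (((List.finRange n).filter (· < j)).map
      fun l => phiOp ρ c l (cBefore ρ c l * qHalf ρ (c l) * 1)).prod =
      PowerSeries.map (Algebra.lmul ℂ (Fock n) : Fock n →+* Module.End ℂ (Fock n))
        (creSeries fun l r => if l < j then
          -(kappa ρ r / r) * (ρ (c l))⁻¹ ^ r * (cBefore ρ c l * qHalf ρ (c l)) ^ r else 0) := by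
    have h1 : ∀ l : Fin n, phiOp ρ c l (cBefore ρ c l * qHalf ρ (c l) * 1) =
        PowerSeries.map (Algebra.lmul ℂ (Fock n) : Fock n →+* Module.End ℂ (Fock n))
          (creSeries fun l' r => if l' = l then
            -(kappa ρ r / r) * (ρ (c l))⁻¹ ^ r * (cBefore ρ c l * qHalf ρ (c l)) ^ r else 0) := by
      intro l
      rw [phiOp, mul_one, expSeries_smul_aNeg]
    simp_rw [h1]
    have h2 : ((((List.finRange n).filter (· < j)).map fun l => creSeries fun l' r => if l' = l then
        -(kappa ρ r / r) * (ρ (c l))⁻¹ ^ r * (cBefore ρ c l * qHalf ρ (c l)) ^ r else 0)).prod =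
        creSeries fun l r => if l < j then
          -(kappa ρ r / r) * (ρ (c l))⁻¹ ^ r * (cBefore ρ c l * qHalf ρ (c l)) ^ r else 0 := by
      rw [← List.prod_toFinset _ ((List.nodup_finRange n).filter _), ← creSeries_sum]
      congr 1
      funext l r
      rw [Finset.sum_apply, Finset.sum_apply, Finset.sum_ite_eq]
      simp
    rw [← h2, map_list_prod, List.map_map]
    rfl
  have hη : etaCre ρ c j (cBefore ρ c j * 1) =
      PowerSeries.map (Algebra.lmul ℂ (Fock n) : Fock n →+* Module.End ℂ (Fock n))
        (creSeries fun l r => if l = j then kappa ρ r / r *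
          ((ρ (c j))⁻¹ ^ r / (qHalf ρ (c j) ^ r - (qHalf ρ (c j))⁻¹ ^ r)) *
            cBefore ρ c j ^ r else 0) := by
    rw [etaCre, mul_one, expSeries_smul_aNeg]
  rw [lambdaCre, hα, hφ, hη, ← map_mul, ← map_mul, ← creSeries_add, ← creSeries_add]
  rfl

theorem aPos_eq (l : Fin n) (r : ℕ) : aPos ρ c l r =
    ((r : ℂ) / kappa ρ r * (qHalf ρ (c l) ^ r - (qHalf ρ (c l))⁻¹ ^ r)) • derOp l r := by
  rcases r.eq_zero_or_pos with rfl | h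
  · simp [aPos, derOp_zero]
  · have e : derOp l r = (MvPolynomial.pderiv (R := ℂ) (l, r.toPNat h)).toLinearMap := dif_pos h
    rw [e]
    exact dif_pos h

theorem lambdaAnn_eq (j : Fin n) :
    lambdaAnn ρ c j 1 = annSeries (lambdaAnnLog ρ c j) := by
  have h : lambdaAnnLog ρ c j =
      (fun l r => (if l = j then -(kappa ρ r / r) * (ρ (c j) ^ r / (qPar ρ (c j) ^ r - 1)) *
        (cBefore ρ c j)⁻¹ ^ r else 0) *
        ((r : ℂ) / kappa ρ r * (qHalf ρ (c l) ^ r - (qHalf ρ (c l))⁻¹ ^ r))) +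
      (fun l r => 1 / (cAll ρ c ^ r - (cAll ρ c)⁻¹ ^ r) * (cAll ρ c)⁻¹ ^ r *
        (kappa ρ r / r * ρ (c l) ^ r * cBefore ρ c l ^ r) *
        ((r : ℂ) / kappa ρ r * (qHalf ρ (c l) ^ r - (qHalf ρ (c l))⁻¹ ^ r))) := rfl
  rw [h, annSeries_add, lambdaAnn]
  congr 1
  · rw [etaAnn, annSeries, mul_one]
    congr 1
    refine PowerSeries.ext fun r => ?_
    rw [PowerSeries.coeff_mk, PowerSeries.coeff_mk, Finset.sum_eq_single j]
    · rw [if_pos rfl, aPos_eq, smul_smul]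
    · intro l _ hl
      rw [if_neg hl, zero_mul, zero_smul]
    · simp
  · rw [betaOp, annSeries]
    congr 1
    refine PowerSeries.ext fun r => ?_
    simp only [PowerSeries.coeff_mk, bPos, logKPlus, inv_one, one_pow, mul_one, Finset.smul_sum,
      smul_smul, aPos_eq]
    refine Finset.sum_congr rfl fun l _ => ?_
    congr 1
    ring

/-- The modes of `Λ̃_j(z)`. -/
def lambdaMode (j : Fin n) (m : ℤ) : Module.End ℂ (Fock n) :=
  vertexMode (lambdaAnnLog ρ c j) (lambdaCreLog ρ c j) m

theorem normOrdMode_singleton (u : Fin n → ℂ) (j : Fin n) (m : ℤ) (v : Fock n) :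
    normOrdMode ρ c u [(j, 1)] m v = u j • lambdaMode ρ c j m v := by
  simp only [normOrdMode, List.map_cons, List.map_nil, List.prod_singleton]
  rw [lambdaCre_eq, lambdaAnn_eq, mode_eq_vertexMode]
  rfl

theorem miuraCoeff_zero (i : Fin 3) : miuraCoeff ρ i 0 = 1 := by
  simp [miuraCoeff]

theorem neg_miuraCoeff_one (hρ : ∀ i, ρ i ≠ 0) (j : Fin n) :
    -miuraCoeff ρ (c j) 1 = yCoeff ρ c j := by
  have h : ∀ i, qHalf ρ i ≠ 0 := fun i => pow_ne_zero 2 (hρ i)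
  have hp : ∀ i, qPar ρ i = qHalf ρ i ^ 2 := fun i => by simp only [qPar, qHalf]; ring
  simp only [miuraCoeff, yCoeff, pow_one, one_pow, Finset.prod_range_one, hp, Nat.cast_zero,
    Nat.cast_one, zero_sub, neg_add_cancel, zpow_zero, one_mul, zero_add]
  set x := qHalf ρ (c j) with hx
  set w := qHalf ρ 2 with hw
  have hx0 : x ≠ 0 := h _
  have hw0 : w ≠ 0 := h _
  have e1 : x - x⁻¹ = -(x⁻¹ * (1 - x ^ 2)) := by field_simp; ring
  have e2 : w - w⁻¹ = -(w⁻¹ * (1 - w ^ 2)) := by field_simp; ring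
  rw [e1, e2, neg_div_neg_eq, mul_div_mul_comm, div_inv_eq_mul]
  ring

theorem miuraWord_single (j : Fin n) :
    miuraWord ρ (Pi.single j 1 : Fin n → ℕ) = [(j, 1)] := by
  have hsum : ∑ l ∈ Finset.univ.filter (· < j), (Pi.single j 1 : Fin n → ℕ) l = 0 :=
    Finset.sum_eq_zero fun l hl => by
      simp only [Finset.mem_filter, Finset.mem_univ, true_and] at hl
      simp [hl.ne]
  have hf : (fun i : Fin n => (List.range ((Pi.single j 1 : Fin n → ℕ) i)).map fun a =>
      (i, (qPar ρ 2)⁻¹ ^ ((∑ l ∈ Finset.univ.filter (· < i), (Pi.single j 1 : Fin n → ℕ) l) + a))) =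
      fun i => if i = j then [(j, (1 : ℂ))] else [] := by
    funext i
    by_cases h : i = j
    · subst h
      simp [hsum]
    · simp [h]
  have key : ∀ L : List (Fin n), L.Nodup → L.flatMap (fun i => if i = j then [(j, (1 : ℂ))] else []) =
      if j ∈ L then [(j, 1)] else [] := by
    intro L
    induction L with
    | nil => simp
    | cons a L ih =>
      intro hL
      rw [List.nodup_cons] at hL
      rw [List.flatMap_cons, ih hL.2]
      by_cases h : a = j
      · subst h
        simp [hL.1]
      · simp [h, Ne.symm h]
  rw [miuraWord, hf, key _ (List.nodup_finRange n), if_pos (List.mem_finRange j)]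

/-- At order one in the shift, a single Miura factor contributes its linear term and all others
contribute `1`. -/
theorem piAntidiag_one : Finset.piAntidiag (Finset.univ : Finset (Fin n)) 1 =
    Finset.univ.image fun j => (Pi.single j 1 : Fin n → ℕ) := by
  ext f
  simp only [Finset.mem_piAntidiag, Finset.mem_univ, implies_true, and_true, Finset.mem_image,
    true_and]
  constructor
  · intro h
    obtain ⟨j, hj⟩ : ∃ j, f j ≠ 0 := by
      by_contra! hall
      simp [hall] at h
    have h1 := Finset.add_sum_erase Finset.univ f (Finset.mem_univ j)
    have h0 : ∑ x, f x = 1 := h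
    rw [h0] at h1
    refine ⟨j, funext fun i => ?_⟩
    by_cases hij : i = j
    · subst hij
      rw [Pi.single_eq_same]
      omega
    · rw [Pi.single_eq_of_ne hij]
      have h2 : ∑ x ∈ Finset.univ.erase j, f x = 0 := by omega
      exact (Finset.sum_eq_zero_iff.mp h2 i (by simp [hij])).symm
  · rintro ⟨j, rfl⟩
    simp

/-- `T̃_1(z) = ∑_j y_j Λ̃_j(z)`. -/
theorem currentMode_one (hρ : ∀ i, ρ i ≠ 0) (u : Fin n → ℂ) (m : ℤ) (v : Fock n) :
    currentMode ρ c u 1 m v =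
      (∑ j, (yCoeff ρ c j * u j) • lambdaMode ρ c j m : Module.End ℂ (Fock n)) v := by
  rw [currentMode, piAntidiag_one, Finset.sum_image (fun i _ j _ h => by
    by_contra hij
    have := congrFun h i
    simp [hij] at this), Finset.smul_sum, LinearMap.sum_apply]
  refine Finset.sum_congr rfl fun j _ => ?_
  rw [miuraWord_single, normOrdMode_singleton, LinearMap.smul_apply, Finset.prod_eq_single j]
  · rw [Pi.single_eq_same, smul_smul, smul_smul, ← neg_miuraCoeff_one ρ c hρ j]
    congr 1
    ring
  · intro i _ hi
    rw [Pi.single_eq_of_ne hi, miuraCoeff_zero]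
  · simp

/-- The correlation function as a sum over fillings. -/
theorem correlatorCoeff_eq {k : ℕ} (hρ : ∀ i, ρ i ≠ 0) (u : Fin n → ℂ) (m : Fin k → ℤ) :
    correlatorCoeff ρ c u m = ∑ i : Fin k → Fin n,
      ((∏ a, yCoeff ρ c (i a)) * ∏ a, u (i a)) *
        vacuumCoeff ((List.ofFn fun a => lambdaMode ρ c (i a) (m a)).prod 1) := by
  have hfold : ∀ (L : List (Fin k)) (v : Fock n),
      L.foldr (fun a v => currentMode ρ c u 1 (m a) v) v =
        (L.map fun a => (∑ j, (yCoeff ρ c j * u j) • lambdaMode ρ c j (m a) :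
          Module.End ℂ (Fock n))).prod v := by
    intro L v
    induction L with
    | nil => rfl
    | cons a L ih =>
      rw [List.foldr_cons, List.map_cons, List.prod_cons, Module.End.mul_apply, ← ih,
        currentMode_one ρ c hρ]
  -- The modes do not commute, so the ordered product of sums is expanded as a multilinear map.
  rw [correlatorCoeff, hfold, ← List.ofFn_eq_map,
    ← MultilinearMap.mkPiAlgebraFin_apply (R := ℂ), MultilinearMap.map_sum, LinearMap.sum_apply,
    vacuumCoeff, map_sum]
  refine Finset.sum_congr rfl fun i _ => ?_
  rw [MultilinearMap.map_smul_univ, MultilinearMap.mkPiAlgebraFin_apply, LinearMap.smul_apply,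
    MvPolynomial.smul_eq_C_mul, map_mul, MvPolynomial.constantCoeff_C, Finset.prod_mul_distrib]
  rfl

/-- The formal series whose coefficients are the correlation function. -/
theorem coeff_sum_prod_contraction {k : ℕ} (hρ : ∀ i, ρ i ≠ 0) (u : Fin n → ℂ)
    (m : Fin k → ℤ) :
    (∑ i : Fin k → Fin n, HahnSeries.C ((∏ a, yCoeff ρ c (i a)) * ∏ a, u (i a)) *
      ∏ p ∈ Finset.univ.filter (fun p : Fin k × Fin k => p.1 < p.2),
        ratioSeries (contraction (lambdaAnnLog ρ c (i p.1)) (lambdaCreLog ρ c (i p.2)))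
          p.1 p.2 : Formal k).coeff (toLex m) = correlatorCoeff ρ c u m := by
  rw [correlatorCoeff_eq ρ c hρ, HahnSeries.coeff_sum]
  refine Finset.sum_congr rfl fun i _ => ?_
  rw [HahnSeries.C_mul_eq_smul, HahnSeries.coeff_smul, smul_eq_mul]
  congr 1
  exact coeff_prod_contraction (fun a => lambdaAnnLog ρ c (i a)) (fun a => lambdaCreLog ρ c (i a)) m

end Currents

/-! ### The contractions of the currents -/

/-- The scalar identity behind the contractions; here `b` collects the products of the `h m` over
`m < l`, and `a` those over `m > l`. -/
theorem sum_contraction_aux {n : ℕ} {h b a p : Fin n → ℂ} {C K : ℂ} (hh : ∀ l, h l ≠ 0)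
    (hb : ∀ l, b l ≠ 0) (ha : ∀ l, a l ≠ 0) (hp : ∀ l, p l ≠ 0) (hK : K ≠ 0)
    (hC : ∀ l, b l * h l * a l = C) (hC0 : C ≠ 0) (hδ : C - C⁻¹ ≠ 0) (hη : ∀ l, h l ^ 2 - 1 ≠ 0)
    (htotal : ∑ l, (h l ^ 2 - 1) * b l ^ 2 = C ^ 2 - 1)
    (hpartial : ∀ j, ∑ l, (if l < j then (h l ^ 2 - 1) * b l ^ 2 else 0) = b j ^ 2 - 1)
    (i j : Fin n) :
    ∑ l, ((if l = i then -K * (p i / (h i ^ 2 - 1)) * (b i)⁻¹ else 0) *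
          (K⁻¹ * (h l - (h l)⁻¹)) +
        1 / (C - C⁻¹) * C⁻¹ * (K * p l * b l) * (K⁻¹ * (h l - (h l)⁻¹))) *
      (1 / (C - C⁻¹) * (-K * (p l)⁻¹ * (a l)⁻¹) +
        (if l < j then -K * (p l)⁻¹ * (b l * h l) else 0) +
        if l = j then K * ((p j)⁻¹ / (h j - (h j)⁻¹)) * b j else 0) =
      K * C⁻¹ / (C - C⁻¹) + (if i < j then K else 0) -
        if i = j then K / (h i ^ 2 - 1) else 0 := by
  have hη' : ∀ l, h l - (h l)⁻¹ = (h l ^ 2 - 1) * (h l)⁻¹ := fun l => by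
    have := hh l
    field_simp
  have ha' : ∀ l, (a l)⁻¹ = b l * h l * C⁻¹ := fun l => by
    rw [← hC l]
    have := hh l
    have := hb l
    have := ha l
    field_simp
  have hδ' : C - C⁻¹ = (C ^ 2 - 1) * C⁻¹ := by field_simp
  have hC1 : C ^ 2 - 1 ≠ 0 := fun h0 => hδ (by rw [hδ', h0, zero_mul])
  -- Each summand is split into a part supported at `l = i`, which carries the answer, and a
  -- multiple of an expression whose sum over `l` telescopes to zero.
  have term : ∀ l, ((if l = i then -K * (p i / (h i ^ 2 - 1)) * (b i)⁻¹ else 0) *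
          (K⁻¹ * (h l - (h l)⁻¹)) +
        1 / (C - C⁻¹) * C⁻¹ * (K * p l * b l) * (K⁻¹ * (h l - (h l)⁻¹))) *
      (1 / (C - C⁻¹) * (-K * (p l)⁻¹ * (a l)⁻¹) +
        (if l < j then -K * (p l)⁻¹ * (b l * h l) else 0) +
        if l = j then K * ((p j)⁻¹ / (h j - (h j)⁻¹)) * b j else 0) =
      (if l = i then K * C⁻¹ / (C - C⁻¹) + (if i < j then K else 0) -
        (if i = j then K / (h i ^ 2 - 1) else 0) else 0) +
      K / (C ^ 2 - 1) * (-(1 / (C ^ 2 - 1)) * ((h l ^ 2 - 1) * b l ^ 2) -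
        (if l < j then (h l ^ 2 - 1) * b l ^ 2 else 0) + if l = j then b j ^ 2 else 0) := by
    intro l
    rw [hη', ha', hδ']
    have h1 := hh l
    have h2 := hb l
    have h3 := hp l
    have h4 := hη l
    have e1 : (if l = i then -K * (p i / (h i ^ 2 - 1)) * (b i)⁻¹ else 0) *
          (K⁻¹ * ((h l ^ 2 - 1) * (h l)⁻¹)) = if l = i then -p l * (b l)⁻¹ * (h l)⁻¹ else 0 := by
      split_ifs with e
      · rw [← e]; field_simp
      · rw [zero_mul]
    have e2 : 1 / ((C ^ 2 - 1) * C⁻¹) * C⁻¹ * (K * p l * b l) * (K⁻¹ * ((h l ^ 2 - 1) * (h l)⁻¹)) =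
        (h l ^ 2 - 1) * b l * p l / ((C ^ 2 - 1) * h l) := by
      field_simp
    have e3 : (if l = j then K * ((p j)⁻¹ / (h j - (h j)⁻¹)) * b j else 0) =
        if l = j then K * (p l)⁻¹ * h l * b l / (h l ^ 2 - 1) else 0 := by
      split_ifs with e
      · rw [← e, hη']; field_simp
      · rfl
    have e5 : (if l = j then b j ^ 2 else 0) = if l = j then b l ^ 2 else 0 := by
      split_ifs with e
      · rw [e]
      · rfl
    rw [e1, e2, e3, e5]
    by_cases hli : l = i
    · subst hli
      by_cases hlj : l < j
      · simp only [hlj, hlj.ne, if_true, if_false]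
        field_simp
        ring
      · by_cases hlj' : l = j
        · simp only [hlj', if_true, if_false, lt_irrefl]
          subst hlj'
          field_simp
          ring
        · simp only [hlj, hlj', if_true, if_false]
          field_simp
          ring
    · by_cases hlj : l < j
      · simp only [hli, hlj, hlj.ne, if_true, if_false]
        field_simp
        ring
      · by_cases hlj' : l = j
        · simp only [hli, hlj, if_false]
          simp only [hlj', if_true]
          subst hlj'
          field_simp
          ring
        · simp only [hli, hlj, hlj', if_false]
          field_simp
          ring
  rw [Finset.sum_congr rfl fun l _ => term l, Finset.sum_add_distrib, Finset.sum_ite_eq',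
    if_pos (Finset.mem_univ i), ← Finset.mul_sum, Finset.sum_add_distrib, Finset.sum_sub_distrib,
    ← Finset.mul_sum, htotal, hpartial, Finset.sum_ite_eq', if_pos (Finset.mem_univ j)]
  have : -(1 / (C ^ 2 - 1)) * (C ^ 2 - 1) - (b j ^ 2 - 1) + b j ^ 2 = 0 := by
    field_simp
    ring
  rw [this, mul_zero, add_zero]

section Contraction

variable {n : ℕ} {ρ : Fin 3 → ℂ} {c : Fin n → Fin 3}

theorem cBefore_mul_cAfter (l : Fin n) :
    cBefore ρ c l * qHalf ρ (c l) * cAfter ρ c l = cAll ρ c := by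
  have h1 : cAll ρ c = (∏ m ∈ Finset.univ.filter (· < l), qHalf ρ (c m)) *
      ∏ m ∈ Finset.univ.filter (fun m => ¬ m < l), qHalf ρ (c m) :=
    (Finset.prod_filter_mul_prod_filter_not _ _ _).symm
  have h2 : (Finset.univ.filter fun m => ¬ m < l) = insert l (Finset.univ.filter (l < ·)) := by
    ext m
    simp only [Finset.mem_filter, Finset.mem_univ, true_and, Finset.mem_insert, not_lt]
    rw [le_iff_eq_or_lt, eq_comm]
  rw [h1, h2, Finset.prod_insert (by simp), cBefore, cAfter, mul_assoc]

/-- Each summand is the difference of consecutive partial products of the `q_{c_l} ^ r`. -/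
theorem sum_telescope (r : ℕ) : ∑ l, ((qHalf ρ (c l) ^ r) ^ 2 - 1) * (cBefore ρ c l ^ r) ^ 2 =
    (cAll ρ c ^ r) ^ 2 - 1 := by
  have h := Finset.prod_one_add_ordered (Finset.univ : Finset (Fin n))
    (fun l => (qHalf ρ (c l) ^ r) ^ 2 - 1)
  simp only [add_sub_cancel, Finset.prod_pow] at h
  have h' : ∏ i, qHalf ρ (c i) = cAll ρ c := rfl
  have h'' : ∀ i, ∏ j ∈ Finset.univ.filter (· < i), qHalf ρ (c j) = cBefore ρ c i := fun _ => rfl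
  rw [h', ← sub_eq_iff_eq_add'] at h
  rw [h]
  exact Finset.sum_congr rfl fun i _ => by rw [h'']

theorem sum_telescope_lt (r : ℕ) (j : Fin n) :
    ∑ l, (if l < j then ((qHalf ρ (c l) ^ r) ^ 2 - 1) * (cBefore ρ c l ^ r) ^ 2 else 0) =
      (cBefore ρ c j ^ r) ^ 2 - 1 := by
  have h := Finset.prod_one_add_ordered (Finset.univ.filter (· < j) : Finset (Fin n))
    (fun l => (qHalf ρ (c l) ^ r) ^ 2 - 1)
  simp only [add_sub_cancel, Finset.prod_pow] at h
  have h' : ∏ i ∈ Finset.univ.filter (· < j), qHalf ρ (c i) = cBefore ρ c j := rfl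
  rw [h', ← sub_eq_iff_eq_add'] at h
  rw [← Finset.sum_filter, h]
  refine Finset.sum_congr rfl fun i hi => ?_
  simp only [Finset.mem_filter, Finset.mem_univ, true_and] at hi
  have : (Finset.univ.filter (· < j)).filter (· < i) = Finset.univ.filter (· < i) := by
    ext m
    simp only [Finset.mem_filter, Finset.mem_univ, true_and, and_iff_right_iff_imp]
    exact fun hm => hm.trans hi
  rw [this]
  rfl

/-- The contraction of `Λ̃_i` with `Λ̃_j` in order `r`. -/
theorem sum_lambdaLog (hρ : ∀ i, ρ i ≠ 0) {r : ℕ} (hr : r ≠ 0) (hκ : kappa ρ r ≠ 0)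
    (hδ : cAll ρ c ^ r - (cAll ρ c)⁻¹ ^ r ≠ 0) (hη : ∀ i, qPar ρ i ^ r - 1 ≠ 0) (i j : Fin n) :
    ∑ l, lambdaAnnLog ρ c i l r * lambdaCreLog ρ c j l r =
      kappa ρ r / r * (cAll ρ c)⁻¹ ^ r / (cAll ρ c ^ r - (cAll ρ c)⁻¹ ^ r) +
        (if i < j then kappa ρ r / r else 0) -
        if i = j then kappa ρ r / r / (qPar ρ (c i) ^ r - 1) else 0 := by
  have hH : ∀ i, qHalf ρ i ≠ 0 := fun i => pow_ne_zero 2 (hρ i)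
  have hr' : (r : ℂ) ≠ 0 := by exact_mod_cast hr
  have hP : ∀ i, qPar ρ i ^ r = (qHalf ρ i ^ r) ^ 2 := fun i => by simp only [qPar, qHalf]; ring
  have hbef : ∀ l, cBefore ρ c l ≠ 0 := fun l => Finset.prod_ne_zero_iff.mpr fun _ _ => hH _
  have haft : ∀ l, cAfter ρ c l ≠ 0 := fun l => Finset.prod_ne_zero_iff.mpr fun _ _ => hH _
  have hall : cAll ρ c ≠ 0 := Finset.prod_ne_zero_iff.mpr fun _ _ => hH _
  have key := sum_contraction_aux (h := fun l => qHalf ρ (c l) ^ r)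
    (b := fun l => cBefore ρ c l ^ r) (a := fun l => cAfter ρ c l ^ r)
    (p := fun l => ρ (c l) ^ r) (C := cAll ρ c ^ r) (K := kappa ρ r / r)
    (fun l => pow_ne_zero _ (hH _)) (fun l => pow_ne_zero _ (hbef l))
    (fun l => pow_ne_zero _ (haft l)) (fun l => pow_ne_zero _ (hρ _)) (div_ne_zero hκ hr')
    (fun l => by rw [← mul_pow, ← mul_pow, cBefore_mul_cAfter]) (pow_ne_zero _ hall)
    (by rwa [← inv_pow]) (fun l => by rw [← hP]; exact hη _) (sum_telescope r) (sum_telescope_lt r)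
    i j
  simp only [← inv_pow, ← hP, inv_div, ← mul_pow] at key
  simpa only [lambdaAnnLog, lambdaCreLog, mul_pow] using key

end Contraction

/-- A quotient of linear factors as a formal exponential. -/
theorem expSeries_log_mul (a b c d : ℂ) :
    expSeries (PowerSeries.mk fun r => 1 / (r : ℂ) * (a ^ r + b ^ r - c ^ r - d ^ r)) *
      ((1 - PowerSeries.C a * PowerSeries.X) * (1 - PowerSeries.C b * PowerSeries.X)) =
      (1 - PowerSeries.C c * PowerSeries.X) * (1 - PowerSeries.C d * PowerSeries.X) := by
  rw [← expSeries_neg_log, ← expSeries_neg_log, ← expSeries_neg_log, ← expSeries_neg_log,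
    ← expSeries_add (by simp) (by simp) (Commute.all _ _),
    ← expSeries_add (by simp) (by simp) (Commute.all _ _),
    ← expSeries_add (by simp) (by simp) (Commute.all _ _)]
  congr 1
  refine PowerSeries.ext fun r => ?_
  simp only [map_add, PowerSeries.coeff_mk]
  ring

/-! ### Expansion of quotients of linear factors in `z_b / z_a` -/

section Expansion

variable {k : ℕ}

theorem ratioSeries_sub (F F' : PowerSeries ℂ) (b c : Fin k) :
    ratioSeries (F - F') b c = ratioSeries F b c - ratioSeries F' b c :=
  map_sub (PowerSeries.heval _) _ _

theorem ratioSeries_one (b c : Fin k) : ratioSeries 1 b c = 1 := map_one (PowerSeries.heval _)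

theorem expand_algebraMap (p : MvPolynomial (Fin k) ℂ) :
    expand k (algebraMap _ (RatFun k) p) = expandPoly k p :=
  IsFractionRing.lift_algebraMap (expandPoly_injective k) p

theorem expand_const (a : ℂ) : expand k (const a) = HahnSeries.C a := by
  rw [const, expand_algebraMap, expandPoly, MvPolynomial.aeval_C, algebraMap_formal]

theorem formalInv_mul_formalVar (b : Fin k) : formalInv b * formalVar b = 1 := by
  rw [formalInv, formalVar, HahnSeries.single_mul_single, ← toLex_add, add_neg_cancel, one_mul]
  rfl

theorem expand_ratio (b c : Fin k) : expand k (ratio b c) = formalInv b * formalVar c := by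
  have hX : ∀ i : Fin k, expand k (algebraMap _ (RatFun k) (MvPolynomial.X i)) = formalVar i :=
    fun i => by rw [expand_algebraMap, expandPoly, MvPolynomial.aeval_X]
  rw [ratio, map_div₀, hX, hX, div_eq_mul_inv, mul_comm,
    ← eq_inv_of_mul_eq_one_left (formalInv_mul_formalVar b)]

theorem expand_linFactor (a : ℂ) {b c : Fin k} (h : b < c) :
    expand k (linFactor a (ratio b c)) =
      ratioSeries (1 - PowerSeries.C a * PowerSeries.X) b c := by
  rw [linFactor, map_sub, map_one, map_mul, expand_const, expand_ratio, ← ratioSeries_X h,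
    ← ratioSeries_C a b c, ← ratioSeries_mul, ratioSeries_sub, ratioSeries_one]

/-- As an exponential, `1 - a X` is an invertible power series, and invertibility survives the
substitution. -/
theorem expand_linFactor_ne_zero (a : ℂ) {b c : Fin k} (h : b < c) :
    expand k (linFactor a (ratio b c)) ≠ 0 := by
  rw [expand_linFactor a h, ← expSeries_neg_log]
  have h1 : expSeries (PowerSeries.mk fun r => -(1 / (r : ℂ) * a ^ r)) *
      expSeries (-PowerSeries.mk fun r => -(1 / (r : ℂ) * a ^ r)) = 1 := by
    rw [← expSeries_add (by simp) (by simp) (Commute.all _ _), add_neg_cancel, expSeries_zero]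
  have h2 := congrArg (fun F => ratioSeries F b c) h1
  simp only [ratioSeries_mul] at h2
  exact left_ne_zero_of_mul_eq_one (h2.trans (ratioSeries_one b c))

/-- `expand` and `ratioSeries` are both multiplicative, so the identity of power series with
denominators cleared is enough. -/
theorem expand_linFactor_div {a a' d d' : ℂ} {F : PowerSeries ℂ}
    (hF : F * ((1 - PowerSeries.C a * PowerSeries.X) * (1 - PowerSeries.C a' * PowerSeries.X)) =
      (1 - PowerSeries.C d * PowerSeries.X) * (1 - PowerSeries.C d' * PowerSeries.X))
    {b c : Fin k} (h : b < c) :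
    expand k (linFactor d (ratio b c) * linFactor d' (ratio b c) /
      (linFactor a (ratio b c) * linFactor a' (ratio b c))) = ratioSeries F b c := by
  rw [map_div₀, map_mul, map_mul, div_eq_iff (mul_ne_zero (expand_linFactor_ne_zero a h)
    (expand_linFactor_ne_zero a' h)), expand_linFactor a h, expand_linFactor a' h,
    expand_linFactor d h, expand_linFactor d' h, ← ratioSeries_mul, ← ratioSeries_mul,
    ← ratioSeries_mul, hF]

end Expansion

/-! ### Contractions dressed with the structure function -/

section Assembly

variable {N M k : ℕ} {qr tr q t : ℂ}

theorem specRoots_ne_zero (hqr : qr ≠ 0) (htr : tr ≠ 0) (i : Fin 3) : specRoots qr tr i ≠ 0 := by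
  fin_cases i <;> simp [specRoots, hqr, htr]

theorem qPar_specRoots_pow_ne_one (hq : q = qr ^ 4) (ht : t = tr ^ 4)
    (hgen : ∀ a b : ℤ, q ^ a * t ^ b = 1 → a = 0 ∧ b = 0) {r : ℕ} (hr : r ≠ 0) (i : Fin 3) :
    qPar (specRoots qr tr) i ^ r - 1 ≠ 0 := by
  intro h
  rw [sub_eq_zero] at h
  fin_cases i
  · rw [Fin.zero_eta, qPar_specRoots_zero, ← hq] at h
    have := hgen r 0 (by simpa using h)
    omega
  · rw [Fin.mk_one, qPar_specRoots_one, ← hq, ← ht] at h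
    have := hgen (-r) r (by simpa [mul_pow] using h)
    omega
  · rw [show (⟨2, by decide⟩ : Fin 3) = 2 from rfl, qPar_specRoots_two, ← ht] at h
    have := hgen 0 (-r) (by simpa using h)
    omega

theorem cAll_colours_sq (hq : q = qr ^ 4) (ht : t = tr ^ 4) :
    cAll (specRoots qr tr) (colours N M) ^ 2 = t⁻¹ ^ N * q ^ M := by
  have h : ∀ i, qHalf (specRoots qr tr) i ^ 2 = qPar (specRoots qr tr) i := fun i => by
    simp only [qPar, qHalf]; ring
  rw [cAll, ← Finset.prod_pow, Fin.prod_univ_add]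
  simp only [h, colours, Fin.val_castAdd, Fin.is_lt, if_true, Fin.val_natAdd,
    not_lt.mpr (Nat.le_add_right _ _), if_false, Finset.prod_const, Finset.card_univ,
    Fintype.card_fin, qPar_specRoots_zero, qPar_specRoots_two, hq, ht]

/-- Since `C² = t^{-N} q^M`, a power of `C²` equals `1` only if `N = M = 0`; this is where that case
has to be excluded. -/
theorem cAll_colours_pow_sub_ne_zero (hNM : (N, M) ≠ (0, 0)) (hq : q = qr ^ 4) (ht : t = tr ^ 4)
    (hC : cAll (specRoots qr tr) (colours N M) ≠ 0)
    (hgen : ∀ a b : ℤ, q ^ a * t ^ b = 1 → a = 0 ∧ b = 0) {r : ℕ} (hr : r ≠ 0) :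
    cAll (specRoots qr tr) (colours N M) ^ r - (cAll (specRoots qr tr) (colours N M))⁻¹ ^ r ≠ 0 := by
  intro h
  have hr0 := pow_ne_zero r hC
  have h1 : (cAll (specRoots qr tr) (colours N M) ^ 2) ^ r = 1 := by
    rw [inv_pow, sub_eq_zero] at h
    rw [← pow_mul, mul_comm, pow_mul, pow_two]
    nth_rewrite 2 [h]
    exact mul_inv_cancel₀ hr0
  rw [cAll_colours_sq hq ht] at h1
  have h2 := hgen (M * r : ℕ) (-(N * r : ℕ)) (by
    rw [zpow_neg, zpow_natCast, zpow_natCast, pow_mul, pow_mul, ← inv_pow, ← inv_pow, ← mul_pow,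
      mul_comm, h1])
  apply hNM
  have hM : M * r = 0 := by omega
  have hN : N * r = 0 := by omega
  rw [(Nat.mul_eq_zero.mp hM).resolve_right hr, (Nat.mul_eq_zero.mp hN).resolve_right hr]

/-- The logarithm of the structure function times a contraction, as a scalar identity. -/
theorem structF_scalar {C w1 w2 w3 R x : ℂ} (hw : w1 * w2 * w3 = 1) (hw3 : w3 - w3⁻¹ ≠ 0)
    (hC : C - C⁻¹ ≠ 0) (h1 : w1 ≠ 0) (h2 : w2 ≠ 0) (h3 : w3 ≠ 0) :
    R * (w3 - w3⁻¹) * (C * w3⁻¹ - C⁻¹ * w3) *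
        ((w1 - w1⁻¹) * (w2 - w2⁻¹) / ((C - C⁻¹) * (w3 - w3⁻¹))) +
      ((w1 ^ 2 - 1) * (w2 ^ 2 - 1) * (w3 ^ 2 - 1) * R * C⁻¹ / (C - C⁻¹) + x) =
      R * ((w1 ^ 2 - 1) * (w2 ^ 2 - 1)) + x := by
  have e0 : w3⁻¹ = w1 * w2 := inv_eq_of_mul_eq_one_left hw
  have e1 : (w1 - w1⁻¹) * (w2 - w2⁻¹) = (w1 ^ 2 - 1) * (w2 ^ 2 - 1) * w3 := by
    have : w3 = w1⁻¹ * w2⁻¹ := by rw [← mul_inv, ← e0, inv_inv]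
    rw [this]
    field_simp
  have e2 : R * (w3 - w3⁻¹) * (C * w3⁻¹ - C⁻¹ * w3) *
        ((w1 - w1⁻¹) * (w2 - w2⁻¹) / ((C - C⁻¹) * (w3 - w3⁻¹))) =
      R * (C * w3⁻¹ - C⁻¹ * w3) * ((w1 - w1⁻¹) * (w2 - w2⁻¹)) / (C - C⁻¹) := by
    generalize w3 - w3⁻¹ = s at hw3 ⊢
    generalize C - C⁻¹ = δ at hC ⊢
    generalize C * w3⁻¹ - C⁻¹ * w3 = y
    generalize (w1 - w1⁻¹) * (w2 - w2⁻¹) = z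
    field_simp
  have e3 : w3⁻¹ * w3 = 1 := inv_mul_cancel₀ h3
  rw [e2, e1, ← add_assoc, ← add_div, add_left_inj, div_eq_iff hC]
  linear_combination (R * C * (w1 ^ 2 - 1) * (w2 ^ 2 - 1)) * e3

/-- Once `C` has cancelled, the exponent is `(q₁^r - 1)(q₂^r - 1) / r` for `i > j`. It is multiplied
by `q₃^r` for `i < j`, and by `1 - (q₃^r - 1) / (q_{c_i}^r - 1)` for `i = j`, which is zero for
colour 3. Expanding with `q₁ q₂ q₃ = 1` gives the four cases. -/
theorem structF_mul_contraction (hNM : (N, M) ≠ (0, 0)) (hq : q = qr ^ 4) (ht : t = tr ^ 4)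
    (hq0 : q ≠ 0) (ht0 : t ≠ 0)
    (hgen : ∀ a b : ℤ, q ^ a * t ^ b = 1 → a = 0 ∧ b = 0) (i j : Fin (N + M)) :
    structF (specRoots qr tr) (colours N M) 1 1 *
      contraction (lambdaAnnLog (specRoots qr tr) (colours N M) i)
        (lambdaCreLog (specRoots qr tr) (colours N M) j) =
      if i < j then expSeries (PowerSeries.mk fun r =>
        1 / (r : ℂ) * (t⁻¹ ^ r + 1 ^ r - q⁻¹ ^ r - (q * t⁻¹) ^ r))
      else if j < i then expSeries (PowerSeries.mk fun r =>
        1 / (r : ℂ) * (t ^ r + 1 ^ r - q ^ r - (q⁻¹ * t) ^ r))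
      else if N ≤ (i : ℕ) then expSeries (PowerSeries.mk fun r =>
        1 / (r : ℂ) * (t ^ r + t⁻¹ ^ r - q⁻¹ ^ r - q ^ r))
      else 1 := by
  have hqr : qr ≠ 0 := by rintro rfl; exact hq0 (by rw [hq]; norm_num)
  have htr : tr ≠ 0 := by rintro rfl; exact ht0 (by rw [ht]; norm_num)
  have hρ := specRoots_ne_zero hqr htr
  set ρ := specRoots qr tr with hρdef
  set c := colours N M with hc
  have hH : ∀ i, qHalf ρ i ≠ 0 := fun i => pow_ne_zero 2 (hρ i)
  have hall : cAll ρ c ≠ 0 := Finset.prod_ne_zero_iff.mpr fun _ _ => hH _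
  have hprod : qHalf ρ 0 * qHalf ρ 1 * qHalf ρ 2 = 1 := by
    simp only [qHalf, hρdef, specRoots, Matrix.cons_val_zero, Matrix.cons_val_one,
      Matrix.cons_val]
    field_simp
  have hP : ∀ i (r : ℕ), (qHalf ρ i ^ r) ^ 2 = qPar ρ i ^ r := fun i r => by
    simp only [qPar, qHalf]; ring
  have q0 : qPar ρ 0 = q := by rw [hq]; rfl
  have q1 : qPar ρ 1 = q⁻¹ * t := by rw [hq, ht]; exact qPar_specRoots_one qr tr
  have q2 : qPar ρ 2 = t⁻¹ := by rw [ht]; exact qPar_specRoots_two qr tr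
  have hlog : ∀ r : ℕ, r ≠ 0 →
      1 / (r : ℂ) * (qHalf ρ 2 ^ (min 1 1 * r) - (qHalf ρ 2)⁻¹ ^ (min 1 1 * r)) *
        (cAll ρ c ^ r * (qHalf ρ 2)⁻¹ ^ (max 1 1 * r) -
          (cAll ρ c)⁻¹ ^ r * qHalf ρ 2 ^ (max 1 1 * r)) *
        ((qHalf ρ 0 ^ r - (qHalf ρ 0)⁻¹ ^ r) * (qHalf ρ 1 ^ r - (qHalf ρ 1)⁻¹ ^ r) /
          ((cAll ρ c ^ r - (cAll ρ c)⁻¹ ^ r) * (qHalf ρ 2 ^ r - (qHalf ρ 2)⁻¹ ^ r))) +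
        ∑ l, lambdaAnnLog ρ c i l r * lambdaCreLog ρ c j l r =
      1 / (r : ℂ) * ((q ^ r - 1) * ((q⁻¹ * t) ^ r - 1)) +
        ((if i < j then kappa ρ r / r else 0) -
        if i = j then kappa ρ r / r / (qPar ρ (c i) ^ r - 1) else 0) := by
    intro r hr
    have hη := qPar_specRoots_pow_ne_one hq ht hgen hr
    have hκ : kappa ρ r ≠ 0 := Finset.prod_ne_zero_iff.mpr fun i _ => hη i
    have hδ := cAll_colours_pow_sub_ne_zero hNM hq ht hall hgen hr
    have hκ' : kappa ρ r = ((qHalf ρ 0 ^ r) ^ 2 - 1) * ((qHalf ρ 1 ^ r) ^ 2 - 1) *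
        ((qHalf ρ 2 ^ r) ^ 2 - 1) := by
      rw [kappa, Fin.prod_univ_three, hP, hP, hP]
    have hw3 : qHalf ρ 2 ^ r - (qHalf ρ 2 ^ r)⁻¹ ≠ 0 := by
      have h0 := pow_ne_zero r (hH 2)
      intro h
      apply hη 2
      rw [← hP]
      have h1 : qHalf ρ 2 ^ r * (qHalf ρ 2 ^ r - (qHalf ρ 2 ^ r)⁻¹) = 0 := by rw [h, mul_zero]
      rw [mul_sub, mul_inv_cancel₀ h0] at h1
      rw [pow_two]
      exact h1
    rw [sum_lambdaLog hρ hr hκ hδ hη, min_self, max_self, one_mul, add_sub_assoc]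
    have key := structF_scalar (C := cAll ρ c ^ r) (w1 := qHalf ρ 0 ^ r) (w2 := qHalf ρ 1 ^ r)
      (w3 := qHalf ρ 2 ^ r) (R := 1 / (r : ℂ))
      (x := (if i < j then kappa ρ r / r else 0) -
        if i = j then kappa ρ r / r / (qPar ρ (c i) ^ r - 1) else 0)
      (by rw [← mul_pow, ← mul_pow, hprod, one_pow]) hw3 (by rwa [← inv_pow])
      (pow_ne_zero _ (hH _)) (pow_ne_zero _ (hH _)) (pow_ne_zero _ (hH _))
    rw [← hκ'] at key
    simp only [← inv_pow, hP, q0, q1] at key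
    rw [← key]
    congr 2
    ring
  have hsum : structF ρ c 1 1 * contraction (lambdaAnnLog ρ c i) (lambdaCreLog ρ c j) =
      expSeries (PowerSeries.mk fun r => 1 / (r : ℂ) * ((q ^ r - 1) * ((q⁻¹ * t) ^ r - 1)) +
        ((if i < j then kappa ρ r / r else 0) -
        if i = j then kappa ρ r / r / (qPar ρ (c i) ^ r - 1) else 0)) := by
    rw [structF, contraction, ← expSeries_add (by simp) (by simp) (Commute.all _ _)]
    congr 1
    refine PowerSeries.ext fun r => ?_
    rw [map_add, PowerSeries.coeff_mk, PowerSeries.coeff_mk, PowerSeries.coeff_mk]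
    -- In degree zero both sides vanish through division by `0` and the convention in `contraction`.
    by_cases hr : r = 0
    · subst hr
      simp
    · rw [if_neg hr]
      exact hlog r hr
  have hκq : ∀ r : ℕ, kappa ρ r / r =
      1 / (r : ℂ) * ((q ^ r - 1) * ((q⁻¹ * t) ^ r - 1) * (t⁻¹ ^ r - 1)) := fun r => by
    rw [kappa, Fin.prod_univ_three, q0, q1, q2]
    ring
  rw [hsum]
  have hqr0 : ∀ r : ℕ, q ^ r ≠ 0 := fun r => pow_ne_zero r hq0
  have htr0 : ∀ r : ℕ, t ^ r ≠ 0 := fun r => pow_ne_zero r ht0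
  rcases lt_trichotomy i j with h | h | h
  · rw [if_pos h]
    congr 1
    refine PowerSeries.ext fun r => ?_
    have := hqr0 r
    have := htr0 r
    simp only [PowerSeries.coeff_mk, h, h.ne, if_true, if_false, hκq, one_pow, mul_pow, inv_pow]
    generalize 1 / (r : ℂ) = R
    field_simp
    ring
  · subst h
    simp only [lt_irrefl, if_false, if_true]
    by_cases hN : N ≤ (i : ℕ)
    · rw [if_pos hN]
      congr 1
      refine PowerSeries.ext fun r => ?_
      by_cases hr : r = 0
      · subst hr
        simp
      have h1 := qPar_specRoots_pow_ne_one hq ht hgen hr 0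
      have hci : c i = 0 := by rw [hc, colours, if_neg (not_lt.mpr hN)]
      rw [q0] at h1
      have := hqr0 r
      have := htr0 r
      simp only [PowerSeries.coeff_mk, hci, q0, hκq, mul_pow, inv_pow]
      generalize 1 / (r : ℂ) = R
      field_simp
      ring
    · rw [if_neg hN, ← expSeries_zero]
      congr 1
      refine PowerSeries.ext fun r => ?_
      by_cases hr : r = 0
      · subst hr
        simp
      have h1 := qPar_specRoots_pow_ne_one hq ht hgen hr 2
      have hci : c i = 2 := by rw [hc, colours, if_pos (not_le.mp hN)]
      simp only [PowerSeries.coeff_mk, hci, hκq, map_zero]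
      rw [q2] at h1 ⊢
      generalize 1 / (r : ℂ) = R
      rw [mul_div_assoc, mul_div_cancel_right₀ _ h1]
      ring
  · rw [if_neg h.not_gt, if_pos h]
    congr 1
    refine PowerSeries.ext fun r => ?_
    have := hqr0 r
    simp only [PowerSeries.coeff_mk, h.not_gt, h.ne', if_false, one_pow, mul_pow, inv_pow]
    field_simp
    ring

theorem expand_dFactor (hNM : (N, M) ≠ (0, 0)) (hq : q = qr ^ 4) (ht : t = tr ^ 4)
    (hq0 : q ≠ 0) (ht0 : t ≠ 0)
    (hgen : ∀ a b : ℤ, q ^ a * t ^ b = 1 → a = 0 ∧ b = 0) (i j : Fin (N + M)) {a b : Fin k}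
    (hab : a < b) :
    expand k (dFactor (specRoots qr tr) N M i j (ratio a b)) =
      ratioSeries (structF (specRoots qr tr) (colours N M) 1 1) a b *
        ratioSeries (contraction (lambdaAnnLog (specRoots qr tr) (colours N M) i)
          (lambdaCreLog (specRoots qr tr) (colours N M) j)) a b := by
  rw [← ratioSeries_mul, structF_mul_contraction hNM hq ht hq0 ht0 hgen, dFactor_eq hq ht]
  split_ifs
  · exact expand_linFactor_div (expSeries_log_mul _ _ _ _) hab
  · exact expand_linFactor_div (expSeries_log_mul _ _ _ _) hab
  · exact expand_linFactor_div (expSeries_log_mul _ _ _ _) hab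
  · rw [map_one, ratioSeries_one]

end Assembly

end QuantumCorner

end

open QuantumCorner in
theorem lemma4p3 (N M k : ℕ) (hNM : (N, M) ≠ (0, 0)) (lam : Nat.Partition k)
    (qr tr q t : ℂ) (hq : q = qr ^ 4) (ht : t = tr ^ 4) (hq0 : q ≠ 0) (ht0 : t ≠ 0)
    (hgen : ∀ a b : ℤ, q ^ a * t ^ b = 1 → a = 0 ∧ b = 0)
    (u : Fin (N + M) → ℂ) :
    ∃ (G : Formal k) (F : RatFun k) (L : (Fin k → Fin (N + M)) → ℂ),
      (∀ m : Fin k → ℤ,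
        G.coeff (toLex m) = correlatorCoeff (specRoots qr tr) (colours N M) u m) ∧
      expand k F =
        expand k (normFactor (specRoots qr tr) lam) *
          (∏ p ∈ Finset.univ.filter (fun p : Fin k × Fin k => p.1 < p.2),
            ratioSeries (structF (specRoots qr tr) (colours N M) 1 1) p.1 p.2) * G ∧
      (∀ i ∈ RSSYBT N M lam,
        HasSpecLimit lam q t (fillingTerm (specRoots qr tr) N M u lam i) (L i)) ∧
      (∀ i ∉ RSSYBT N M lam,
        HasSpecLimit lam q t (fillingTerm (specRoots qr tr) N M u lam i) 0) ∧
      HasSpecLimit lam q t F (∑ i ∈ RSSYBT N M lam, L i) := by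
  have hqr : qr ≠ 0 := by rintro rfl; exact hq0 (by rw [hq]; norm_num)
  have htr : tr ≠ 0 := by rintro rfl; exact ht0 (by rw [ht]; norm_num)
  choose L hL hL0 using
    exists_hasSpecLimit_fillingTerm (lam := lam) (N := N) (M := M) hq ht hq0 ht0 hgen u
  -- The rational function is the sum over all fillings; the formal series is the sum of products of
  -- contractions.
  refine ⟨_, ∑ i, fillingTerm (specRoots qr tr) N M u lam i, L,
    coeff_sum_prod_contraction (specRoots qr tr) (colours N M) (specRoots_ne_zero hqr htr) u,
    ?_, fun i _ => hL i, fun i hi => hL0 i hi ▸ hL i, ?_⟩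
  · rw [map_sum, Finset.mul_sum]
    refine Finset.sum_congr rfl fun i _ => ?_
    rw [fillingTerm, map_mul, map_mul, map_prod, expand_const, Finset.prod_congr rfl fun p hp =>
      expand_dFactor hNM hq ht hq0 ht0 hgen (i p.1) (i p.2) (Finset.mem_filter.mp hp).2,
      Finset.prod_mul_distrib]
    ring
  -- The limit is taken termwise over all fillings; those that are not bitableaux contribute zero
  -- and are dropped.
  · have h := hasSpecLimit_sum Finset.univ fun i _ => hL i
    rwa [← Finset.sum_subset (Finset.subset_univ (RSSYBT N M lam)) fun i _ hi => hL0 i hi] at h
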